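/- **Conventions.** For $\kappa\in\mathbb R$ let $R_\kappa\in(0,\infty]$ be the diameter of the simply connected complete surface of constant curvature $\kappa$. A GCBA space of curvature $\le\kappa$ is a separable, locally compact metric space $X$ in which every point has a $\mathrm{CAT}(\kappa)$ neighborhood and every local geodesic on a nondegenerate compact interval extends to a local geodesic on a larger interval. An open ball $U=B_{r_0}(x_0)$ in $X$ with $0<r_0\le\min\{1,R_\kappa/100\}$ is *tiny* if $\bar B_{10r_0}(x_0)$ is a compact $\mathrm{CAT}(\kappa)$ space. Put $\tilde U=\bar B_{5r_0}(x_0)$. The ball $U$ has *capacity bounded by $N$* if no ball of radius $r$ in the metric space $\tilde U$ has an $r/2$-separated subset with more than $N$ elements. For $x\in X$ let $\Sigma_x$ be the space of directions (the completion of the set of geodesic directions at $x$ with the angle metric $d$). A $k$-tuple $(v_i)$ in $\Sigma_x$ is *$\delta$-spherical* if there is a $k$-tuple $(\bar v_i)$ in $\Sigma_x$ with $d(v_i,w)+d(w,\bar v_i)<\pi+\delta$ for all $w\in\Sigma_x$ and all $i$, and $d(v_i,\bar v_j),\ d(v_i,v_j),\ d(\bar v_i,\bar v_j)<\frac\pi2+\delta$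 for all $i\ne j$. Let $X_{k,\delta}$ be the set of points $x\in X$ such that $\Sigma_x$ contains a $\delta$-spherical $k$-tuple. For points $p_1,\dots,p_k\in\tilde U$, the map $F=(d(p_1,\cdot),\dots,d(p_k,\cdot))$ to $\mathbb R^k$ is a *$(k,\delta)$-strainer map at* $x\in U$ if all $p_i\ne x$ and the starting directions at $x$ of the geodesics $xp_i$ form a $\delta$-spherical $k$-tuple; it is a *$(k,\delta)$-strainer map on* $V\subset U$ if this holds at every $x\in V$. A map is *$L$-biLipschitz* on $K$ if $\frac1L d(x,y)\le |F(x)-F(y)|\le L\,d(x,y)$ for all $x,y\in K$. $\mathcal H^k$ is the $k$-dimensional Hausdorff measure, normalized to be Lebesgue measure on $\mathbb R^k$. **Theorem.** (1) For every $N\in\mathbb N$ and $\delta>0$ there is $C_1=C_1(N,\delta)>0$ with the following properties. Let $U$ be a tiny ball of radius $r_0$ and capacity bounded by $N$ in a GCBA space $X$, let $k\ge 0$, and let $F:V\to\mathbb R^k$ be a $(k,\delta)$-strainer map on an open set $V\subset U$. Let $E$ be the set of points $x\in V$ at which $F$ cannot be extended to a $(k+1,12\delta)$-strainer map $(F,d(q,\cdot))$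 with some $q\in\tilde U$. Then: * $E$ meets each fiber of $F$ in at most $C_1$ points; * $E$ is a union of countably many compact sets on each of which $F$ is $C_1$-biLipschitz; * $\mathcal H^k(E)\le C_1^{k+1}\,\mathcal H^k(F(E))\le C_1^{2k+1}\cdot 10\cdot r_0^k$; * $V\setminus X_{k+1,12\delta}$ is a union of countably many compact sets on each of which $F$ is $C_1$-biLipschitz, and $\mathcal H^k(V\setminus X_{k+1,12\delta})\le C_1^{2k+1}\cdot 10\cdot r_0^k$. (2) If $F:V\to\mathbb R^k$ is a $(k,\delta)$-strainer map, $\delta>0$, on an open subset $V$ of any tiny ball of a GCBA space $X$, then $V\setminus X_{k+1,12\delta}$ is a union of countably many compact sets $K_i$ such that $F:K_i\to F(K_i)$ is biLipschitz, with a constant that does not depend on $i$. -/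

import Mathlib

open Set Filter Topology MeasureTheory

universe u

noncomputable section

namespace GCBA

/-! ### Geodesics, `CAT(κ)` spaces, curvature bounded above -/

/-- `γ` restricted to `[a, b]` is a geodesic, i.e. an isometric embedding of `[a, b]`. -/
def IsGeodesicOn {X : Type u} [MetricSpace X] (γ : ℝ → X) (a b : ℝ) : Prop :=
  ∀ s ∈ Icc a b, ∀ t ∈ Icc a b, dist (γ s) (γ t) = |s - t|

/-- `γ` restricted to `[a, b]` is a local geodesic: near every parameter it is a geodesic. -/
def IsLocalGeodesicOn {X : Type u} [MetricSpace X] (γ : ℝ → X) (a b : ℝ) : Prop :=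
  ∀ t ∈ Icc a b, ∃ ε > 0, ∀ s ∈ Icc a b, ∀ s' ∈ Icc a b,
    |s - t| < ε → |s' - t| < ε → dist (γ s) (γ s') = |s - s'|

/-- `γ`, on `[0, d(x, y)]`, is a geodesic from `x` to `y`. -/
def IsGeodesicFromTo {X : Type u} [MetricSpace X] (γ : ℝ → X) (x y : X) : Prop :=
  IsGeodesicOn γ 0 (dist x y) ∧ γ 0 = x ∧ γ (dist x y) = y

/-- `p` lies on some geodesic from `x` to `y`. -/
def OnGeodesic {X : Type u} [MetricSpace X] (x y p : X) : Prop :=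
  ∃ γ : ℝ → X, IsGeodesicFromTo γ x y ∧ ∃ t ∈ Icc (0 : ℝ) (dist x y), γ t = p

/-- The diameter `R_κ ∈ (0, ∞]` of the complete simply connected surface of curvature `κ`. -/
def modelDiam (κ : ℝ) : ENNReal :=
  if 0 < κ then ENNReal.ofReal (Real.pi / Real.sqrt κ) else ⊤

/-- All triangles of `X` of perimeter `< 2 R` are not thicker than their comparison triangles in
the model surface with set of points `M` and distance function `dM`. Here `p` is a point on a side
`xy` and `q` is a point on a side `xz`; since `x, y, z` are arbitrary, this covers all
pairs of sides. The points `x' y' z'` are the vertices of a comparison triangle, and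
`p' q'` are the comparison points on it. -/
def TrianglesThin (X : Type u) [MetricSpace X] (R : ENNReal) (M : Type) (dM : M → M → ℝ) : Prop :=
  ∀ x y z p q : X, edist x y + edist y z + edist z x < 2 * R →
    OnGeodesic x y p → OnGeodesic x z q →
    ∀ x' y' z' p' q' : M,
      dM x' y' = dist x y → dM y' z' = dist y z → dM x' z' = dist x z →
      dM x' p' = dist x p → dM p' y' = dist p y →
      dM x' q' = dist x q → dM q' z' = dist q z →
      dist p q ≤ dM p' q'

/-- `CAT(κ)` spaces. The model surface is the unit sphere in `ℝ³` with the angular metric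
divided by `√κ` if `κ > 0`, the Euclidean plane if `κ = 0`, and the hyperbolic (upper half) plane
with metric divided by `√(-κ)` if `κ < 0`. -/
structure IsCAT (κ : ℝ) (X : Type u) [MetricSpace X] : Prop where
  complete : CompleteSpace X
  geodesic : ∀ x y : X, edist x y < modelDiam κ → ∃ γ : ℝ → X, IsGeodesicFromTo γ x y
  thin_pos : 0 < κ → TrianglesThin X (modelDiam κ)
    (Metric.sphere (0 : EuclideanSpace ℝ (Fin 3)) 1)
    (fun a b => InnerProductGeometry.angle
      (a : EuclideanSpace ℝ (Fin 3)) (b : EuclideanSpace ℝ (Fin 3)) / Real.sqrt κ)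
  thin_zero : κ = 0 → TrianglesThin X (modelDiam κ)
    (EuclideanSpace ℝ (Fin 2)) (fun a b => dist a b)
  thin_neg : κ < 0 → TrianglesThin X (modelDiam κ)
    UpperHalfPlane (fun a b => dist a b / Real.sqrt (-κ))

/-- Every local geodesic on a nondegenerate compact interval extends, as a local geodesic, to a
larger interval. -/
def LocallyGeodesicallyComplete (X : Type u) [MetricSpace X] : Prop :=
  ∀ (γ : ℝ → X) (a b : ℝ), a < b → IsLocalGeodesicOn γ a b →
    ∃ ε > 0, ∃ γ' : ℝ → X, EqOn γ' γ (Icc a b) ∧ IsLocalGeodesicOn γ' (a - ε) (b + ε)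

/-- GCBA spaces with curvature bounded above by `κ`: separable, locally compact, locally
geodesically complete metric spaces each of whose points has a `CAT(κ)` neighborhood. -/
structure IsGCBA (κ : ℝ) (X : Type u) [MetricSpace X] : Prop where
  separable : TopologicalSpace.SeparableSpace X
  locallyCompact : LocallyCompactSpace X
  geodesicallyComplete : LocallyGeodesicallyComplete X
  curvature_le : ∀ x : X, ∃ O ∈ 𝓝 x, IsCAT κ O

/-! ### Tiny balls and their capacity -/

/-- `B_{r₀}(x₀)` is a tiny ball of a space of curvature at most `κ`: its radius is at most
`min {1, R_κ / 100}` and the closed concentric ball of radius `10 r₀` is a compact `CAT(κ)`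
space. -/
structure IsTinyBall (κ : ℝ) {X : Type u} [MetricSpace X] (x₀ : X) (r₀ : ℝ) : Prop where
  radius_pos : 0 < r₀
  radius_le_one : r₀ ≤ 1
  radius_le : ENNReal.ofReal (100 * r₀) ≤ modelDiam κ
  compact : IsCompact (Metric.closedBall x₀ (10 * r₀))
  cat : IsCAT κ (Metric.closedBall x₀ (10 * r₀))

/-- A metric space is `N`-doubling if no ball of radius `r` has an `r/2`-separated subset with more
than `N` elements. -/
def IsDoubling (N : ℕ) (Y : Type u) [MetricSpace Y] : Prop :=
  ∀ (y : Y) (r : ℝ), 0 < r → ∀ S : Finset Y, (∀ a ∈ S, a ∈ Metric.ball y r) →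
    (∀ a ∈ S, ∀ b ∈ S, a ≠ b → r / 2 ≤ dist a b) → S.card ≤ N

/-- The tiny ball `B_{r₀}(x₀)` has capacity bounded by `N`. -/
def CapacityBoundedBy (N : ℕ) {X : Type u} [MetricSpace X] (x₀ : X) (r₀ : ℝ) : Prop :=
  IsDoubling N (Metric.closedBall x₀ (5 * r₀))

/-! ### Angles and spaces of directions -/

/-- Geodesics (of positive length) starting at `x`. Only the values on `[0, length]` matter. -/
structure GeodesicAt {X : Type u} [MetricSpace X] (x : X) where
  toFun : ℝ → X
  length : ℝ
  length_pos : 0 < length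
  source : toFun 0 = x
  isGeodesic : IsGeodesicOn toFun 0 length

/-- The angle opposite to `c` of a Euclidean triangle with sides `a, b, c`. -/
def comparisonAngle (a b c : ℝ) : ℝ :=
  Real.arccos ((a ^ 2 + b ^ 2 - c ^ 2) / (2 * a * b))

/-- The (Alexandrov) angle between two geodesics starting at `x`; the upper limit is a
limit in spaces of curvature bounded above. -/
def GeodesicAt.angle {X : Type u} [MetricSpace X] {x : X} (γ η : GeodesicAt x) : ℝ :=
  limsup (fun p : ℝ × ℝ => comparisonAngle p.1 p.2 (dist (γ.toFun p.1) (η.toFun p.2)))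
    (𝓝[>] (0 : ℝ) ×ˢ 𝓝[>] (0 : ℝ))

section AngleMetric

variable {X : Type u} [MetricSpace X] {x : X}

theorem comparisonAngle_nonneg (a b c : ℝ) : 0 ≤ comparisonAngle a b c := Real.arccos_nonneg _

theorem comparisonAngle_le_pi (a b c : ℝ) : comparisonAngle a b c ≤ Real.pi := Real.arccos_le_pi _

theorem GeodesicAt.isBoundedUnder_le (γ η : GeodesicAt x) :
    IsBoundedUnder (· ≤ ·) (𝓝[>] (0 : ℝ) ×ˢ 𝓝[>] (0 : ℝ))
      (fun p : ℝ × ℝ => comparisonAngle p.1 p.2 (dist (γ.toFun p.1) (η.toFun p.2))) :=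
  isBoundedUnder_of ⟨Real.pi, fun _ => comparisonAngle_le_pi _ _ _⟩

theorem GeodesicAt.isBoundedUnder_ge (γ η : GeodesicAt x) :
    IsBoundedUnder (· ≥ ·) (𝓝[>] (0 : ℝ) ×ˢ 𝓝[>] (0 : ℝ))
      (fun p : ℝ × ℝ => comparisonAngle p.1 p.2 (dist (γ.toFun p.1) (η.toFun p.2))) :=
  isBoundedUnder_of ⟨0, fun _ => comparisonAngle_nonneg _ _ _⟩

theorem GeodesicAt.angle_le_of_eventually {γ η : GeodesicAt x} {c : ℝ}
    (h : ∀ᶠ p in (𝓝[>] (0 : ℝ) ×ˢ 𝓝[>] (0 : ℝ)),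
      comparisonAngle p.1 p.2 (dist (γ.toFun p.1) (η.toFun p.2)) ≤ c) : γ.angle η ≤ c :=
  limsup_le_of_le (γ.isBoundedUnder_ge η).isCoboundedUnder_le h

theorem GeodesicAt.angle_nonneg (γ η : GeodesicAt x) : 0 ≤ γ.angle η :=
  le_limsup_of_frequently_le (Frequently.of_forall fun _ => comparisonAngle_nonneg _ _ _)
    (γ.isBoundedUnder_le η)

theorem GeodesicAt.angle_le_pi (γ η : GeodesicAt x) : γ.angle η ≤ Real.pi :=
  GeodesicAt.angle_le_of_eventually (Eventually.of_forall fun _ => comparisonAngle_le_pi _ _ _)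

theorem GeodesicAt.eventually_lt {γ η : GeodesicAt x} {c : ℝ} (h : γ.angle η < c) :
    ∃ ε > 0, ∀ s ∈ Ioo (0 : ℝ) ε, ∀ t ∈ Ioo (0 : ℝ) ε,
      comparisonAngle s t (dist (γ.toFun s) (η.toFun t)) < c := by
  have h1 := eventually_lt_of_limsup_lt h (γ.isBoundedUnder_le η)
  rw [((nhdsGT_basis (0 : ℝ)).prod_self).eventually_iff] at h1
  obtain ⟨ε, hε, h2⟩ := h1
  exact ⟨ε, hε, fun s hs t ht => @h2 (s, t) ⟨hs, ht⟩⟩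

theorem GeodesicAt.angle_self (γ : GeodesicAt x) : γ.angle γ = 0 := by
  refine le_antisymm (GeodesicAt.angle_le_of_eventually ?_) (γ.angle_nonneg γ)
  rw [((nhdsGT_basis (0 : ℝ)).prod_self).eventually_iff]
  refine ⟨γ.length, γ.length_pos, fun p hp => ?_⟩
  obtain ⟨⟨h1, h2⟩, h3, h4⟩ := hp
  rw [γ.isGeodesic _ ⟨h1.le, h2.le⟩ _ ⟨h3.le, h4.le⟩, comparisonAngle, sq_abs]
  have : (p.1 ^ 2 + p.2 ^ 2 - (p.1 - p.2) ^ 2) / (2 * p.1 * p.2) = 1 := by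
    have := h1.ne'
    have := h3.ne'
    field_simp
    ring
  rw [this, Real.arccos_one]

theorem GeodesicAt.angle_le_swap (γ η : GeodesicAt x) : γ.angle η ≤ η.angle γ := by
  refine le_of_forall_gt_imp_ge_of_dense fun c hc => ?_
  obtain ⟨ε, hε, h⟩ := GeodesicAt.eventually_lt hc
  refine GeodesicAt.angle_le_of_eventually ?_
  rw [((nhdsGT_basis (0 : ℝ)).prod_self).eventually_iff]
  refine ⟨ε, hε, fun p hp => ?_⟩
  have := h p.2 hp.2 p.1 hp.1
  have e : comparisonAngle p.1 p.2 (dist (γ.toFun p.1) (η.toFun p.2)) =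
      comparisonAngle p.2 p.1 (dist (η.toFun p.2) (γ.toFun p.1)) := by
    rw [comparisonAngle, comparisonAngle, dist_comm, add_comm (p.1 ^ 2), mul_right_comm]
  rw [e]
  exact this.le

theorem GeodesicAt.angle_comm (γ η : GeodesicAt x) : γ.angle η = η.angle γ :=
  le_antisymm (γ.angle_le_swap η) (η.angle_le_swap γ)

theorem sq_lt_of_comparisonAngle_lt {a b c θ : ℝ} (ha : 0 < a) (hb : 0 < b) (hθ : θ ≤ Real.pi)
    (h : comparisonAngle a b c < θ) : c ^ 2 < a ^ 2 + b ^ 2 - 2 * a * b * Real.cos θ := by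
  have h0 : 0 < θ := (comparisonAngle_nonneg a b c).trans_lt h
  have h1 : Real.cos θ < (a ^ 2 + b ^ 2 - c ^ 2) / (2 * a * b) := by
    by_contra! hcon
    have := Real.arccos_le_arccos hcon
    rw [Real.arccos_cos h0.le hθ] at this
    exact absurd h (not_lt.2 this)
  rw [lt_div_iff₀ (by positivity)] at h1
  linarith

theorem comparisonAngle_le_of_sq_le {a b c θ : ℝ} (ha : 0 < a) (hb : 0 < b) (h0 : 0 ≤ θ)
    (hθ : θ ≤ Real.pi) (h : c ^ 2 ≤ a ^ 2 + b ^ 2 - 2 * a * b * Real.cos θ) :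
    comparisonAngle a b c ≤ θ := by
  have h1 : Real.cos θ ≤ (a ^ 2 + b ^ 2 - c ^ 2) / (2 * a * b) := by
    rw [le_div_iff₀ (by positivity)]
    linarith
  have := Real.arccos_le_arccos h1
  rwa [Real.arccos_cos h0 hθ] at this

theorem triangle_identity {s v W a b c e : ℝ} (hW : W ≠ 0) (hWdef : W = s * a + v * b)
    (pa : a ^ 2 + c ^ 2 = 1) (pb : b ^ 2 + e ^ 2 = 1) :
    s ^ 2 + (s * v * (a * e + c * b) / W) ^ 2 - 2 * s * (s * v * (a * e + c * b) / W) * c =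
      (s * a / W) ^ 2 * (s ^ 2 + v ^ 2 - 2 * s * v * (c * e - a * b)) := by
  field_simp
  subst hWdef
  linear_combination s ^ 2 * ((-2 * a * b * s * v - b ^ 2 * v ^ 2) * pa + a ^ 2 * v ^ 2 * pb)

theorem GeodesicAt.angle_triangle (γ η ζ : GeodesicAt x) :
    γ.angle ζ ≤ γ.angle η + η.angle ζ := by
  refine le_of_forall_pos_le_add fun e he => ?_
  set α := γ.angle η + e / 2 with hα
  set β := η.angle ζ + e / 2 with hβ
  have hα0 : 0 < α := by have := γ.angle_nonneg η; linarith
  have hβ0 : 0 < β := by have := η.angle_nonneg ζ; linarith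
  have hgoal : γ.angle η + η.angle ζ + e = α + β := by rw [hα, hβ]; ring
  rw [hgoal]
  rcases le_or_gt Real.pi (α + β) with hpi | hpi
  · exact (γ.angle_le_pi ζ).trans hpi
  obtain ⟨ε₁, hε₁, h1⟩ := GeodesicAt.eventually_lt (show γ.angle η < α by linarith)
  obtain ⟨ε₂, hε₂, h2⟩ := GeodesicAt.eventually_lt (show η.angle ζ < β by linarith)
  refine GeodesicAt.angle_le_of_eventually ?_
  rw [((nhdsGT_basis (0 : ℝ)).prod_self).eventually_iff]
  refine ⟨min ε₁ ε₂, lt_min hε₁ hε₂, ?_⟩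
  rintro ⟨s, v⟩ ⟨⟨hs0, hs⟩, hv0, hv⟩
  simp only at hs0 hs hv0 hv ⊢
  have hA : 0 < Real.sin α := Real.sin_pos_of_pos_of_lt_pi hα0 (by linarith)
  have hB : 0 < Real.sin β := Real.sin_pos_of_pos_of_lt_pi hβ0 (by linarith)
  have hAB : 0 < Real.sin (α + β) := Real.sin_pos_of_pos_of_lt_pi (by linarith) hpi
  have hABle : Real.sin (α + β) ≤ Real.sin α + Real.sin β := by
    rw [Real.sin_add]
    nlinarith [Real.cos_le_one α, Real.cos_le_one β]
  have hW : 0 < s * Real.sin α + v * Real.sin β := by positivity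
  set W := s * Real.sin α + v * Real.sin β with hWdef
  set t := s * v * Real.sin (α + β) / W with ht
  have ht0 : 0 < t := by positivity
  have htm : t < min ε₁ ε₂ := by
    refine lt_of_le_of_lt ?_ (max_lt hs hv)
    rw [ht, div_le_iff₀ hW]
    rcases le_total s v with hsv | hsv
    · rw [max_eq_right hsv, hWdef]
      nlinarith [mul_le_mul_of_nonneg_left hABle (mul_pos hs0 hv0).le,
        mul_nonneg (mul_pos hv0 hB).le (sub_nonneg.2 hsv)]
    · rw [max_eq_left hsv, hWdef]
      nlinarith [mul_le_mul_of_nonneg_left hABle (mul_pos hs0 hv0).le,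
        mul_nonneg (mul_pos hs0 hA).le (sub_nonneg.2 hsv)]
  have d1 := sq_lt_of_comparisonAngle_lt hs0 ht0 (by linarith)
    (h1 s ⟨hs0, hs.trans_le (min_le_left _ _)⟩ t ⟨ht0, htm.trans_le (min_le_left _ _)⟩)
  have d2 := sq_lt_of_comparisonAngle_lt ht0 hv0 (by linarith)
    (h2 t ⟨ht0, htm.trans_le (min_le_right _ _)⟩ v ⟨hv0, hv.trans_le (min_le_right _ _)⟩)
  set D2 := s ^ 2 + v ^ 2 - 2 * s * v * Real.cos (α + β) with hD2
  have hD2nn : 0 ≤ D2 := by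
    rw [hD2]
    nlinarith [sq_nonneg (s - v), Real.cos_le_one (α + β), mul_pos hs0 hv0]
  set D := Real.sqrt D2 with hD
  have hDsq : D ^ 2 = D2 := Real.sq_sqrt hD2nn
  have hDnn : 0 ≤ D := Real.sqrt_nonneg _
  have pa := Real.sin_sq_add_cos_sq α
  have pb := Real.sin_sq_add_cos_sq β
  have e1 : s ^ 2 + t ^ 2 - 2 * s * t * Real.cos α = (s * Real.sin α / W * D) ^ 2 := by
    rw [mul_pow, hDsq, hD2, ht, Real.cos_add α β, Real.sin_add α β]
    exact triangle_identity hW.ne' hWdef pa pb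
  have e2 : t ^ 2 + v ^ 2 - 2 * t * v * Real.cos β = (v * Real.sin β / W * D) ^ 2 := by
    have := triangle_identity (s := v) (v := s) hW.ne' (hWdef.trans (add_comm _ _)) pb pa
    rw [mul_pow, hDsq, hD2, ht, Real.cos_add α β, Real.sin_add α β]
    linear_combination this
  rw [e1] at d1
  rw [e2] at d2
  have l1 := (abs_lt.1 (abs_lt_of_sq_lt_sq d1 (by positivity))).2
  have l2 := (abs_lt.1 (abs_lt_of_sq_lt_sq d2 (by positivity))).2
  refine comparisonAngle_le_of_sq_le hs0 hv0 (by linarith) hpi.le ?_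
  have hsum : s * Real.sin α / W * D + v * Real.sin β / W * D = D := by
    rw [← add_mul, ← add_div, ← hWdef, div_self hW.ne', one_mul]
  have htri := dist_triangle (γ.toFun s) (η.toFun t) (ζ.toFun v)
  rw [← hD2, ← hDsq]
  exact pow_le_pow_left₀ dist_nonneg (by linarith) 2

end AngleMetric

/-- The angle pseudometric on geodesics starting at `x`. -/
instance GeodesicAt.instPseudoMetricSpace {X : Type u} [MetricSpace X] (x : X) :
    PseudoMetricSpace (GeodesicAt x) where
  dist γ η := γ.angle η
  dist_self γ := γ.angle_self
  dist_comm γ η := γ.angle_comm η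
  dist_triangle γ η ζ := γ.angle_triangle η ζ

/-- The space of directions `Σ_x`: the completion of the set of geodesic directions at `x` with the
angle metric. -/
abbrev SpaceOfDirections {X : Type u} [MetricSpace X] (x : X) : Type u :=
  UniformSpace.Completion (GeodesicAt x)

/-- `v ∈ Σ_x` is the starting direction of a geodesic from `x` to `p ≠ x`. -/
def IsDirectionTo {X : Type u} [MetricSpace X] (x p : X) (v : SpaceOfDirections x) : Prop :=
  ∃ γ : GeodesicAt x, γ.length = dist x p ∧ γ.toFun (dist x p) = p ∧
    v = (γ : UniformSpace.Completion (GeodesicAt x))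

/-! ### Spherical tuples and strainers -/

/-- `v` and `v'` are opposite `δ`-spherical points. -/
def OppositeSphericalPoints {S : Type u} [MetricSpace S] (δ : ℝ) (v v' : S) : Prop :=
  ∀ w : S, dist v w + dist w v' < Real.pi + δ

/-- `(v_i)` and `(v'_i)` are opposite `δ`-spherical `k`-tuples. -/
def OppositeSphericalTuples {S : Type u} [MetricSpace S] {k : ℕ} (δ : ℝ) (v v' : Fin k → S) :
    Prop :=
  (∀ i, OppositeSphericalPoints δ (v i) (v' i)) ∧
    ∀ i j, i ≠ j → dist (v i) (v' j) < Real.pi / 2 + δ ∧ dist (v i) (v j) < Real.pi / 2 + δ ∧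
      dist (v' i) (v' j) < Real.pi / 2 + δ

/-- `(v_i)` is a `δ`-spherical `k`-tuple. -/
def IsSphericalTuple {S : Type u} [MetricSpace S] {k : ℕ} (δ : ℝ) (v : Fin k → S) : Prop :=
  ∃ v' : Fin k → S, OppositeSphericalTuples δ v v'

/-- The set `X_{k,δ}` of `(k, δ)`-strained points. -/
def strainedPoints (X : Type u) [MetricSpace X] (k : ℕ) (δ : ℝ) : Set X :=
  {x | ∃ v : Fin k → SpaceOfDirections x, IsSphericalTuple δ v}

/-- The `k`-tuple `p` of points of the closed ball of radius `5 r₀` around `x₀`, all different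
from `x`, is a `(k, δ)`-strainer at `x` (with respect to the tiny ball `B_{r₀}(x₀)`). -/
def IsStrainerAt {X : Type u} [MetricSpace X] (x₀ : X) (r₀ : ℝ) {k : ℕ} (δ : ℝ) (p : Fin k → X)
    (x : X) : Prop :=
  (∀ i, p i ∈ Metric.closedBall x₀ (5 * r₀) ∧ p i ≠ x) ∧
    ∃ v : Fin k → SpaceOfDirections x, (∀ i, IsDirectionTo x (p i) (v i)) ∧ IsSphericalTuple δ v

/-- The distance map `(d_{p_1}, …, d_{p_k})`. -/
def distMap {X : Type u} [MetricSpace X] {k : ℕ} (p : Fin k → X) (x : X) :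
    EuclideanSpace ℝ (Fin k) :=
  WithLp.toLp 2 fun i => dist (p i) x

/-- The distance map defined by `p` is a `(k, δ)`-strainer map in the open subset `V` of the tiny
ball `B_{r₀}(x₀)`. -/
structure IsStrainerMap {X : Type u} [MetricSpace X] (x₀ : X) (r₀ : ℝ) {k : ℕ} (δ : ℝ)
    (p : Fin k → X) (V : Set X) : Prop where
  isOpen : IsOpen V
  subset : V ⊆ Metric.ball x₀ r₀
  mem : ∀ i, p i ∈ Metric.closedBall x₀ (5 * r₀)
  strainer : ∀ x ∈ V, IsStrainerAt x₀ r₀ δ p x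

/-- The set `E` of points of `V` at which the distance map defined by `p` cannot be extended, by one
further distance function `d_q`, to a `(k + 1, δ')`-strainer map. -/
def nonExtendable {X : Type u} [MetricSpace X] (x₀ : X) (r₀ : ℝ) {k : ℕ} (δ' : ℝ) (p : Fin k → X)
    (V : Set X) : Set X :=
  {x ∈ V | ¬ ∃ q : X, IsStrainerAt x₀ r₀ δ' (Fin.snoc (α := fun _ => X) p q) x}

/-! ### BiLipschitz maps and Hausdorff measures -/

/-- The restriction of `F` to `K` is an `L`-biLipschitz embedding. -/
def BiLipschitzOn {X Y : Type*} [MetricSpace X] [MetricSpace Y] (L : ℝ) (F : X → Y) (K : Set X) :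
    Prop :=
  ∀ x ∈ K, ∀ y ∈ K, 1 / L * dist x y ≤ dist (F x) (F y) ∧ dist (F x) (F y) ≤ L * dist x y

/-- The `k`-dimensional Hausdorff measure, with the usual normalization by `ω_k / 2^k`, where
`ω_k` is the volume of the unit ball of `ℝ^k` (so that it is Lebesgue measure on `ℝ^k`). -/
def hausdorffMeasure (k : ℕ) (X : Type*) [MetricSpace X] [MeasurableSpace X] [BorelSpace X] :
    Measure X :=
  (volume (Metric.ball (0 : EuclideanSpace ℝ (Fin k)) 1) / 2 ^ k) • Measure.hausdorffMeasure (k : ℝ)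

end GCBA

end

/-!
Let `E` be the set of points of `V` at which the strainer map `F` cannot be extended. The proof rests
on one fact: if `x` and `y` are two points of a fiber of `F`, and if the geometry around `x` does not
change between the scale `d(x, y)` and a much larger scale, then `F` can be extended at `y` by the
distance to `x`, so that `y ∉ E` (`ComparisonBall.not_mem_nonExtendable`). It is enough that `x` and `y`
are almost in the same fiber, that is, `|d(p_i, x) - d(p_i, y)| ≤ c d(x, y)` with a small `c`.

The curvature bound enters only through an inequality for the distance from a vertex of a triangle to a
point of the opposite side, uniform in the sign of `κ` (`ComparisonBall`). It makes comparison angles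
at `x` decrease when the end points move towards `x`. That the geometry does not change between two
scales means that the comparison angles at `x` hardly decrease between them (`Stable`). Then, at `y`, the
direction to `x` and that of an extension of `xy` beyond `y` are almost opposite spherical points
(`ComparisonBall.exists_oppPair_of_stable`), and the direction to `x` is almost orthogonal to the
directions to the `p_i` (`ComparisonBall.abs_cos_ang_le_of_stable`). Together with the strainer at `y`
this gives a strainer with one more point (`ComparisonBall.isStrainerAt_snoc`).

Stability is common by monotonicity: the comparison angles of a finite net of directions at `x`, as
functions of the scale, are monotone and bounded (`ComparisonBall.exists_stability_function`). This is
used twice.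

* They converge as the scale tends to `0`, so all small scales at `x` are stable. Hence `F` expands all
  distances from `x ∈ E` to nearby points of `E` by a definite factor. Since `E` is relatively closed in
  `V`, by the upper semicontinuity of angles, a countable decomposition according to what nearby means
  gives compact sets on which `F` is biLipschitz (`ComparisonBall.exists_compact_pieces`).
* In a doubling space the net can be chosen with a bounded number of elements, and then all but a bounded
  number of scales are stable, while a large finite set contains a long chain of points that converges
  fast to one of its points. So `E` has a bounded number of points in each fiber
  (`exists_card_fiber_le`).

The doubling condition also bounds `k` (`ComparisonBall.nonExtendable_eq_empty_or_le`). The inequalities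
for the measures follow from the bounds on the biLipschitz constant and on the number of points in the
fibers (`hausdorffMeasure_le_of_biLipschitzOn`), and from `F` mapping a ball of radius `r₀` into a cube
of side `2 r₀` (`hausdorffMeasure_le_of_cube`). Finally `V \ X_{k+1, 12 δ}` is a relatively closed subset
of `E`.
-/

noncomputable section

namespace GCBA

/-! ### Hinges and comparison triangles in the model surfaces -/

/-- If `f' / g'` is increasing, then `f` lies below the interpolation of its end values along `g`.
With `f t = cos (m t)`, and `g t = t ^ 2` or `g = cosh`, this compares the third sides of hinges in
different model surfaces, since `g` of the third side is affine in the cosine of the angle. -/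
theorem le_interpolation_of_ratio_mono {f g f' g' : ℝ → ℝ} {e₁ e₂ a l : ℝ} (he : e₁ ≤ e₂)
    (hf : ∀ t, HasDerivAt f (f' t) t) (hg : ∀ t, HasDerivAt g (g' t) t)
    (hpos : ∀ t ∈ Ioo e₁ e₂, 0 < g' t)
    (hmono : ∀ s ∈ Ioo e₁ e₂, ∀ t ∈ Ioo e₁ e₂, s < t → f' s * g' t ≤ f' t * g' s)
    (h0 : 0 ≤ l) (h1 : l ≤ 1) (ha : a ∈ Icc e₁ e₂) (hga : g a = l * g e₁ + (1 - l) * g e₂) :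
    f a ≤ l * f e₁ + (1 - l) * f e₂ := by
  rcases eq_or_lt_of_le ha.1 with h | h
  · subst h
    rcases eq_or_lt_of_le he with h2 | h2
    · subst h2; linarith
    · -- then `l = 1`
      have : g e₁ < g e₂ := by
        obtain ⟨c, hc, hc'⟩ := exists_hasDerivAt_eq_slope g g' h2
          (fun x _ => (hg x).continuousAt.continuousWithinAt) (fun x _ => hg x)
        have := hpos c hc
        rw [hc', lt_div_iff₀ (by linarith)] at this
        linarith
      have h3 : l = 1 := by nlinarith
      subst h3; linarith
  rcases eq_or_lt_of_le ha.2 with h' | h'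
  · subst h'
    have : g e₁ < g a := by
      obtain ⟨c, hc, hc'⟩ := exists_hasDerivAt_eq_slope g g' h
        (fun x _ => (hg x).continuousAt.continuousWithinAt) (fun x _ => hg x)
      have := hpos c hc
      rw [hc', lt_div_iff₀ (by linarith)] at this
      linarith
    have h3 : l = 0 := by nlinarith
    subst h3; linarith
  obtain ⟨c₁, hc₁, e1⟩ := exists_ratio_hasDerivAt_eq_ratio_slope f f' h
    (fun x _ => (hf x).continuousAt.continuousWithinAt) (fun x _ => hf x) g g'
    (fun x _ => (hg x).continuousAt.continuousWithinAt) (fun x _ => hg x)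
  obtain ⟨c₂, hc₂, e2⟩ := exists_ratio_hasDerivAt_eq_ratio_slope f f' h'
    (fun x _ => (hf x).continuousAt.continuousWithinAt) (fun x _ => hf x) g g'
    (fun x _ => (hg x).continuousAt.continuousWithinAt) (fun x _ => hg x)
  have m1 : c₁ ∈ Ioo e₁ e₂ := ⟨hc₁.1, hc₁.2.trans h'⟩
  have m2 : c₂ ∈ Ioo e₁ e₂ := ⟨h.trans hc₂.1, hc₂.2⟩
  have hm := hmono c₁ m1 c₂ m2 (hc₁.2.trans hc₂.1)
  have p1 := hpos c₁ m1
  have p2 := hpos c₂ m2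
  have i1 : g a - g e₁ = (1 - l) * (g e₂ - g e₁) := by linarith
  have i2 : g e₂ - g a = l * (g e₂ - g e₁) := by linarith
  have hG : 0 < g e₂ - g e₁ := by
    obtain ⟨c, hc, hc'⟩ := exists_hasDerivAt_eq_slope g g' (h.trans h')
      (fun x _ => (hg x).continuousAt.continuousWithinAt) (fun x _ => hg x)
    have := hpos c hc
    rw [hc', lt_div_iff₀ (by linarith)] at this
    linarith
  rw [i1] at e1
  rw [i2] at e2
  -- `(f a - f e₁) = (1 - l) G f'(c₁)/g'(c₁)`, `(f e₂ - f a) = l G f'(c₂)/g'(c₂)`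
  have j1 : f a - f e₁ = (1 - l) * (g e₂ - g e₁) * (f' c₁ / g' c₁) := by
    field_simp; linarith
  have j2 : f e₂ - f a = l * (g e₂ - g e₁) * (f' c₂ / g' c₂) := by
    field_simp; linarith
  have hr : f' c₁ / g' c₁ ≤ f' c₂ / g' c₂ := by
    rw [div_le_div_iff₀ p1 p2]; exact hm
  have key : l * (f a - f e₁) ≤ (1 - l) * (f e₂ - f a) := by
    rw [j1, j2]
    have : 0 ≤ l * (1 - l) * (g e₂ - g e₁) := by
      have := sub_nonneg.2 h1
      positivity
    nlinarith [mul_le_mul_of_nonneg_left hr this]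
  linarith

theorem sin_mul_le_sin_mul {s t : ℝ} (hs : 0 ≤ s) (hst : s ≤ t) (ht : t ≤ Real.pi) :
    s * Real.sin t ≤ t * Real.sin s := by
  rcases eq_or_lt_of_le (hs.trans hst) with h | h
  · have : s = 0 := by linarith
    simp [← h, this]
  have := strictConcaveOn_sin_Icc.concaveOn.2
    (show (0 : ℝ) ∈ Icc 0 Real.pi from ⟨le_rfl, Real.pi_pos.le⟩)
    (show t ∈ Icc 0 Real.pi from ⟨h.le, ht⟩)
    (show 0 ≤ 1 - s / t by rw [sub_nonneg, div_le_one h]; exact hst)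
    (show 0 ≤ s / t by positivity) (by ring)
  simp only [smul_eq_mul, mul_zero, zero_add, Real.sin_zero] at this
  rw [div_mul_cancel₀ _ h.ne'] at this
  rw [div_mul_eq_mul_div, div_le_iff₀ h] at this
  linarith

theorem mul_sinh_le_mul_sinh {s t : ℝ} (hs : 0 ≤ s) (hst : s ≤ t) :
    t * Real.sinh s ≤ s * Real.sinh t := by
  rcases eq_or_lt_of_le hs with h | h
  · simp [← h]
  rcases eq_or_lt_of_le hst with h' | h'
  · simp [h']
  obtain ⟨c₁, hc₁, e1⟩ := exists_hasDerivAt_eq_slope Real.sinh Real.cosh h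
    Real.continuous_sinh.continuousOn (fun x _ => Real.hasDerivAt_sinh x)
  obtain ⟨c₂, hc₂, e2⟩ := exists_hasDerivAt_eq_slope Real.sinh Real.cosh h'
    Real.continuous_sinh.continuousOn (fun x _ => Real.hasDerivAt_sinh x)
  have : Real.cosh c₁ ≤ Real.cosh c₂ := by
    rw [Real.cosh_le_cosh, abs_of_pos hc₁.1, abs_of_pos (h.trans hc₂.1)]
    linarith [hc₁.2, hc₂.1]
  rw [e1, e2, Real.sinh_zero, div_le_div_iff₀ (by linarith) (by linarith)] at this
  linarith

/-- A Euclidean hinge is at least as wide as the spherical hinge with the same data. -/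
theorem cos_le_of_euclidean_hinge {m D u a c : ℝ} (hm : 0 < m) (hD : 0 ≤ D) (hu : 0 ≤ u)
    (hDu : m * (D + u) ≤ Real.pi) (ha : 0 ≤ a) (hc : |c| ≤ 1)
    (h : a ^ 2 = D ^ 2 + u ^ 2 - 2 * D * u * c) :
    Real.cos (m * a) ≤ Real.cos (m * D) * Real.cos (m * u) +
      Real.sin (m * D) * Real.sin (m * u) * c := by
  obtain ⟨c1, c2⟩ := abs_le.1 hc
  have hmem : a ∈ Icc |D - u| (D + u) := by
    constructor
    · refine abs_le_of_sq_le_sq ?_ ha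
      nlinarith [mul_nonneg hD hu]
    · nlinarith [mul_nonneg hD hu]
  have := le_interpolation_of_ratio_mono (f := fun t => Real.cos (m * t)) (g := fun t => t ^ 2)
    (f' := fun t => -Real.sin (m * t) * m) (g' := fun t => 2 * t) (l := (1 + c) / 2)
    (hmem.1.trans hmem.2)
    (fun t => by
      have := ((hasDerivAt_id t).const_mul m).cos
      simpa using this)
    (fun t => by simpa using hasDerivAt_pow 2 t)
    (fun t ht => by have := (abs_nonneg _).trans_lt ht.1; linarith)
    (fun s hs t ht hst => by
      have s0 := (abs_nonneg _).trans_lt hs.1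
      have := sin_mul_le_sin_mul (s := m * s) (t := m * t) (by positivity)
        (by nlinarith) (by nlinarith [ht.2])
      nlinarith)
    (by linarith) (by linarith) hmem (by simp only [sq_abs]; rw [h]; ring)
  have e : Real.cos (m * |D - u|) = Real.cos (m * (D - u)) := by
    rw [← Real.cos_abs (m * (D - u)), abs_mul, abs_of_pos hm]
  simp only [e, mul_sub, mul_add, Real.cos_sub, Real.cos_add] at this
  linarith

/-- A hyperbolic hinge is at least as wide as the spherical hinge with the same data. -/
theorem cos_le_of_hyperbolic_hinge {m D u a c : ℝ} (hm : 0 < m) (hD : 0 ≤ D) (hu : 0 ≤ u)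
    (hDu : m * (D + u) ≤ Real.pi) (ha : 0 ≤ a) (hc : |c| ≤ 1)
    (h : Real.cosh a = Real.cosh D * Real.cosh u - Real.sinh D * Real.sinh u * c) :
    Real.cos (m * a) ≤ Real.cos (m * D) * Real.cos (m * u) +
      Real.sin (m * D) * Real.sin (m * u) * c := by
  obtain ⟨c1, c2⟩ := abs_le.1 hc
  have hs1 := Real.sinh_nonneg_iff.2 hD
  have hs2 := Real.sinh_nonneg_iff.2 hu
  have hmem : a ∈ Icc |D - u| (D + u) := by
    constructor
    · rw [← abs_of_nonneg ha, ← Real.cosh_le_cosh, h, Real.cosh_sub]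
      nlinarith [mul_nonneg hs1 hs2]
    · rw [← abs_of_nonneg ha, ← abs_of_nonneg (add_nonneg hD hu), ← Real.cosh_le_cosh, h,
        Real.cosh_add]
      nlinarith [mul_nonneg hs1 hs2]
  have e' : Real.cosh |D - u| = Real.cosh (D - u) := Real.cosh_abs _
  have := le_interpolation_of_ratio_mono (f := fun t => Real.cos (m * t)) (g := Real.cosh)
    (f' := fun t => -Real.sin (m * t) * m) (g' := Real.sinh) (l := (1 + c) / 2)
    (hmem.1.trans hmem.2)
    (fun t => by
      have := ((hasDerivAt_id t).const_mul m).cos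
      simpa using this)
    Real.hasDerivAt_cosh
    (fun t ht => Real.sinh_pos_iff.2 ((abs_nonneg _).trans_lt ht.1))
    (fun s hs t ht hst => by
      have s0 := (abs_nonneg _).trans_lt hs.1
      have t0 := s0.trans hst
      have h1 := sin_mul_le_sin_mul (s := m * s) (t := m * t) (by positivity)
        (by nlinarith) (by nlinarith [ht.2])
      have h2 := mul_sinh_le_mul_sinh s0.le hst.le
      have h3 : 0 ≤ Real.sin (m * t) := Real.sin_nonneg_of_nonneg_of_le_pi (by positivity)
        (by nlinarith [ht.2])
      have h4 : s * Real.sin (m * t) ≤ t * Real.sin (m * s) := by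
        refine le_of_mul_le_mul_left ?_ hm
        linarith
      have h5 : Real.sin (m * t) * Real.sinh s ≤ Real.sin (m * s) * Real.sinh t := by
        have p1 := mul_le_mul_of_nonneg_left h2 h3
        have p2 := mul_le_mul_of_nonneg_right h4 (Real.sinh_pos_iff.2 t0).le
        refine le_of_mul_le_mul_left ?_ t0
        linarith
      nlinarith)
    (by linarith) (by linarith) hmem (by rw [e', Real.cosh_sub, Real.cosh_add, h]; ring)
  have e : Real.cos (m * |D - u|) = Real.cos (m * (D - u)) := by
    rw [← Real.cos_abs (m * (D - u)), abs_mul, abs_of_pos hm]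
  simp only [e, mul_sub, mul_add, Real.cos_sub, Real.cos_add] at this
  linarith

/-- Comparison triangles on the unit sphere. -/
theorem exists_sphere_comparison {u v a b : ℝ} (hu : 0 ≤ u) (hv : 0 ≤ v) (huv : 0 < u + v)
    (hπ : u + v < Real.pi) (ha : 0 ≤ a) (hb : 0 ≤ b) (hab : a + b ≤ Real.pi)
    (h1 : |a - b| ≤ u + v) (h2 : u + v ≤ a + b) :
    ∃ x y z p : Metric.sphere (0 : EuclideanSpace ℝ (Fin 3)) 1,
      InnerProductGeometry.angle (x : EuclideanSpace ℝ (Fin 3)) y = u + v ∧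
      InnerProductGeometry.angle (y : EuclideanSpace ℝ (Fin 3)) z = b ∧
      InnerProductGeometry.angle (x : EuclideanSpace ℝ (Fin 3)) z = a ∧
      InnerProductGeometry.angle (x : EuclideanSpace ℝ (Fin 3)) p = u ∧
      InnerProductGeometry.angle (p : EuclideanSpace ℝ (Fin 3)) y = v ∧
      Real.sin (u + v) * Real.cos (InnerProductGeometry.angle (p : EuclideanSpace ℝ (Fin 3)) z) =
        Real.sin v * Real.cos a + Real.sin u * Real.cos b := by
  have hs : 0 < Real.sin (u + v) := Real.sin_pos_of_pos_of_lt_pi huv hπ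
  set P := (Real.cos a * Real.sin v + Real.cos b * Real.sin u) / Real.sin (u + v) with hP
  set Q := (Real.cos b * Real.cos u - Real.cos a * Real.cos v) / Real.sin (u + v) with hQ
  have c1 : Real.cos (a + b) ≤ Real.cos (u + v) :=
    Real.cos_le_cos_of_nonneg_of_le_pi huv.le hab h2
  have c2 : Real.cos (u + v) ≤ Real.cos (a - b) := by
    rw [← Real.cos_abs (a - b)]
    exact Real.cos_le_cos_of_nonneg_of_le_pi (abs_nonneg _) hπ.le h1
  have pu := Real.sin_sq_add_cos_sq u
  have pv := Real.sin_sq_add_cos_sq v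
  have pa := Real.sin_sq_add_cos_sq a
  have pb := Real.sin_sq_add_cos_sq b
  have psum := Real.sin_sq_add_cos_sq (u + v)
  have eP : Real.sin (u + v) * P = Real.cos a * Real.sin v + Real.cos b * Real.sin u := by
    rw [hP]; field_simp
  have eQ : Real.sin (u + v) * Q = Real.cos b * Real.cos u - Real.cos a * Real.cos v := by
    rw [hQ]; field_simp
  have hPQ : P ^ 2 + Q ^ 2 ≤ 1 := by
    have e : Real.sin (u + v) ^ 2 * (P ^ 2 + Q ^ 2) = Real.cos a ^ 2 + Real.cos b ^ 2 -
        2 * Real.cos a * Real.cos b * Real.cos (u + v) := by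
      have : Real.sin (u + v) ^ 2 * (P ^ 2 + Q ^ 2) =
        (Real.sin (u + v) * P) ^ 2 + (Real.sin (u + v) * Q) ^ 2 := by ring
      rw [this, eP, eQ, Real.cos_add]
      linear_combination Real.cos a ^ 2 * pv + Real.cos b ^ 2 * pu
    have e2 : Real.cos a ^ 2 + Real.cos b ^ 2 - 2 * Real.cos a * Real.cos b * Real.cos (u + v) ≤
        Real.sin (u + v) ^ 2 := by
      rw [Real.cos_add a b] at c1
      rw [Real.cos_sub] at c2
      have hsa := Real.sin_nonneg_of_nonneg_of_le_pi ha (by linarith)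
      have hsb := Real.sin_nonneg_of_nonneg_of_le_pi hb (by linarith)
      have : (Real.cos (u + v) - Real.cos a * Real.cos b) ^ 2 ≤ (Real.sin a * Real.sin b) ^ 2 := by
        apply sq_le_sq'
        · linarith
        · linarith
      have i : Real.sin a ^ 2 * Real.sin b ^ 2 =
        (1 - Real.cos a ^ 2) * (1 - Real.cos b ^ 2) := by
          rw [← Real.sin_sq, ← Real.sin_sq]
      nlinarith
    rw [← e] at e2
    have hs2 : 0 < Real.sin (u + v) ^ 2 := by positivity
    exact le_of_mul_le_mul_left (by linarith) hs2
  have i1 : P * Real.cos u - Q * Real.sin u = Real.cos a := by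
    refine mul_left_cancel₀ hs.ne' ?_
    have : Real.sin (u + v) * (P * Real.cos u - Q * Real.sin u) =
      (Real.sin (u + v) * P) * Real.cos u - (Real.sin (u + v) * Q) * Real.sin u := by ring
    rw [this, eP, eQ, Real.sin_add]
    ring
  have i2 : P * Real.cos v + Q * Real.sin v = Real.cos b := by
    refine mul_left_cancel₀ hs.ne' ?_
    have : Real.sin (u + v) * (P * Real.cos v + Q * Real.sin v) =
      (Real.sin (u + v) * P) * Real.cos v + (Real.sin (u + v) * Q) * Real.sin v := by ring
    rw [this, eP, eQ, Real.sin_add]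
    ring
  have hR := Real.sq_sqrt (sub_nonneg.2 hPQ)
  set R := Real.sqrt (1 - (P ^ 2 + Q ^ 2)) with hRdef
  have nx : ‖(!₂[Real.cos u, -Real.sin u, 0] : EuclideanSpace ℝ (Fin 3))‖ = 1 := by
    rw [EuclideanSpace.norm_eq, Real.sqrt_eq_one]
    simp [Fin.sum_univ_three]
  have ny : ‖(!₂[Real.cos v, Real.sin v, 0] : EuclideanSpace ℝ (Fin 3))‖ = 1 := by
    rw [EuclideanSpace.norm_eq, Real.sqrt_eq_one]
    simp [Fin.sum_univ_three]
  have nz : ‖(!₂[P, Q, R] : EuclideanSpace ℝ (Fin 3))‖ = 1 := by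
    rw [EuclideanSpace.norm_eq, Real.sqrt_eq_one]
    simp [Fin.sum_univ_three]
    linarith
  have np : ‖(!₂[1, 0, 0] : EuclideanSpace ℝ (Fin 3))‖ = 1 := by
    rw [EuclideanSpace.norm_eq, Real.sqrt_eq_one]
    simp [Fin.sum_univ_three]
  have ang : ∀ (w w' : EuclideanSpace ℝ (Fin 3)) (t : ℝ), ‖w‖ = 1 → ‖w'‖ = 1 → 0 ≤ t →
      t ≤ Real.pi → inner ℝ w w' = Real.cos t → InnerProductGeometry.angle w w' = t := by
    intro w w' t hw hw' h0 h1 h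
    rw [InnerProductGeometry.angle, hw, hw', h, mul_one, div_one, Real.arccos_cos h0 h1]
  refine ⟨⟨_, mem_sphere_zero_iff_norm.2 nx⟩, ⟨_, mem_sphere_zero_iff_norm.2 ny⟩,
    ⟨_, mem_sphere_zero_iff_norm.2 nz⟩, ⟨_, mem_sphere_zero_iff_norm.2 np⟩, ?_, ?_, ?_, ?_, ?_, ?_⟩
  · refine ang _ _ _ nx ny huv.le hπ.le ?_
    simp [PiLp.inner_apply, Fin.sum_univ_three, Real.cos_add]
    ring
  · refine ang _ _ _ ny nz hb (by linarith) ?_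
    simp [PiLp.inner_apply, Fin.sum_univ_three]
    linarith
  · refine ang _ _ _ nx nz ha (by linarith) ?_
    simp [PiLp.inner_apply, Fin.sum_univ_three]
    linarith
  · refine ang _ _ _ nx np hu (by linarith) ?_
    simp [PiLp.inner_apply, Fin.sum_univ_three]
  · refine ang _ _ _ np ny hv (by linarith) ?_
    simp [PiLp.inner_apply, Fin.sum_univ_three]
  · rw [InnerProductGeometry.cos_angle]
    simp only [np, nz]
    simp [PiLp.inner_apply, Fin.sum_univ_three]
    linarith

/-- Comparison triangles in the Euclidean plane. -/
theorem exists_plane_comparison {u v a b : ℝ} (hu : 0 ≤ u) (hv : 0 ≤ v) (huv : 0 < u + v)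
    (ha : 0 ≤ a) (hb : 0 ≤ b) (h1 : |a - b| ≤ u + v) (h2 : u + v ≤ a + b) :
    ∃ x y z p : EuclideanSpace ℝ (Fin 2), dist x y = u + v ∧ dist y z = b ∧ dist x z = a ∧
      dist x p = u ∧ dist p y = v ∧ ∃ c, |c| ≤ 1 ∧
      a ^ 2 = dist p z ^ 2 + u ^ 2 - 2 * dist p z * u * c ∧
      b ^ 2 = dist p z ^ 2 + v ^ 2 - 2 * dist p z * v * (-c) := by
  set P := (a ^ 2 - b ^ 2 - u ^ 2 + v ^ 2) / (2 * (u + v)) with hP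
  have eP : 2 * (u + v) * P = a ^ 2 - b ^ 2 - u ^ 2 + v ^ 2 := by rw [hP]; field_simp
  obtain ⟨k1, k2⟩ := abs_le.1 h1
  have hQ : 0 ≤ a ^ 2 - (P + u) ^ 2 := by
    have e : 2 * (u + v) * (P + u) = a ^ 2 - b ^ 2 + (u + v) ^ 2 := by linarith
    have : 0 ≤ (2 * (u + v)) ^ 2 * (a ^ 2 - (P + u) ^ 2) := by
      have : (2 * (u + v)) ^ 2 * (a ^ 2 - (P + u) ^ 2) =
        (2 * (u + v) * a - 2 * (u + v) * (P + u)) * (2 * (u + v) * a + 2 * (u + v) * (P + u)) := by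
          ring
      rw [this, e]
      apply mul_nonneg
      · nlinarith
      · nlinarith
    exact nonneg_of_mul_nonneg_right this (by positivity)
  have hR := Real.sq_sqrt hQ
  set Q := Real.sqrt (a ^ 2 - (P + u) ^ 2)
  have dpz : dist (!₂[0, 0] : EuclideanSpace ℝ (Fin 2)) !₂[P, Q] = Real.sqrt (P ^ 2 + Q ^ 2) := by
    rw [EuclideanSpace.dist_eq]
    simp [Fin.sum_univ_two, Real.dist_eq]
  refine ⟨!₂[-u, 0], !₂[v, 0], !₂[P, Q], !₂[0, 0], ?_, ?_, ?_, ?_, ?_, ?_⟩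
  · rw [EuclideanSpace.dist_eq, Real.sqrt_eq_iff_mul_self_eq_of_pos huv]
    simp [Fin.sum_univ_two, Real.dist_eq]
    ring
  · rw [EuclideanSpace.dist_eq]
    refine (congrArg Real.sqrt ?_).trans (Real.sqrt_sq hb)
    simp [Fin.sum_univ_two, Real.dist_eq]
    nlinarith
  · rw [EuclideanSpace.dist_eq]
    refine (congrArg Real.sqrt ?_).trans (Real.sqrt_sq ha)
    simp [Fin.sum_univ_two, Real.dist_eq]
    nlinarith
  · rw [EuclideanSpace.dist_eq]
    refine (congrArg Real.sqrt ?_).trans (Real.sqrt_sq hu)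
    simp [Fin.sum_univ_two, Real.dist_eq]
  · rw [EuclideanSpace.dist_eq]
    refine (congrArg Real.sqrt ?_).trans (Real.sqrt_sq hv)
    simp [Fin.sum_univ_two, Real.dist_eq]
  · rw [dpz]
    have hD := Real.sq_sqrt (show 0 ≤ P ^ 2 + Q ^ 2 by positivity)
    have hD0 := Real.sqrt_nonneg (P ^ 2 + Q ^ 2)
    set D := Real.sqrt (P ^ 2 + Q ^ 2)
    have hPD : |P| ≤ D := abs_le_of_sq_le_sq (by nlinarith [sq_nonneg Q]) hD0
    have hDc : D * (-P / D) = -P := by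
      rcases eq_or_ne D 0 with h | h
      · have : P = 0 := by rw [h] at hPD; exact abs_nonpos_iff.1 hPD
        simp [h, this]
      · field_simp
    refine ⟨-P / D, ?_, ?_, ?_⟩
    · rw [abs_div, abs_neg, abs_of_nonneg hD0]
      exact div_le_one_of_le₀ hPD hD0
    · have : 2 * D * u * (-P / D) = 2 * u * (D * (-P / D)) := by ring
      rw [this, hDc, hD]
      nlinarith
    · have : 2 * D * v * (-(-P / D)) = -(2 * v * (D * (-P / D))) := by ring
      rw [this, hDc, hD]
      nlinarith

/-! ### The comparison inequality in a tiny ball -/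

/-- Comparison triangles in the hyperbolic plane. -/
theorem exists_hyperbolic_comparison {u v a b : ℝ} (hu : 0 ≤ u) (hv : 0 ≤ v) (huv : 0 < u + v)
    (ha : 0 ≤ a) (hb : 0 ≤ b) (h1 : |a - b| ≤ u + v) (h2 : u + v ≤ a + b) :
    ∃ x y z p : UpperHalfPlane, dist x y = u + v ∧ dist y z = b ∧ dist x z = a ∧
      dist x p = u ∧ dist p y = v ∧ ∃ c, |c| ≤ 1 ∧
      Real.cosh a = Real.cosh (dist p z) * Real.cosh u - Real.sinh (dist p z) * Real.sinh u * c ∧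
      Real.cosh b = Real.cosh (dist p z) * Real.cosh v -
        Real.sinh (dist p z) * Real.sinh v * (-c) := by
  have hs : 0 < Real.sinh (u + v) := Real.sinh_pos_iff.2 huv
  set P := (Real.cosh a * Real.sinh v + Real.cosh b * Real.sinh u) / Real.sinh (u + v) with hP
  set Q := (Real.cosh b * Real.cosh u - Real.cosh a * Real.cosh v) / Real.sinh (u + v) with hQ
  have c1 : Real.cosh (u + v) ≤ Real.cosh (a + b) := by
    rw [Real.cosh_le_cosh, abs_of_pos huv, abs_of_nonneg (add_nonneg ha hb)]; exact h2
  have c2 : Real.cosh (a - b) ≤ Real.cosh (u + v) := by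
    rw [Real.cosh_le_cosh, abs_of_pos huv]; exact h1
  have pu := Real.cosh_sq u
  have pv := Real.cosh_sq v
  have pa := Real.cosh_sq a
  have pb := Real.cosh_sq b
  have psum := Real.cosh_sq (u + v)
  have su := Real.sinh_nonneg_iff.2 hu
  have sv := Real.sinh_nonneg_iff.2 hv
  have eP : Real.sinh (u + v) * P = Real.cosh a * Real.sinh v + Real.cosh b * Real.sinh u := by
    rw [hP]; field_simp
  have eQ : Real.sinh (u + v) * Q = Real.cosh b * Real.cosh u - Real.cosh a * Real.cosh v := by
    rw [hQ]; field_simp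
  have hP0 : 0 < P := by
    have s0 : 0 ≤ P := by
      have := Real.cosh_pos a
      have := Real.cosh_pos b
      positivity
    refine lt_of_le_of_ne s0 fun h => ?_
    rw [← h, mul_zero] at eP
    have q1 := Real.one_le_cosh a
    have q2 := Real.one_le_cosh b
    have z1 : Real.sinh v = 0 := by nlinarith
    have z2 : Real.sinh u = 0 := by nlinarith
    rw [Real.sinh_add, z1, z2] at hs
    simp at hs
  have hPQ : 1 ≤ P ^ 2 - Q ^ 2 := by
    have e : Real.sinh (u + v) ^ 2 * (P ^ 2 - Q ^ 2) =
        2 * Real.cosh a * Real.cosh b * Real.cosh (u + v) - Real.cosh a ^ 2 - Real.cosh b ^ 2 := by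
      have : Real.sinh (u + v) ^ 2 * (P ^ 2 - Q ^ 2) =
        (Real.sinh (u + v) * P) ^ 2 - (Real.sinh (u + v) * Q) ^ 2 := by ring
      rw [this, eP, eQ, Real.cosh_add]
      linear_combination -Real.cosh a ^ 2 * pv - Real.cosh b ^ 2 * pu
    have e2 : Real.sinh (u + v) ^ 2 ≤
        2 * Real.cosh a * Real.cosh b * Real.cosh (u + v) - Real.cosh a ^ 2 - Real.cosh b ^ 2 := by
      rw [Real.cosh_add a b] at c1
      rw [Real.cosh_sub] at c2
      have : (Real.cosh (u + v) - Real.cosh a * Real.cosh b) ^ 2 ≤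
          (Real.sinh a * Real.sinh b) ^ 2 := by
        apply sq_le_sq'
        · linarith
        · linarith
      have i : (Real.sinh a * Real.sinh b) ^ 2 =
          (Real.cosh a ^ 2 - 1) * (Real.cosh b ^ 2 - 1) := by
        rw [pa, pb]; ring
      nlinarith
    rw [← e] at e2
    have hs2 : 0 < Real.sinh (u + v) ^ 2 := by positivity
    exact le_of_mul_le_mul_left (by linarith) hs2
  have hPQ' : 0 < P + Q := by
    have : |Q| < P := abs_lt_of_sq_lt_sq (by linarith) hP0.le
    linarith [(abs_lt.1 this).1]
  have i1 : P * Real.cosh u - Q * Real.sinh u = Real.cosh a := by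
    refine mul_left_cancel₀ hs.ne' ?_
    have : Real.sinh (u + v) * (P * Real.cosh u - Q * Real.sinh u) =
      (Real.sinh (u + v) * P) * Real.cosh u - (Real.sinh (u + v) * Q) * Real.sinh u := by ring
    rw [this, eP, eQ, Real.sinh_add]
    ring
  have i2 : P * Real.cosh v + Q * Real.sinh v = Real.cosh b := by
    refine mul_left_cancel₀ hs.ne' ?_
    have : Real.sinh (u + v) * (P * Real.cosh v + Q * Real.sinh v) =
      (Real.sinh (u + v) * P) * Real.cosh v + (Real.sinh (u + v) * Q) * Real.sinh v := by ring
    rw [this, eP, eQ, Real.sinh_add]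
    ring
  let I : ℝ → UpperHalfPlane := fun w => ⟨⟨0, Real.exp w⟩, Real.exp_pos w⟩
  have hI : ∀ w w', dist (I w) (I w') = |w - w'| := by
    intro w w'
    have e : ∀ w, (I w).im = Real.exp w := fun w => rfl
    rw [UpperHalfPlane.dist_of_re_eq (by rfl), e, e, Real.log_exp, Real.log_exp, Real.dist_eq]
  let z : UpperHalfPlane := ⟨⟨Real.sqrt (P ^ 2 - Q ^ 2 - 1) / (P + Q), 1 / (P + Q)⟩, by
    show 0 < 1 / (P + Q)
    positivity⟩
  have hz : ∀ w, Real.cosh (dist (I w) z) = P * Real.cosh w + Q * Real.sinh w := by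
    intro w
    have e1 : (I w).re = 0 := rfl
    have e2 : (I w).im = Real.exp w := rfl
    have e3 : z.re = Real.sqrt (P ^ 2 - Q ^ 2 - 1) / (P + Q) := rfl
    have e4 : z.im = 1 / (P + Q) := rfl
    rw [UpperHalfPlane.cosh_dist', e1, e2, e3, e4, Real.cosh_eq, Real.sinh_eq, Real.exp_neg]
    have hsq := Real.sq_sqrt (show 0 ≤ P ^ 2 - Q ^ 2 - 1 by linarith)
    have he := (Real.exp_pos w).ne'
    have : (0 - Real.sqrt (P ^ 2 - Q ^ 2 - 1) / (P + Q)) ^ 2 =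
        (P ^ 2 - Q ^ 2 - 1) / (P + Q) ^ 2 := by
      rw [zero_sub, neg_sq, div_pow, hsq]
    rw [this]
    field_simp
    ring
  have inj : ∀ s t : ℝ, 0 ≤ s → 0 ≤ t → Real.cosh s = Real.cosh t → s = t := by
    intro s t hs ht h
    rw [← abs_of_nonneg hs, ← abs_of_nonneg ht]
    exact le_antisymm (Real.cosh_le_cosh.1 h.le) (Real.cosh_le_cosh.1 h.ge)
  refine ⟨I (-u), I v, z, I 0, ?_, ?_, ?_, ?_, ?_, ?_⟩
  · rw [hI, abs_sub_comm, abs_of_nonneg] <;> linarith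
  · refine inj _ _ dist_nonneg hb ?_
    rw [hz, i2]
  · refine inj _ _ dist_nonneg ha ?_
    rw [hz, Real.cosh_neg, Real.sinh_neg, ← i1]
    ring
  · rw [hI, abs_sub_comm, abs_of_nonneg] <;> linarith
  · rw [hI, abs_sub_comm, abs_of_nonneg] <;> linarith
  · have hD0 : 0 ≤ dist (I 0) z := dist_nonneg
    have hD := hz 0
    rw [Real.cosh_zero, Real.sinh_zero, mul_one, mul_zero, add_zero] at hD
    set D := dist (I 0) z
    have hsD := Real.sinh_nonneg_iff.2 hD0
    have hQD : |Q| ≤ Real.sinh D := by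
      refine abs_le_of_sq_le_sq ?_ hsD
      have := Real.cosh_sq D
      rw [hD] at this
      linarith
    have hDc : Real.sinh D * (Q / Real.sinh D) = Q := by
      rcases eq_or_ne (Real.sinh D) 0 with h | h
      · have : Q = 0 := by rw [h] at hQD; exact abs_nonpos_iff.1 hQD
        simp [h, this]
      · field_simp
    refine ⟨Q / Real.sinh D, ?_, ?_, ?_⟩
    · rw [abs_div, abs_of_nonneg hsD]
      exact div_le_one_of_le₀ hQD hsD
    · rw [hD]
      have : Real.sinh D * Real.sinh u * (Q / Real.sinh D) =
        Real.sinh u * (Real.sinh D * (Q / Real.sinh D)) := by ring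
      rw [this, hDc]
      linarith
    · rw [hD]
      have : Real.sinh D * Real.sinh v * (-(Q / Real.sinh D)) =
        -(Real.sinh v * (Real.sinh D * (Q / Real.sinh D))) := by ring
      rw [this, hDc]
      linarith

/-- A closed ball of a metric space that behaves like a ball of a `CAT` space of curvature at most
`m ^ 2`, inside a locally geodesically complete space. The inequality `stewart` is the comparison of
the distance from a vertex of a triangle to a point of the opposite side with the corresponding
distance in the sphere of curvature `m ^ 2`, where it is an equality. -/
structure ComparisonBall {X : Type u} [MetricSpace X] (x₀ : X) (r₀ m : ℝ) : Prop where
  radius_pos : 0 < r₀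
  scale_pos : 0 < m
  scale_le : m * r₀ ≤ Real.pi / 100
  compact : IsCompact (Metric.closedBall x₀ (10 * r₀))
  exists_geodesic : ∀ x ∈ Metric.closedBall x₀ (10 * r₀), ∀ y ∈ Metric.closedBall x₀ (10 * r₀),
    ∃ γ : ℝ → X, IsGeodesicFromTo γ x y ∧
      ∀ t ∈ Icc 0 (dist x y), γ t ∈ Metric.closedBall x₀ (10 * r₀)
  stewart : ∀ x ∈ Metric.closedBall x₀ (10 * r₀), ∀ y ∈ Metric.closedBall x₀ (10 * r₀),
    ∀ z ∈ Metric.closedBall x₀ (10 * r₀), ∀ p ∈ Metric.closedBall x₀ (10 * r₀),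
    dist x p + dist p y = dist x y →
    Real.sin (m * dist p y) * Real.cos (m * dist x z) +
      Real.sin (m * dist x p) * Real.cos (m * dist y z) ≤
    Real.sin (m * dist x y) * Real.cos (m * dist p z)
  complete : LocallyGeodesicallyComplete X

theorem onGeodesic_of_dist_add {Y : Type u} [MetricSpace Y] {x y p : Y} {γ η : ℝ → Y}
    (hγ : IsGeodesicFromTo γ x p) (hη : IsGeodesicFromTo η p y)
    (h : dist x p + dist p y = dist x y) : OnGeodesic x y p := by
  classical
  have key : ∀ s t, 0 ≤ s → s ≤ dist x p → dist x p < t → t ≤ dist x y →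
      dist (γ s) (η (t - dist x p)) = t - s := by
    intro s t hs0 hs ht ht1
    have g1 := hγ.1 s ⟨hs0, hs⟩ (dist x p) ⟨dist_nonneg, le_rfl⟩
    have g2 := hγ.1 0 ⟨le_rfl, dist_nonneg⟩ s ⟨hs0, hs⟩
    have g3 := hη.1 0 ⟨le_rfl, dist_nonneg⟩ (t - dist x p) ⟨by linarith, by linarith⟩
    have g4 := hη.1 (t - dist x p) ⟨by linarith, by linarith⟩ (dist p y) ⟨dist_nonneg, le_rfl⟩
    rw [hγ.2.2, abs_of_nonpos (by linarith)] at g1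
    rw [hγ.2.1, abs_of_nonpos (by linarith)] at g2
    rw [hη.2.1, abs_of_nonpos (by linarith)] at g3
    rw [hη.2.2, abs_of_nonpos (by linarith)] at g4
    apply le_antisymm
    · have := dist_triangle (γ s) p (η (t - dist x p))
      linarith
    · have := dist_triangle4 x (γ s) (η (t - dist x p)) y
      linarith
  have hl : dist x p ≤ dist x y := by have := dist_nonneg (x := p) (y := y); linarith
  refine ⟨fun t => if t ≤ dist x p then γ t else η (t - dist x p), ⟨?_, ?_, ?_⟩, dist x p,
    ⟨dist_nonneg, hl⟩, ?_⟩
  · intro s hs t ht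
    by_cases h1 : s ≤ dist x p <;> by_cases h2 : t ≤ dist x p
    · simp only [h1, h2, if_true]
      exact hγ.1 s ⟨hs.1, h1⟩ t ⟨ht.1, h2⟩
    · simp only [h1, h2, if_true, if_false]
      push Not at h2
      rw [key s t hs.1 h1 h2 ht.2, abs_of_nonpos (by linarith)]
      ring
    · simp only [h1, h2, if_true, if_false]
      push Not at h1
      rw [dist_comm, key t s ht.1 h2 h1 hs.2, abs_of_nonneg (by linarith)]
    · simp only [h1, h2, if_false]
      push Not at h1 h2
      rw [hη.1 _ ⟨by linarith, by linarith [hs.2]⟩ _ ⟨by linarith, by linarith [ht.2]⟩]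
      congr 1
      ring
  · simp [dist_nonneg, hγ.2.1]
  · by_cases h1 : dist x y ≤ dist x p
    · have h2 : dist x y = dist x p := le_antisymm h1 hl
      have h3 : dist p y = 0 := by linarith
      have h4 := dist_eq_zero.1 h3
      simp only [h1, if_true]
      rw [h2, hγ.2.2, h4]
    · simp only [h1, if_false]
      rw [← h, add_sub_cancel_left, hη.2.2]
  · simp [hγ.2.2]

/-- The closed ball of radius `10 r₀` around the center of a tiny ball is a `ComparisonBall`, with
`m = √κ` if `κ > 0`, and with `m = π / (100 r₀)` if `κ ≤ 0`: an upper curvature bound `κ ≤ 0` implies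
every positive one. -/
theorem IsTinyBall.exists_comparisonBall {κ : ℝ} {X : Type u} [MetricSpace X] {x₀ : X} {r₀ : ℝ}
    (hX : IsGCBA κ X) (h : IsTinyBall κ x₀ r₀) : ∃ m, ComparisonBall x₀ r₀ m := by
  have hr := h.radius_pos
  have hd : ∀ x y : Metric.closedBall x₀ (10 * r₀), dist x y ≤ 20 * r₀ := by
    intro x y
    have h1 := Metric.mem_closedBall.1 x.2
    have h2 := Metric.mem_closedBall'.1 y.2
    have := dist_triangle (x : X) x₀ y
    have : dist x y = dist (x : X) y := rfl
    linarith
  have hed : ∀ x y : Metric.closedBall x₀ (10 * r₀), edist x y ≤ ENNReal.ofReal (20 * r₀) := by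
    intro x y
    rw [edist_dist]
    exact ENNReal.ofReal_le_ofReal (hd x y)
  have hgeo : ∀ x y : Metric.closedBall x₀ (10 * r₀), ∃ γ, IsGeodesicFromTo γ x y := by
    intro x y
    refine h.cat.geodesic x y (((hed x y).trans_lt ?_).trans_le h.radius_le)
    rw [ENNReal.ofReal_lt_ofReal_iff] <;> linarith
  have hper : ∀ x y z : Metric.closedBall x₀ (10 * r₀),
      edist x y + edist y z + edist z x < 2 * modelDiam κ := by
    intro x y z
    calc edist x y + edist y z + edist z x
        ≤ ENNReal.ofReal (20 * r₀) + ENNReal.ofReal (20 * r₀) + ENNReal.ofReal (20 * r₀) :=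
          add_le_add (add_le_add (hed _ _) (hed _ _)) (hed _ _)
      _ = ENNReal.ofReal (60 * r₀) := by
          rw [← ENNReal.ofReal_add, ← ENNReal.ofReal_add] <;> [skip; skip; skip; skip; skip] <;>
            first | positivity | (congr 1; ring)
      _ < ENNReal.ofReal (200 * r₀) := by
          rw [ENNReal.ofReal_lt_ofReal_iff] <;> linarith
      _ = 2 * ENNReal.ofReal (100 * r₀) := by
          rw [show (200 : ℝ) * r₀ = 2 * (100 * r₀) by ring, ENNReal.ofReal_mul (by norm_num)]
          norm_num
      _ ≤ _ := by gcongr; exact h.radius_le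
  have hon : ∀ x y p : Metric.closedBall x₀ (10 * r₀), dist x p + dist p y = dist x y →
      OnGeodesic x y p := by
    intro x y p hp
    obtain ⟨γ, hγ⟩ := hgeo x p
    obtain ⟨η, hη⟩ := hgeo p y
    exact onGeodesic_of_dist_add hγ hη hp
  have hon' : ∀ x z : Metric.closedBall x₀ (10 * r₀), OnGeodesic x z z :=
    fun x z => hon x z z (by simp)
  -- it suffices to bound the distance from the vertex `z` to a point `p` of the side `x y`
  suffices hS : ∃ m : ℝ, 0 < m ∧ m * r₀ ≤ Real.pi / 100 ∧
      ∀ x y z p : Metric.closedBall x₀ (10 * r₀), dist x p + dist p y = dist x y →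
        0 < dist x y →
        ∃ D : ℝ, dist p z ≤ D ∧ m * D ≤ Real.pi ∧
          Real.sin (m * dist p y) * Real.cos (m * dist x z) +
            Real.sin (m * dist x p) * Real.cos (m * dist y z) ≤
          Real.sin (m * dist x y) * Real.cos (m * D) by
    obtain ⟨m, hm, hmr, hS⟩ := hS
    refine ⟨m, hr, hm, hmr, h.compact, ?_, ?_, hX.geodesicallyComplete⟩
    · intro x hx y hy
      obtain ⟨γ, hγ⟩ := hgeo ⟨x, hx⟩ ⟨y, hy⟩
      exact ⟨fun t => γ t, ⟨fun s hs t ht => hγ.1 s hs t ht, congrArg Subtype.val hγ.2.1,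
        congrArg Subtype.val hγ.2.2⟩, fun t _ => (γ t).2⟩
    · intro x hx y hy z hz p hp hxy
      rcases eq_or_lt_of_le (dist_nonneg (x := x) (y := y)) with h0 | h0
      · have h1 : dist p y = 0 := by
          have := dist_nonneg (x := x) (y := p)
          have := dist_nonneg (x := p) (y := y)
          linarith
        have h2 : dist x p = 0 := by linarith
        simp [h1, h2, ← h0]
      obtain ⟨D, hD1, hD2, hD⟩ := hS ⟨x, hx⟩ ⟨y, hy⟩ ⟨z, hz⟩ ⟨p, hp⟩ hxy h0
      refine hD.trans ?_
      have hl : dist x y ≤ 20 * r₀ := hd ⟨x, hx⟩ ⟨y, hy⟩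
      refine mul_le_mul_of_nonneg_left ?_ (Real.sin_nonneg_of_nonneg_of_le_pi
        (by positivity) ?_)
      · exact Real.cos_le_cos_of_nonneg_of_le_pi (by positivity) hD2
          (mul_le_mul_of_nonneg_left hD1 hm.le)
      · have := mul_le_mul_of_nonneg_left hl hm.le
        have := Real.pi_pos
        show m * dist x y ≤ Real.pi
        nlinarith
  rcases lt_trichotomy κ 0 with hκ | hκ | hκ
  · set n := Real.sqrt (-κ) with hn
    have hn0 : 0 < n := Real.sqrt_pos.2 (by linarith)
    have hm0 : 0 < Real.pi / (100 * r₀) := by positivity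
    refine ⟨Real.pi / (100 * r₀), hm0, ?_, ?_⟩
    · apply le_of_eq; field_simp
    intro x y z p hxy h0
    have d1 := hd x z
    have d2 := hd x p
    have d3 := hd p y
    have d4 := hd y z
    have t1 := dist_triangle x y z
    have t2 := dist_triangle y x z
    have t3 := dist_triangle x z y
    rw [dist_comm y x] at t2
    rw [dist_comm z y] at t3
    obtain ⟨x', y', z', p', e1, e2, e3, e4, e5, c, hc, h1, h2⟩ :=
      exists_hyperbolic_comparison (u := n * dist x p) (v := n * dist p y) (a := n * dist x z)
        (b := n * dist y z) (by positivity) (by positivity)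
        (by rw [← mul_add, hxy]; positivity) (by positivity) (by positivity)
        (by rw [← mul_add, hxy, ← mul_sub, abs_mul, abs_of_pos hn0]
            refine mul_le_mul_of_nonneg_left (abs_le.2 ⟨by linarith, by linarith⟩) hn0.le)
        (by rw [← mul_add, hxy, ← mul_add]
            exact mul_le_mul_of_nonneg_left t3 hn0.le)
    have hthin := h.cat.thin_neg hκ x y z p z (hper x y z) (hon _ _ _ hxy) (hon' x z)
      x' y' z' p' z' (by beta_reduce; rw [e1, ← mul_add, hxy, ← hn]; field_simp)
      (by beta_reduce; rw [e2, ← hn]; field_simp) (by beta_reduce; rw [e3, ← hn]; field_simp)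
      (by beta_reduce; rw [e4, ← hn]; field_simp) (by beta_reduce; rw [e5, ← hn]; field_simp)
      (by beta_reduce; rw [e3, ← hn]; field_simp) (by simp)
    rw [← hn] at hthin
    have hD0 : 0 ≤ dist p' z' := dist_nonneg
    have hD : dist p' z' ≤ n * (40 * r₀) := by
      have := dist_triangle p' x' z'
      rw [dist_comm p' x', e4, e3] at this
      have := mul_le_mul_of_nonneg_left d1 hn0.le
      have := mul_le_mul_of_nonneg_left d2 hn0.le
      linarith
    set m := Real.pi / (100 * r₀) with hm
    have hmr : m * (100 * r₀) = Real.pi := by rw [hm]; field_simp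
    have hmn : m / n * n = m := by field_simp
    have hm0 : 0 < m := by positivity
    have hDn : m / n * dist p' z' ≤ m * (40 * r₀) := by
      calc m / n * dist p' z' ≤ m / n * (n * (40 * r₀)) :=
            mul_le_mul_of_nonneg_left hD (by positivity)
        _ = (m / n * n) * (40 * r₀) := by ring
        _ = _ := by rw [hmn]
    have hpi := Real.pi_pos
    have hm2 := mul_le_mul_of_nonneg_left d2 hm0.le
    have hm3 := mul_le_mul_of_nonneg_left d3 hm0.le
    have H1 := cos_le_of_hyperbolic_hinge (m := m / n) (by positivity) hD0
      (by positivity) (by rw [mul_add, ← mul_assoc, hmn]; linarith) (by positivity) hc h1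
    have H2 := cos_le_of_hyperbolic_hinge (m := m / n) (by positivity) hD0
      (by positivity) (by rw [mul_add, ← mul_assoc, hmn]; linarith) (by positivity)
      (by rwa [abs_neg]) h2
    simp only [← mul_assoc, hmn] at H1 H2
    refine ⟨dist p' z' / n, hthin, ?_, ?_⟩
    · rw [← mul_div_assoc, mul_div_right_comm]; linarith
    · rw [← hxy, mul_add, Real.sin_add, ← mul_div_assoc m, mul_div_right_comm]
      have s1 : 0 ≤ Real.sin (m * dist x p) :=
        Real.sin_nonneg_of_nonneg_of_le_pi (by positivity) (by linarith)
      have s2 : 0 ≤ Real.sin (m * dist p y) :=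
        Real.sin_nonneg_of_nonneg_of_le_pi (by positivity) (by linarith)
      linarith [mul_le_mul_of_nonneg_left H1 s2, mul_le_mul_of_nonneg_left H2 s1]
  · have hm0 : 0 < Real.pi / (100 * r₀) := by positivity
    refine ⟨Real.pi / (100 * r₀), hm0, ?_, ?_⟩
    · apply le_of_eq; field_simp
    intro x y z p hxy h0
    have d1 := hd x z
    have d2 := hd x p
    have d3 := hd p y
    have d4 := hd y z
    have t1 := dist_triangle x y z
    have t2 := dist_triangle y x z
    have t3 := dist_triangle x z y
    rw [dist_comm y x] at t2
    rw [dist_comm z y] at t3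
    obtain ⟨x', y', z', p', e1, e2, e3, e4, e5, c, hc, h1, h2⟩ :=
      exists_plane_comparison (u := dist x p) (v := dist p y) (a := dist x z)
        (b := dist y z) (by positivity) (by positivity)
        (by rwa [hxy]) (by positivity) (by positivity)
        (by rw [hxy]; exact abs_le.2 ⟨by linarith, by linarith⟩)
        (by rw [hxy]; exact t3)
    have hthin := h.cat.thin_zero hκ x y z p z (hper x y z) (hon _ _ _ hxy) (hon' x z)
      x' y' z' p' z' (e1.trans hxy) e2 e3 e4 e5 e3 (by simp)
    have hD0 : 0 ≤ dist p' z' := dist_nonneg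
    have hD : dist p' z' ≤ 40 * r₀ := by
      have := dist_triangle p' x' z'
      rw [dist_comm p' x', e4, e3] at this
      linarith
    set m := Real.pi / (100 * r₀) with hm
    have hmr : m * (100 * r₀) = Real.pi := by rw [hm]; field_simp
    have hpi := Real.pi_pos
    have hm2 := mul_le_mul_of_nonneg_left d2 hm0.le
    have hm3 := mul_le_mul_of_nonneg_left d3 hm0.le
    have hm4 := mul_le_mul_of_nonneg_left hD hm0.le
    have H1 := cos_le_of_euclidean_hinge hm0 hD0
      (by positivity) (by rw [mul_add]; linarith) (by positivity) hc h1
    have H2 := cos_le_of_euclidean_hinge hm0 hD0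
      (by positivity) (by rw [mul_add]; linarith) (by positivity)
      (by rwa [abs_neg]) h2
    refine ⟨dist p' z', hthin, ?_, ?_⟩
    · linarith
    · rw [← hxy, mul_add, Real.sin_add]
      have s1 : 0 ≤ Real.sin (m * dist x p) :=
        Real.sin_nonneg_of_nonneg_of_le_pi (by positivity) (by linarith)
      have s2 : 0 ≤ Real.sin (m * dist p y) :=
        Real.sin_nonneg_of_nonneg_of_le_pi (by positivity) (by linarith)
      linarith [mul_le_mul_of_nonneg_left H1 s2, mul_le_mul_of_nonneg_left H2 s1]
  · set m := Real.sqrt κ with hm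
    have hm0 : 0 < m := Real.sqrt_pos.2 hκ
    have hmr : m * (100 * r₀) ≤ Real.pi := by
      have := h.radius_le
      rw [modelDiam, if_pos hκ, ENNReal.ofReal_le_ofReal_iff (by positivity), ← hm,
        le_div_iff₀ hm0] at this
      linarith
    refine ⟨m, hm0, by linarith, ?_⟩
    intro x y z p hxy h0
    have hpi := Real.pi_pos
    have d0 := mul_le_mul_of_nonneg_left (hd x y) hm0.le
    have d1 := mul_le_mul_of_nonneg_left (hd x z) hm0.le
    have d4 := mul_le_mul_of_nonneg_left (hd y z) hm0.le
    have t1 := dist_triangle x y z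
    have t2 := dist_triangle y x z
    have t3 := dist_triangle x z y
    rw [dist_comm y x] at t2
    rw [dist_comm z y] at t3
    obtain ⟨x', y', z', p', e1, e2, e3, e4, e5, h1⟩ :=
      exists_sphere_comparison (u := m * dist x p) (v := m * dist p y) (a := m * dist x z)
        (b := m * dist y z) (by positivity) (by positivity)
        (by rw [← mul_add, hxy]; positivity) (by rw [← mul_add, hxy]; linarith)
        (by positivity) (by positivity) (by linarith)
        (by rw [← mul_add, hxy, ← mul_sub, abs_mul, abs_of_pos hm0]
            refine mul_le_mul_of_nonneg_left (abs_le.2 ⟨by linarith, by linarith⟩) hm0.le)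
        (by rw [← mul_add, hxy, ← mul_add]
            exact mul_le_mul_of_nonneg_left t3 hm0.le)
    have hz' : (z' : EuclideanSpace ℝ (Fin 3)) ≠ 0 := by
      intro h
      have := mem_sphere_zero_iff_norm.1 z'.2
      rw [h, norm_zero] at this
      norm_num at this
    have hthin := h.cat.thin_pos hκ x y z p z (hper x y z) (hon _ _ _ hxy) (hon' x z)
      x' y' z' p' z' (by beta_reduce; rw [e1, ← mul_add, hxy, ← hm]; field_simp)
      (by beta_reduce; rw [e2, ← hm]; field_simp) (by beta_reduce; rw [e3, ← hm]; field_simp)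
      (by beta_reduce; rw [e4, ← hm]; field_simp) (by beta_reduce; rw [e5, ← hm]; field_simp)
      (by beta_reduce; rw [e3, ← hm]; field_simp) (by beta_reduce; rw [InnerProductGeometry.angle_self hz']; simp)
    rw [← hm] at hthin
    have ec : m * (InnerProductGeometry.angle (p' : EuclideanSpace ℝ (Fin 3)) z' / m) =
      InnerProductGeometry.angle (p' : EuclideanSpace ℝ (Fin 3)) z' := by field_simp
    refine ⟨_, hthin, ?_, ?_⟩
    · rw [ec]; exact InnerProductGeometry.angle_le_pi _ _
    · rw [ec, ← hxy, mul_add, h1]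

/-! ### Comparison angles, uniqueness and extension of geodesics -/

/-- The cosine of the angle opposite to `c` of a triangle with sides `a, b, c` in the sphere of
curvature `m ^ 2`. -/
def sphCos (m a b c : ℝ) : ℝ :=
  (Real.cos (m * c) - Real.cos (m * a) * Real.cos (m * b)) / (Real.sin (m * a) * Real.sin (m * b))

theorem sphCos_comm (m a b c : ℝ) : sphCos m a b c = sphCos m b a c := by
  rw [sphCos, sphCos, mul_comm (Real.cos (m * a)), mul_comm (Real.sin (m * a))]

/-- The ball of radius `10 r₀`, in which all comparisons take place. -/
abbrev bigBall {X : Type u} [MetricSpace X] (x₀ : X) (r₀ : ℝ) : Set X :=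
  Metric.closedBall x₀ (10 * r₀)

namespace ComparisonBall

variable {X : Type u} [MetricSpace X] {x₀ : X} {r₀ m : ℝ}

theorem mul_dist_le (h : ComparisonBall x₀ r₀ m) {x y : X} (hx : x ∈ bigBall x₀ r₀)
    (hy : y ∈ bigBall x₀ r₀) : m * dist x y ≤ Real.pi / 5 := by
  have h1 := Metric.mem_closedBall.1 hx
  have h2 := Metric.mem_closedBall'.1 hy
  have h3 := dist_triangle x x₀ y
  have h4 := mul_le_mul_of_nonneg_left (show dist x y ≤ 20 * r₀ by linarith) h.scale_pos.le
  linarith [h.scale_le]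

theorem sin_pos (h : ComparisonBall x₀ r₀ m) {x y : X} (hx : x ∈ bigBall x₀ r₀)
    (hy : y ∈ bigBall x₀ r₀) (hxy : 0 < dist x y) : 0 < Real.sin (m * dist x y) := by
  have := h.mul_dist_le hx hy
  have := h.scale_pos
  exact Real.sin_pos_of_pos_of_lt_pi (by positivity) (by linarith [Real.pi_pos])

/-- Comparison angles at `x` decrease when one of the points moves towards `x`. -/
theorem sphCos_mono (h : ComparisonBall x₀ r₀ m) {x y z p : X} (hx : x ∈ bigBall x₀ r₀)
    (hy : y ∈ bigBall x₀ r₀) (hz : z ∈ bigBall x₀ r₀) (hp : p ∈ bigBall x₀ r₀)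
    (hxy : dist x p + dist p y = dist x y) (hxp : 0 < dist x p) (hxz : 0 < dist x z) :
    sphCos m (dist x z) (dist x y) (dist y z) ≤ sphCos m (dist x z) (dist x p) (dist p z) := by
  have h0 : 0 < dist x y := by have := dist_nonneg (x := p) (y := y); linarith
  have s1 := h.sin_pos hx hy h0
  have s2 := h.sin_pos hx hp hxp
  have s3 := h.sin_pos hx hz hxz
  have hs := h.stewart x hx y hy z hz p hp hxy
  have hv : m * dist p y = m * dist x y - m * dist x p := by rw [← hxy]; ring
  rw [hv, Real.sin_sub] at hs
  rw [sphCos, sphCos, div_le_div_iff₀ (by positivity) (by positivity)]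
  have := mul_le_mul_of_nonneg_left hs s3.le
  linarith

theorem sphCos_mono₂ (h : ComparisonBall x₀ r₀ m) {x y z p q : X} (hx : x ∈ bigBall x₀ r₀)
    (hy : y ∈ bigBall x₀ r₀) (hz : z ∈ bigBall x₀ r₀) (hp : p ∈ bigBall x₀ r₀)
    (hq : q ∈ bigBall x₀ r₀)
    (hxy : dist x p + dist p y = dist x y) (hxp : 0 < dist x p)
    (hxz : dist x q + dist q z = dist x z) (hxq : 0 < dist x q) :
    sphCos m (dist x y) (dist x z) (dist y z) ≤ sphCos m (dist x p) (dist x q) (dist p q) := by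
  have h0 : 0 < dist x z := by have := dist_nonneg (x := q) (y := z); linarith
  have h1 := h.sphCos_mono hx hy hz hp hxy hxp h0
  have h2 := h.sphCos_mono hx hz hp hq hxz hxq hxp
  rw [sphCos_comm m (dist x y)]
  refine h1.trans ?_
  rw [sphCos_comm, dist_comm p z, dist_comm p q]
  exact h2

/-- Geodesics are determined by their end points. -/
theorem eq_of_dist_add (h : ComparisonBall x₀ r₀ m) {x y p q : X} (hx : x ∈ bigBall x₀ r₀)
    (hy : y ∈ bigBall x₀ r₀) (hp : p ∈ bigBall x₀ r₀) (hq : q ∈ bigBall x₀ r₀)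
    (hxp : dist x p + dist p y = dist x y) (hxq : dist x q + dist q y = dist x y)
    (hpq : dist x p = dist x q) : p = q := by
  rcases eq_or_lt_of_le (dist_nonneg (x := x) (y := y)) with h0 | h0
  · have e1 : dist x p = 0 := by
      have := dist_nonneg (x := x) (y := p)
      have := dist_nonneg (x := p) (y := y)
      linarith
    rw [← dist_eq_zero.1 e1, ← dist_eq_zero.1 (hpq.symm.trans e1)]
  have hs := h.stewart x hx y hy q hq p hp hxp
  have e : dist y q = dist p y := by rw [dist_comm]; linarith
  rw [e, ← hpq, mul_comm (Real.sin (m * dist x p)), mul_comm (Real.sin (m * dist p y)), add_comm,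
    mul_comm (Real.cos (m * dist p y)), mul_comm (Real.cos (m * dist x p)),
    mul_comm (Real.sin (m * dist p y)), ← Real.sin_add, ← mul_add, hxp] at hs
  have s1 := h.sin_pos hx hy h0
  have h1 : 1 ≤ Real.cos (m * dist p q) := by
    by_contra! hc
    nlinarith
  by_contra hne
  have h2 : 0 < dist p q := dist_pos.2 hne
  have h3 := h.mul_dist_le hp hq
  have h4 := h.scale_pos
  have h5 := Real.cos_lt_cos_of_nonneg_of_le_pi (x := 0) (y := m * dist p q) le_rfl
    (by linarith [Real.pi_pos]) (by positivity)
  rw [Real.cos_zero] at h5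
  linarith

theorem exists_dist_eq (h : ComparisonBall x₀ r₀ m) {x y : X} (hx : x ∈ bigBall x₀ r₀)
    (hy : y ∈ bigBall x₀ r₀) {t : ℝ} (h0 : 0 ≤ t) (h1 : t ≤ dist x y) :
    ∃ p ∈ bigBall x₀ r₀, dist x p = t ∧ dist p y = dist x y - t := by
  obtain ⟨γ, hγ, hB⟩ := h.exists_geodesic x hx y hy
  refine ⟨γ t, hB t ⟨h0, h1⟩, ?_, ?_⟩
  · have := hγ.1 0 ⟨le_rfl, dist_nonneg⟩ t ⟨h0, h1⟩
    rw [hγ.2.1] at this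
    rw [this, zero_sub, abs_neg, abs_of_nonneg h0]
  · have := hγ.1 t ⟨h0, h1⟩ (dist x y) ⟨dist_nonneg, le_rfl⟩
    rw [hγ.2.2] at this
    rw [this, abs_of_nonpos (by linarith)]
    ring

/-- A concatenation of geodesics that is a geodesic near the common point is a geodesic. -/
theorem dist_add_dist_of_local (h : ComparisonBall x₀ r₀ m) {x y z p q : X}
    (hx : x ∈ bigBall x₀ r₀)
    (hy : y ∈ bigBall x₀ r₀) (hz : z ∈ bigBall x₀ r₀) (hp : p ∈ bigBall x₀ r₀)
    (hq : q ∈ bigBall x₀ r₀) (hxp : dist x p + dist p y = dist x y)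
    (hqz : dist y q + dist q z = dist y z) (hpq : dist p y + dist y q = dist p q)
    (hpy : 0 < dist p y) (hyq : 0 < dist y q) : dist x y + dist y z = dist x z := by
  have h1 : 0 < dist x y := by have := dist_nonneg (x := x) (y := p); linarith
  have h2 : 0 < dist y z := by have := dist_nonneg (x := q) (y := z); linarith
  rw [dist_comm p y] at hpy hpq hxp
  have hm := h.sphCos_mono₂ hy hx hz hp hq (p := p) (q := q)
    (by rw [dist_comm p x, dist_comm y x]; linarith) hpy hqz hyq
  have s1 := h.sin_pos hy hp hpy
  have s2 := h.sin_pos hy hq hyq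
  have s3 := h.sin_pos hx hy h1
  have s4 := h.sin_pos hy hz h2
  have e : sphCos m (dist y p) (dist y q) (dist p q) = -1 := by
    rw [sphCos, ← hpq, mul_add, Real.cos_add, div_eq_iff (by positivity)]
    ring
  rw [e, sphCos, dist_comm y x, div_le_iff₀ (by positivity)] at hm
  have hc : Real.cos (m * dist x z) ≤ Real.cos (m * (dist x y + dist y z)) := by
    rw [mul_add, Real.cos_add]; linarith
  have m1 := h.mul_dist_le hx hy
  have m2 := h.mul_dist_le hy hz
  have m3 := h.mul_dist_le hx hz
  have m0 := h.scale_pos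
  have pi := Real.pi_pos
  have hle : m * (dist x y + dist y z) ≤ m * dist x z :=
    (Real.strictAntiOn_cos.le_iff_ge (a := m * dist x z) ⟨by positivity, by linarith⟩
      ⟨by positivity, by rw [mul_add]; linarith⟩).1 hc
  exact le_antisymm (le_of_mul_le_mul_left hle m0) (dist_triangle x y z)

/-- Geodesics extend up to the boundary of the big ball. -/
theorem exists_extension (h : ComparisonBall x₀ r₀ m) {x y : X} (hx : x ∈ bigBall x₀ r₀)
    (hy : y ∈ bigBall x₀ r₀) (hxy : x ≠ y) {T : ℝ} (hT : 0 ≤ T) (hyT : dist x₀ y + T < 10 * r₀) :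
    ∃ z ∈ bigBall x₀ r₀, dist x y + dist y z = dist x z ∧ dist y z = T := by
  -- take a point as far from `y` as possible
  have hc : IsCompact (bigBall x₀ r₀ ∩ {z | dist x y + dist y z = dist x z ∧ dist y z ≤ T}) := by
    refine h.compact.inter_right ?_
    exact (isClosed_eq (f := fun z => dist x y + dist y z) (g := fun z => dist x z)
      (by fun_prop) (by fun_prop)).inter
      (isClosed_le (f := fun z => dist y z) (g := fun _ => T) (by fun_prop) (by fun_prop))
  obtain ⟨z, ⟨hz, hz1, hz2⟩, hmax⟩ := hc.exists_isMaxOn ⟨y, hy, by simp [hT]⟩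
    (f := fun z => dist y z) (by fun_prop)
  refine ⟨z, hz, hz1, le_antisymm hz2 (not_lt.1 fun hlt => ?_)⟩
  have hxy0 : 0 < dist x y := dist_pos.2 hxy
  have hl : 0 < dist x z := by have := dist_nonneg (x := y) (y := z); linarith
  have hz0 : dist x₀ z < 10 * r₀ := by have := dist_triangle x₀ y z; linarith
  obtain ⟨γ, hγ, hγB⟩ := h.exists_geodesic x hx z hz
  obtain ⟨ε, hε, γ', he, hloc⟩ := h.complete γ 0 (dist x z) hl (fun t ht =>
    ⟨1, one_pos, fun s hs s' hs' _ _ => hγ.1 s hs s' hs'⟩)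
  obtain ⟨ε', hε', hg⟩ := hloc (dist x z) ⟨by linarith, by linarith⟩
  obtain ⟨τ, hτ0, hτ⟩ : ∃ τ, 0 < τ ∧ τ < min (min ε ε') (min (dist x z)
      (min (T - dist y z) (10 * r₀ - dist x₀ z))) := by
    apply exists_between
    simp only [lt_min_iff]
    exact ⟨⟨hε, hε'⟩, hl, by linarith, by linarith⟩
  simp only [lt_min_iff] at hτ
  obtain ⟨⟨hτ1, hτ2⟩, hτ3, hτ4, hτ5⟩ := hτ
  have ez : γ' (dist x z) = z := by rw [he ⟨hl.le, le_rfl⟩, hγ.2.2]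
  have ep : γ' (dist x z - τ) = γ (dist x z - τ) := he ⟨by linarith, by linarith⟩
  set p := γ' (dist x z - τ) with hp
  set q := γ' (dist x z + τ) with hq
  have hpB : p ∈ bigBall x₀ r₀ := by rw [ep]; exact hγB _ ⟨by linarith, by linarith⟩
  have d1 : dist p z = τ := by
    have := hg (dist x z - τ) ⟨by linarith, by linarith⟩ (dist x z) ⟨by linarith, by linarith⟩
      (by rw [abs_lt]; constructor <;> linarith) (by rw [abs_lt]; constructor <;> linarith)
    rw [ez] at this
    rw [hp, this, abs_of_neg] <;> linarith
  have d2 : dist z q = τ := by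
    have := hg (dist x z) ⟨by linarith, by linarith⟩ (dist x z + τ) ⟨by linarith, by linarith⟩
      (by rw [abs_lt]; constructor <;> linarith) (by rw [abs_lt]; constructor <;> linarith)
    rw [ez] at this
    rw [hq, this, abs_of_neg] <;> linarith
  have d3 : dist p q = 2 * τ := by
    have := hg (dist x z - τ) ⟨by linarith, by linarith⟩ (dist x z + τ)
      ⟨by linarith, by linarith⟩
      (by rw [abs_lt]; constructor <;> linarith) (by rw [abs_lt]; constructor <;> linarith)
    rw [hp, hq, this, abs_of_neg] <;> linarith
  have d4 : dist x p = dist x z - τ := by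
    have := hγ.1 0 ⟨le_rfl, hl.le⟩ (dist x z - τ) ⟨by linarith, by linarith⟩
    rw [hγ.2.1] at this
    rw [ep, this, abs_of_neg] <;> linarith
  have hqB : q ∈ bigBall x₀ r₀ := by
    rw [Metric.mem_closedBall, dist_comm]
    have := dist_triangle x₀ z q
    linarith
  have hxq := h.dist_add_dist_of_local hx hz hqB hpB hqB (by linarith)
    (by rw [dist_self, add_zero]) (by linarith) (by linarith) (by linarith)
  have t1 := dist_triangle y z q
  have t2 := dist_triangle x y q
  have := hmax (show q ∈ _ from ⟨hqB, by linarith, by linarith⟩)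
  simp only at this
  have : dist y q ≤ dist y z := this
  linarith

theorem exists_extension_length (h : ComparisonBall x₀ r₀ m) {x z : X} (hx : x ∈ bigBall x₀ r₀)
    (hz : z ∈ bigBall x₀ r₀) (hxz : x ≠ z) {T : ℝ} (hT : dist x z ≤ T)
    (hxT : dist x₀ x + T < 10 * r₀) :
    ∃ w ∈ bigBall x₀ r₀, dist x z + dist z w = dist x w ∧ dist x w = T := by
  obtain ⟨w, hw, h1, h2⟩ := h.exists_extension hx hz hxz (T := T - dist x z) (by linarith)
    (by have := dist_triangle x₀ x z; linarith)
  exact ⟨w, hw, h1, by linarith⟩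

end ComparisonBall

/-! ### Angles between geodesics -/

/-- The cosine of the angle opposite to `c` of a Euclidean triangle with sides `a, b, c`. -/
def eucCos (a b c : ℝ) : ℝ := (a ^ 2 + b ^ 2 - c ^ 2) / (2 * a * b)

theorem eucCos_comm (a b c : ℝ) : eucCos a b c = eucCos b a c := by
  rw [eucCos, eucCos, add_comm (a ^ 2), mul_right_comm]

theorem abs_eucCos_le {a b c : ℝ} (ha : 0 < a) (hb : 0 < b) (h1 : |a - b| ≤ c) (h2 : c ≤ a + b) :
    |eucCos a b c| ≤ 1 := by
  have h0 : 0 ≤ c := (abs_nonneg _).trans h1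
  obtain ⟨h3, h4⟩ := abs_le.1 h1
  have hab := mul_pos ha hb
  rw [eucCos, abs_le, le_div_iff₀ (by positivity), div_le_iff₀ (by positivity)]
  constructor
  · nlinarith
  · nlinarith

/-- Spherical and Euclidean comparison angles agree up to a quadratic error. With
`p, q = (c ± (a - b)) / 2` their cosines are `1 - 2 sin p sin q / (sin a sin b)` and
`1 - 2 p q / (a b)`. -/
theorem sphCos_eucCos_aux {a b c : ℝ} (ha : 0 < a) (hb : 0 < b) (h1 : |a - b| ≤ c)
    (h2 : c ≤ a + b) (ha1 : a ≤ 1) (hb1 : b ≤ 1) :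
    sphCos 1 a b c ≤ eucCos a b c ∧ eucCos a b c - (a ^ 2 + b ^ 2) / 2 ≤ sphCos 1 a b c := by
  obtain ⟨h3, h4⟩ := abs_le.1 h1
  have hpi := Real.pi_gt_three
  obtain ⟨p, hp⟩ : ∃ p, p = (c + (a - b)) / 2 := ⟨_, rfl⟩
  obtain ⟨q, hq⟩ : ∃ q, q = (c - (a - b)) / 2 := ⟨_, rfl⟩
  have hp0 : 0 ≤ p := by linarith
  have hq0 : 0 ≤ q := by linarith
  have hpa : p ≤ a := by linarith
  have hqb : q ≤ b := by linarith
  have sa := Real.sin_pos_of_pos_of_lt_pi ha (by linarith)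
  have sb := Real.sin_pos_of_pos_of_lt_pi hb (by linarith)
  have sp := Real.sin_nonneg_of_nonneg_of_le_pi hp0 (by linarith)
  have sq := Real.sin_nonneg_of_nonneg_of_le_pi hq0 (by linarith)
  have eE : eucCos a b c = 1 - 2 * (p * q) / (a * b) := by
    rw [eucCos, hp, hq]; field_simp; ring
  have eS : sphCos 1 a b c = 1 - 2 * (Real.sin p * Real.sin q) / (Real.sin a * Real.sin b) := by
    have e1 : Real.cos (a - b) - Real.cos c = 2 * (Real.sin p * Real.sin q) := by
      have e2 : a - b = p - q := by rw [hp, hq]; ring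
      have e3 : c = p + q := by rw [hp, hq]; ring
      rw [e2, e3, Real.cos_sub, Real.cos_add]; ring
    rw [← e1, Real.cos_sub, sphCos]
    simp only [one_mul]
    field_simp
    ring
  have m1 : p * Real.sin a ≤ a * Real.sin p := sin_mul_le_sin_mul hp0 hpa (by linarith)
  have m2 : q * Real.sin b ≤ b * Real.sin q := sin_mul_le_sin_mul hq0 hqb (by linarith)
  constructor
  · rw [eE, eS]
    have : 2 * (p * q) / (a * b) ≤
        2 * (Real.sin p * Real.sin q) / (Real.sin a * Real.sin b) := by
      rw [div_le_div_iff₀ (by positivity) (by positivity)]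
      have := mul_le_mul m1 m2 (by positivity) (by positivity)
      linarith
    linarith
  · have hE : 2 * (p * q) / (a * b) ≤ 2 := by
      rw [div_le_iff₀ (by positivity)]
      have := mul_le_mul hpa hqb hq0 ha.le
      linarith
    rw [eE, eS]
    have la : a * (1 - a ^ 2 / 6) ≤ Real.sin a := by
      have := Real.sin_ge_sub_cube ha.le; linarith
    have lb : b * (1 - b ^ 2 / 6) ≤ Real.sin b := by
      have := Real.sin_ge_sub_cube hb.le; linarith
    have a2 : a ^ 2 ≤ 1 := by nlinarith
    have b2 : b ^ 2 ≤ 1 := by nlinarith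
    have lab : a * b * (1 - (a ^ 2 + b ^ 2) / 6) ≤ Real.sin a * Real.sin b := by
      have := mul_le_mul la lb (mul_nonneg hb.le (by linarith)) sa.le
      have h6 : 0 ≤ a * b * (a ^ 2 * b ^ 2 / 36) := by positivity
      linarith
    have lpq : Real.sin p * Real.sin q ≤ p * q :=
      mul_le_mul (Real.sin_le hp0) (Real.sin_le hq0) sq hp0
    have hX : 2 * (Real.sin p * Real.sin q) / (Real.sin a * Real.sin b) ≤
        2 * (p * q) / (a * b) * (1 + (a ^ 2 + b ^ 2) / 4) := by
      rw [div_le_iff₀ (by positivity)]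
      have e1 : 2 * (p * q) ≤
          2 * (p * q) / (a * b) * (1 + (a ^ 2 + b ^ 2) / 4) *
            (a * b * (1 - (a ^ 2 + b ^ 2) / 6)) := by
        have : 2 * (p * q) / (a * b) * (1 + (a ^ 2 + b ^ 2) / 4) *
            (a * b * (1 - (a ^ 2 + b ^ 2) / 6)) =
            2 * (p * q) * ((1 + (a ^ 2 + b ^ 2) / 4) * (1 - (a ^ 2 + b ^ 2) / 6)) := by
          field_simp
        rw [this]
        have h7 : 1 ≤ (1 + (a ^ 2 + b ^ 2) / 4) * (1 - (a ^ 2 + b ^ 2) / 6) := by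
          nlinarith [sq_nonneg a, sq_nonneg b]
        have h8 : 0 ≤ 2 * (p * q) := by positivity
        nlinarith
      have e2 := mul_le_mul_of_nonneg_left lab
        (show 0 ≤ 2 * (p * q) / (a * b) * (1 + (a ^ 2 + b ^ 2) / 4) by positivity)
      linarith
    have : 0 ≤ a ^ 2 + b ^ 2 := by positivity
    nlinarith

theorem sphCos_eucCos {m a b c : ℝ} (hm : 0 < m) (ha : 0 < a) (hb : 0 < b) (h1 : |a - b| ≤ c)
    (h2 : c ≤ a + b) (ha1 : m * a ≤ 1) (hb1 : m * b ≤ 1) :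
    sphCos m a b c ≤ eucCos a b c ∧
      eucCos a b c - ((m * a) ^ 2 + (m * b) ^ 2) / 2 ≤ sphCos m a b c := by
  have e1 : sphCos m a b c = sphCos 1 (m * a) (m * b) (m * c) := by simp [sphCos]
  have e2 : eucCos a b c = eucCos (m * a) (m * b) (m * c) := by
    rw [eucCos, eucCos]; field_simp
  rw [e1, e2]
  refine sphCos_eucCos_aux (by positivity) (by positivity) ?_ ?_ ha1 hb1
  · rw [← mul_sub, abs_mul, abs_of_pos hm]
    exact mul_le_mul_of_nonneg_left h1 hm.le
  · rw [← mul_add]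
    exact mul_le_mul_of_nonneg_left h2 hm.le

theorem comparisonAngle_eq (a b c : ℝ) : comparisonAngle a b c = Real.arccos (eucCos a b c) := rfl

section

variable {X : Type u} [MetricSpace X] {x₀ : X} {r₀ m : ℝ}

/-- The angle depends only on the initial pieces of the geodesics. -/
theorem GeodesicAt.angle_congr {x : X} {γ γ' η η' : GeodesicAt x} {ε : ℝ} (hε : 0 < ε)
    (h : ∀ t ∈ Ioo 0 ε, γ.toFun t = γ'.toFun t) (h' : ∀ t ∈ Ioo 0 ε, η.toFun t = η'.toFun t) :
    γ.angle η = γ'.angle η' := by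
  refine limsup_congr ?_
  rw [((nhdsGT_basis (0 : ℝ)).prod_self).eventually_iff]
  exact ⟨ε, hε, fun p hp => by rw [h _ hp.1, h' _ hp.2]⟩

theorem abs_dist_sub_dist_le (x y z : X) : |dist x y - dist x z| ≤ dist y z := by
  rw [dist_comm x y, dist_comm x z]; exact abs_dist_sub_le y z x

/-- `γ` is a geodesic from `x` to `p`. -/
def GeodesicAt.Reaches {x : X} (γ : GeodesicAt x) (p : X) : Prop :=
  γ.length = dist x p ∧ γ.toFun (dist x p) = p

theorem GeodesicAt.dist_source {x : X} (γ : GeodesicAt x) {t : ℝ} (h0 : 0 ≤ t)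
    (h1 : t ≤ γ.length) : dist x (γ.toFun t) = t := by
  have := γ.isGeodesic 0 ⟨le_rfl, γ.length_pos.le⟩ t ⟨h0, h1⟩
  rwa [γ.source, zero_sub, abs_neg, abs_of_nonneg h0] at this

theorem GeodesicAt.Reaches.pos {x p : X} {γ : GeodesicAt x} (h : γ.Reaches p) :
    0 < dist x p := h.1 ▸ γ.length_pos

theorem GeodesicAt.Reaches.dist_target {x p : X} {γ : GeodesicAt x} (h : γ.Reaches p) {t : ℝ}
    (h0 : 0 ≤ t) (h1 : t ≤ dist x p) : dist (γ.toFun t) p = dist x p - t := by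
  have := γ.isGeodesic t ⟨h0, h.1 ▸ h1⟩ (dist x p) ⟨h0.trans h1, h.1.ge⟩
  rw [h.2, abs_of_nonpos (by linarith)] at this
  linarith

theorem GeodesicAt.Reaches.mem {x p : X} {γ : GeodesicAt x} (h : γ.Reaches p)
    (hx : x ∈ Metric.ball x₀ r₀) (hp : p ∈ Metric.closedBall x₀ (5 * r₀)) {t : ℝ}
    (h0 : 0 ≤ t) (h1 : t ≤ dist x p) : γ.toFun t ∈ bigBall x₀ r₀ := by
  have e1 := γ.dist_source h0 (h.1 ▸ h1)
  have e2 := h.dist_target h0 h1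
  rw [Metric.mem_closedBall] at hp ⊢
  rw [Metric.mem_ball] at hx
  have t1 := dist_triangle_left (γ.toFun t) x₀ x
  have t2 := dist_triangle (γ.toFun t) p x₀
  have t3 := dist_triangle_right x p x₀
  have := dist_nonneg (x := x) (y := x₀)
  linarith

theorem ball_subset_bigBall : Metric.ball x₀ r₀ ⊆ bigBall x₀ r₀ := by
  intro x hx
  rw [Metric.mem_ball] at hx
  rw [Metric.mem_closedBall]
  have := dist_nonneg (x := x) (y := x₀)
  linarith

theorem closedBall_subset_bigBall (h : 0 < r₀) :
    Metric.closedBall x₀ (5 * r₀) ⊆ bigBall x₀ r₀ :=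
  Metric.closedBall_subset_closedBall (by linarith)

namespace ComparisonBall

theorem mul_dist_le_one (h : ComparisonBall x₀ r₀ m) {x y : X} (hx : x ∈ bigBall x₀ r₀)
    (hy : y ∈ bigBall x₀ r₀) : m * dist x y ≤ 1 := by
  have := h.mul_dist_le hx hy
  linarith [Real.pi_le_four]

theorem sphCos_eucCos (h : ComparisonBall x₀ r₀ m) {x a b : X} (hx : x ∈ bigBall x₀ r₀)
    (ha : a ∈ bigBall x₀ r₀) (hb : b ∈ bigBall x₀ r₀) (hxa : 0 < dist x a) (hxb : 0 < dist x b) :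
    sphCos m (dist x a) (dist x b) (dist a b) ≤ eucCos (dist x a) (dist x b) (dist a b) ∧
      eucCos (dist x a) (dist x b) (dist a b) - ((m * dist x a) ^ 2 + (m * dist x b) ^ 2) / 2 ≤
        sphCos m (dist x a) (dist x b) (dist a b) :=
  GCBA.sphCos_eucCos h.scale_pos hxa hxb (abs_dist_sub_dist_le _ _ _) (dist_triangle_left _ _ _)
    (h.mul_dist_le_one hx ha) (h.mul_dist_le_one hx hb)

theorem exists_reaches (h : ComparisonBall x₀ r₀ m) {x p : X} (hx : x ∈ Metric.ball x₀ r₀)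
    (hp : p ∈ Metric.closedBall x₀ (5 * r₀)) (hxp : p ≠ x) :
    ∃ γ : GeodesicAt x, γ.Reaches p := by
  obtain ⟨γ, hγ, -⟩ := h.exists_geodesic x (ball_subset_bigBall hx) p
    (closedBall_subset_bigBall h.radius_pos hp)
  exact ⟨⟨γ, dist x p, dist_pos.2 hxp.symm, hγ.2.1, hγ.1⟩, rfl, hγ.2.2⟩

theorem reaches_unique (h : ComparisonBall x₀ r₀ m) {x p q : X} (hx : x ∈ Metric.ball x₀ r₀)
    (hp : p ∈ Metric.closedBall x₀ (5 * r₀)) {γ : GeodesicAt x}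
    (hγ : γ.Reaches p) (hq : q ∈ bigBall x₀ r₀) (hxq : dist x q + dist q p = dist x p) :
    γ.toFun (dist x q) = q := by
  have h1 : dist x q ≤ dist x p := by have := dist_nonneg (x := q) (y := p); linarith
  have e1 := γ.dist_source dist_nonneg (hγ.1 ▸ h1)
  refine h.eq_of_dist_add (ball_subset_bigBall hx) (closedBall_subset_bigBall h.radius_pos hp)
    (hγ.mem hx hp dist_nonneg h1) hq ?_ hxq e1
  rw [e1, hγ.dist_target dist_nonneg h1]; ring

theorem angle_le_arccos (h : ComparisonBall x₀ r₀ m) {x a b : X} (hx : x ∈ Metric.ball x₀ r₀)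
    (ha : a ∈ Metric.closedBall x₀ (5 * r₀)) (hb : b ∈ Metric.closedBall x₀ (5 * r₀))
    {γ η : GeodesicAt x} (hγ : γ.Reaches a) (hη : η.Reaches b) :
    γ.angle η ≤ Real.arccos (sphCos m (dist x a) (dist x b) (dist a b)) := by
  refine GeodesicAt.angle_le_of_eventually ?_
  rw [((nhdsGT_basis (0 : ℝ)).prod_self).eventually_iff]
  refine ⟨min (dist x a) (dist x b), lt_min hγ.pos hη.pos, ?_⟩
  rintro ⟨s, t⟩ ⟨⟨hs0, hs⟩, ht0, ht⟩
  simp only [lt_min_iff] at hs0 hs ht0 ht ⊢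
  have hxB := ball_subset_bigBall hx
  have haB := closedBall_subset_bigBall h.radius_pos ha
  have hbB := closedBall_subset_bigBall h.radius_pos hb
  have m1 := hγ.mem hx ha hs0.le hs.1.le
  have m2 := hη.mem hx hb ht0.le ht.2.le
  have e1 := γ.dist_source hs0.le (hγ.1.symm ▸ hs.1.le)
  have e2 := η.dist_source ht0.le (hη.1.symm ▸ ht.2.le)
  have k1 := h.sphCos_mono₂ hxB haB hbB m1 m2
    (by rw [e1, hγ.dist_target hs0.le hs.1.le]; ring) (by rw [e1]; exact hs0)
    (by rw [e2, hη.dist_target ht0.le ht.2.le]; ring) (by rw [e2]; exact ht0)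
  have k2 := (h.sphCos_eucCos hxB m1 m2 (by rw [e1]; exact hs0) (by rw [e2]; exact ht0)).1
  rw [e1, e2] at k1 k2
  rw [comparisonAngle_eq]
  exact Real.arccos_le_arccos (k1.trans k2)

theorem abs_sphCos_le (h : ComparisonBall x₀ r₀ m) {x a b : X} (hx : x ∈ bigBall x₀ r₀)
    (ha : a ∈ bigBall x₀ r₀)
    (hb : b ∈ bigBall x₀ r₀) (hxa : 0 < dist x a) (hxb : 0 < dist x b) :
    |sphCos m (dist x a) (dist x b) (dist a b)| ≤ 1 := by
  have s1 := h.sin_pos hx ha hxa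
  have s2 := h.sin_pos hx hb hxb
  have m0 := h.scale_pos
  have m1 := h.mul_dist_le hx ha
  have m2 := h.mul_dist_le hx hb
  have hpi := Real.pi_pos
  have t1 := abs_dist_sub_dist_le x a b
  have t2 := dist_triangle_left a b x
  rw [sphCos, abs_le, le_div_iff₀ (by positivity), div_le_iff₀ (by positivity)]
  constructor
  · have : Real.cos (m * (dist x a + dist x b)) ≤ Real.cos (m * dist a b) :=
      Real.cos_le_cos_of_nonneg_of_le_pi (by positivity) (by rw [mul_add]; linarith)
        (mul_le_mul_of_nonneg_left t2 m0.le)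
    rw [mul_add, Real.cos_add] at this
    linarith
  · have : Real.cos (m * dist a b) ≤ Real.cos (m * (dist x a - dist x b)) := by
      rw [← Real.cos_abs (m * (dist x a - dist x b)), abs_mul, abs_of_pos m0]
      exact Real.cos_le_cos_of_nonneg_of_le_pi (by positivity)
        (by linarith [h.mul_dist_le ha hb])
        (mul_le_mul_of_nonneg_left t1 m0.le)
    rw [mul_sub, Real.cos_sub] at this
    linarith

theorem sphCos_le_cos_angle (h : ComparisonBall x₀ r₀ m) {x a b : X} (hx : x ∈ Metric.ball x₀ r₀)
    (ha : a ∈ Metric.closedBall x₀ (5 * r₀)) (hb : b ∈ Metric.closedBall x₀ (5 * r₀))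
    {γ η : GeodesicAt x} (hγ : γ.Reaches a) (hη : η.Reaches b) :
    sphCos m (dist x a) (dist x b) (dist a b) ≤ Real.cos (γ.angle η) := by
  have h1 := h.angle_le_arccos hx ha hb hγ hη
  have h2 := abs_le.1 (h.abs_sphCos_le (ball_subset_bigBall hx)
    (closedBall_subset_bigBall h.radius_pos ha) (closedBall_subset_bigBall h.radius_pos hb)
    hγ.pos hη.pos)
  have h3 := Real.cos_le_cos_of_nonneg_of_le_pi (γ.angle_nonneg η) (Real.arccos_le_pi _) h1
  rwa [Real.cos_arccos h2.1 h2.2] at h3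

/-- Comparison angles at small scales exceed the angle by little. -/
theorem cos_angle_le (h : ComparisonBall x₀ r₀ m) {x : X} (γ η : GeodesicAt x) {ε : ℝ}
    (hε : 0 < ε) : ∃ s₀ > 0, ∀ s ∈ Ioo 0 s₀, ∀ t ∈ Ioo 0 s₀,
      Real.cos (γ.angle η) - ε ≤ sphCos m s t (dist (γ.toFun s) (η.toFun t)) := by
  obtain ⟨s₁, hs₁, H⟩ := GeodesicAt.eventually_lt
    (show γ.angle η < γ.angle η + ε / 2 by linarith)
  have hm := h.scale_pos
  refine ⟨min (min s₁ (min (min γ.length η.length) r₀)) (min 1 (ε / 2) / m),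
    lt_min (lt_min hs₁ (lt_min (lt_min γ.length_pos η.length_pos) h.radius_pos))
      (by positivity), ?_⟩
  rintro s ⟨hs0, hs⟩ t ⟨ht0, ht⟩
  simp only [lt_min_iff, lt_div_iff₀ hm] at hs ht
  obtain ⟨⟨hs1, ⟨hs2, hs3⟩, hs4⟩, hs5, hs6⟩ := hs
  obtain ⟨⟨ht1, ⟨ht2, ht3⟩, ht4⟩, ht5, ht6⟩ := ht
  have H1 := H s ⟨hs0, hs1⟩ t ⟨ht0, ht1⟩
  have e1 := γ.dist_source hs0.le hs2.le
  have e2 := η.dist_source ht0.le ht3.le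
  have k1 : |s - t| ≤ dist (γ.toFun s) (η.toFun t) := by
    have := abs_dist_sub_dist_le x (γ.toFun s) (η.toFun t)
    rwa [e1, e2] at this
  have k2 : dist (γ.toFun s) (η.toFun t) ≤ s + t := by
    have := dist_triangle_left (γ.toFun s) (η.toFun t) x
    rwa [e1, e2] at this
  have k3 := (GCBA.sphCos_eucCos hm hs0 ht0 k1 k2 (by linarith) (by linarith)).2
  have k4 := abs_le.1 (abs_eucCos_le hs0 ht0 k1 k2)
  have k5 : Real.cos (γ.angle η) - ε / 2 ≤ eucCos s t (dist (γ.toFun s) (η.toFun t)) := by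
    rw [comparisonAngle_eq] at H1
    set θ := Real.arccos (eucCos s t (dist (γ.toFun s) (η.toFun t))) with hθ
    have e3 : Real.cos θ = eucCos s t (dist (γ.toFun s) (η.toFun t)) := Real.cos_arccos k4.1 k4.2
    rw [← e3]
    rcases le_total θ (γ.angle η) with hle | hle
    · have := Real.cos_le_cos_of_nonneg_of_le_pi (Real.arccos_nonneg _) (γ.angle_le_pi η) hle
      linarith
    · have := (abs_le.1 (Real.abs_cos_sub_cos_le (γ.angle η) θ)).2
      rw [abs_of_nonpos (by linarith)] at this
      linarith
  have k6 : (m * s) ^ 2 + (m * t) ^ 2 ≤ ε := by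
    have : 0 < m * s := by positivity
    have : 0 < m * t := by positivity
    nlinarith
  linarith

end ComparisonBall

end

/-! ### Angles between points and spaces of directions -/

/-- The angle at `y` between geodesics from `y` to `a` and to `b`. Where it is used, these geodesics are
unique, so that the infimum is that of a single number, see `ComparisonBall.ang_eq`. -/
def ang {X : Type u} [MetricSpace X] (y a b : X) : ℝ :=
  sInf {θ | ∃ γ η : GeodesicAt y, γ.Reaches a ∧ η.Reaches b ∧ θ = γ.angle η}

section

variable {X : Type u} [MetricSpace X] {x₀ : X} {r₀ m : ℝ}

namespace ComparisonBall

theorem reaches_eqOn (h : ComparisonBall x₀ r₀ m) {y a : X} (hy : y ∈ Metric.ball x₀ r₀)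
    (ha : a ∈ Metric.closedBall x₀ (5 * r₀)) {γ γ' : GeodesicAt y} (hγ : γ.Reaches a)
    (hγ' : γ'.Reaches a) {t : ℝ} (h0 : 0 ≤ t) (h1 : t ≤ dist y a) : γ.toFun t = γ'.toFun t := by
  have e1 := γ'.dist_source h0 (hγ'.1 ▸ h1)
  have := h.reaches_unique hy ha hγ (hγ'.mem hy ha h0 h1)
    (by rw [e1, hγ'.dist_target h0 h1]; ring)
  rwa [e1] at this

theorem ang_eq (h : ComparisonBall x₀ r₀ m) {y a b : X} (hy : y ∈ Metric.ball x₀ r₀)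
    (ha : a ∈ Metric.closedBall x₀ (5 * r₀)) (hb : b ∈ Metric.closedBall x₀ (5 * r₀))
    {γ η : GeodesicAt y} (hγ : γ.Reaches a) (hη : η.Reaches b) : ang y a b = γ.angle η := by
  have : {θ | ∃ γ η : GeodesicAt y, γ.Reaches a ∧ η.Reaches b ∧ θ = γ.angle η} =
      {γ.angle η} := by
    ext θ
    simp only [mem_ofPred_eq, mem_singleton_iff]
    constructor
    · rintro ⟨γ', η', hγ', hη', rfl⟩
      refine GeodesicAt.angle_congr (lt_min hγ.pos hη.pos) (fun t ht => ?_) (fun t ht => ?_)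
      · exact h.reaches_eqOn hy ha hγ' hγ ht.1.le (ht.2.le.trans (min_le_left _ _))
      · exact h.reaches_eqOn hy hb hη' hη ht.1.le (ht.2.le.trans (min_le_right _ _))
    · rintro rfl
      exact ⟨γ, η, hγ, hη, rfl⟩
  rw [ang, this, csInf_singleton]

theorem ang_comm (h : ComparisonBall x₀ r₀ m) {y a b : X} (hy : y ∈ Metric.ball x₀ r₀)
    (ha : a ∈ Metric.closedBall x₀ (5 * r₀)) (hb : b ∈ Metric.closedBall x₀ (5 * r₀))
    (hay : a ≠ y) (hby : b ≠ y) : ang y a b = ang y b a := by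
  obtain ⟨γ, hγ⟩ := h.exists_reaches hy ha hay
  obtain ⟨η, hη⟩ := h.exists_reaches hy hb hby
  rw [h.ang_eq hy ha hb hγ hη, h.ang_eq hy hb ha hη hγ, GeodesicAt.angle_comm]

theorem ang_triangle (h : ComparisonBall x₀ r₀ m) {y a b c : X} (hy : y ∈ Metric.ball x₀ r₀)
    (ha : a ∈ Metric.closedBall x₀ (5 * r₀)) (hb : b ∈ Metric.closedBall x₀ (5 * r₀))
    (hc : c ∈ Metric.closedBall x₀ (5 * r₀)) (hay : a ≠ y) (hby : b ≠ y) (hcy : c ≠ y) :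
    ang y a c ≤ ang y a b + ang y b c := by
  obtain ⟨γ, hγ⟩ := h.exists_reaches hy ha hay
  obtain ⟨η, hη⟩ := h.exists_reaches hy hb hby
  obtain ⟨ζ, hζ⟩ := h.exists_reaches hy hc hcy
  rw [h.ang_eq hy ha hb hγ hη, h.ang_eq hy hb hc hη hζ, h.ang_eq hy ha hc hγ hζ]
  exact GeodesicAt.angle_triangle _ _ _

theorem ang_nonneg (h : ComparisonBall x₀ r₀ m) {y a b : X} (hy : y ∈ Metric.ball x₀ r₀)
    (ha : a ∈ Metric.closedBall x₀ (5 * r₀)) (hb : b ∈ Metric.closedBall x₀ (5 * r₀))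
    (hay : a ≠ y) (hby : b ≠ y) : 0 ≤ ang y a b := by
  obtain ⟨γ, hγ⟩ := h.exists_reaches hy ha hay
  obtain ⟨η, hη⟩ := h.exists_reaches hy hb hby
  rw [h.ang_eq hy ha hb hγ hη]
  exact GeodesicAt.angle_nonneg _ _

theorem ang_le_pi (h : ComparisonBall x₀ r₀ m) {y a b : X} (hy : y ∈ Metric.ball x₀ r₀)
    (ha : a ∈ Metric.closedBall x₀ (5 * r₀)) (hb : b ∈ Metric.closedBall x₀ (5 * r₀))
    (hay : a ≠ y) (hby : b ≠ y) : ang y a b ≤ Real.pi := by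
  obtain ⟨γ, hγ⟩ := h.exists_reaches hy ha hay
  obtain ⟨η, hη⟩ := h.exists_reaches hy hb hby
  rw [h.ang_eq hy ha hb hγ hη]
  exact GeodesicAt.angle_le_pi _ _

theorem sphCos_le_cos_ang (h : ComparisonBall x₀ r₀ m) {y a b : X} (hy : y ∈ Metric.ball x₀ r₀)
    (ha : a ∈ Metric.closedBall x₀ (5 * r₀)) (hb : b ∈ Metric.closedBall x₀ (5 * r₀))
    (hay : a ≠ y) (hby : b ≠ y) :
    sphCos m (dist y a) (dist y b) (dist a b) ≤ Real.cos (ang y a b) := by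
  obtain ⟨γ, hγ⟩ := h.exists_reaches hy ha hay
  obtain ⟨η, hη⟩ := h.exists_reaches hy hb hby
  rw [h.ang_eq hy ha hb hγ hη]
  exact h.sphCos_le_cos_angle hy ha hb hγ hη

theorem cos_ang_le (h : ComparisonBall x₀ r₀ m) {y a b : X} (hy : y ∈ Metric.ball x₀ r₀)
    (ha : a ∈ Metric.closedBall x₀ (5 * r₀)) (hb : b ∈ Metric.closedBall x₀ (5 * r₀))
    (hay : a ≠ y) (hby : b ≠ y) {ε : ℝ} (hε : 0 < ε) :
    ∃ s₀ > 0, ∀ a' ∈ bigBall x₀ r₀, ∀ b' ∈ bigBall x₀ r₀,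
      dist y a' + dist a' a = dist y a → dist y b' + dist b' b = dist y b →
      0 < dist y a' → 0 < dist y b' → dist y a' < s₀ → dist y b' < s₀ →
      Real.cos (ang y a b) - ε ≤ sphCos m (dist y a') (dist y b') (dist a' b') := by
  obtain ⟨γ, hγ⟩ := h.exists_reaches hy ha hay
  obtain ⟨η, hη⟩ := h.exists_reaches hy hb hby
  obtain ⟨s₀, hs₀, H⟩ := h.cos_angle_le γ η hε
  refine ⟨s₀, hs₀, fun a' ha' b' hb' e1 e2 p1 p2 l1 l2 => ?_⟩
  have := H _ ⟨p1, l1⟩ _ ⟨p2, l2⟩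
  rwa [h.reaches_unique hy ha hγ ha' e1, h.reaches_unique hy hb hη hb' e2,
    ← h.ang_eq hy ha hb hγ hη] at this

/-- The angle does not change when an end point moves along its geodesic. -/
theorem ang_of_between (h : ComparisonBall x₀ r₀ m) {y a b a' : X} (hy : y ∈ Metric.ball x₀ r₀)
    (ha : a ∈ Metric.closedBall x₀ (5 * r₀)) (hb : b ∈ Metric.closedBall x₀ (5 * r₀))
    (ha' : a' ∈ Metric.closedBall x₀ (5 * r₀))
    (ha'y : a' ≠ y) (hby : b ≠ y) (e : dist y a' + dist a' a = dist y a) :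
    ang y a' b = ang y a b := by
  have hpos : 0 < dist y a' := dist_pos.2 ha'y.symm
  have hle : dist y a' ≤ dist y a := by have := dist_nonneg (x := a') (y := a); linarith
  have hay : a ≠ y := fun h => by rw [h, dist_self] at hle; linarith
  obtain ⟨γ, hγ⟩ := h.exists_reaches hy ha hay
  obtain ⟨η, hη⟩ := h.exists_reaches hy hb hby
  let γ' : GeodesicAt y := ⟨γ.toFun, dist y a', hpos, γ.source, fun s hs t ht =>
    γ.isGeodesic s ⟨hs.1, hs.2.trans (hle.trans hγ.1.ge)⟩ t
      ⟨ht.1, ht.2.trans (hle.trans hγ.1.ge)⟩⟩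
  have hu := h.reaches_unique hy ha hγ (closedBall_subset_bigBall h.radius_pos ha') e
  have hγ' : γ'.Reaches a' := ⟨rfl, hu⟩
  rw [h.ang_eq hy ha hb hγ hη, h.ang_eq hy ha' hb hγ' hη]
  rfl

theorem ang_eq_pi (h : ComparisonBall x₀ r₀ m) {y a b : X} (hy : y ∈ Metric.ball x₀ r₀)
    (ha : a ∈ Metric.closedBall x₀ (5 * r₀)) (hb : b ∈ Metric.closedBall x₀ (5 * r₀))
    (hay : a ≠ y) (hby : b ≠ y) (e : dist a y + dist y b = dist a b) : ang y a b = Real.pi := by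
  have haB := closedBall_subset_bigBall h.radius_pos ha
  have hbB := closedBall_subset_bigBall h.radius_pos hb
  have hyB := ball_subset_bigBall hy
  have pa : 0 < dist y a := dist_pos.2 hay.symm
  have pb : 0 < dist y b := dist_pos.2 hby.symm
  have key : Real.cos (ang y a b) ≤ -1 := by
    refine le_of_forall_pos_le_add fun ε hε => ?_
    obtain ⟨s₀, hs₀, H⟩ := h.cos_ang_le hy ha hb hay hby hε
    obtain ⟨t, ht0, ht⟩ : ∃ t, 0 < t ∧ t < min s₀ (min (dist y a) (dist y b)) :=
      exists_between (lt_min hs₀ (lt_min pa pb))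
    simp only [lt_min_iff] at ht
    obtain ⟨a', ha', e1, e2⟩ := h.exists_dist_eq hyB haB ht0.le ht.2.1.le
    obtain ⟨b', hb', e3, e4⟩ := h.exists_dist_eq hyB hbB ht0.le ht.2.2.le
    have hd : dist a' b' = t + t := by
      apply le_antisymm
      · have := dist_triangle_left a' b' y; linarith
      · have := dist_triangle4 a a' b' b
        rw [dist_comm a a', dist_comm a y] at *
        linarith
    have := H a' ha' b' hb' (by linarith) (by linarith) (by linarith) (by linarith)
      (by linarith) (by linarith)
    have s1 := h.sin_pos hyB ha' (by linarith)
    have e5 : sphCos m t t (t + t) = -1 := by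
      rw [e1] at s1
      rw [sphCos, mul_add, Real.cos_add, div_eq_iff (by positivity)]
      ring
    rw [e1, e3, hd, e5] at this
    linarith
  have h1 : Real.cos (ang y a b) = Real.cos Real.pi :=
    Real.cos_pi ▸ le_antisymm key (Real.neg_one_le_cos _)
  exact Real.injOn_cos ⟨h.ang_nonneg hy ha hb hay hby, h.ang_le_pi hy ha hb hay hby⟩
    ⟨Real.pi_pos.le, le_rfl⟩ h1

theorem dist_coe (h : ComparisonBall x₀ r₀ m) {y a b : X} (hy : y ∈ Metric.ball x₀ r₀)
    (ha : a ∈ Metric.closedBall x₀ (5 * r₀)) (hb : b ∈ Metric.closedBall x₀ (5 * r₀))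
    {γ η : GeodesicAt y} (hγ : γ.Reaches a) (hη : η.Reaches b) :
    dist (γ : SpaceOfDirections y) (η : SpaceOfDirections y) = ang y a b := by
  rw [UniformSpace.Completion.dist_eq, h.ang_eq hy ha hb hγ hη]
  rfl

theorem mem_of_dist_le {y z : X} (hy : y ∈ Metric.ball x₀ r₀) {t : ℝ} (ht : dist y z ≤ t)
    (ht' : t ≤ 4 * r₀) : z ∈ Metric.closedBall x₀ (5 * r₀) := by
  rw [Metric.mem_ball] at hy
  rw [Metric.mem_closedBall]
  have := dist_triangle_left z x₀ y
  linarith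

/-- Every point of `Σ_y` is the direction of a geodesic of length `R`. -/
theorem exists_direction (h : ComparisonBall x₀ r₀ m) {y : X} (hy : y ∈ Metric.ball x₀ r₀)
    {R : ℝ} (hR : 0 < R) (hR' : R ≤ r₀) (v : SpaceOfDirections y) :
    ∃ z, dist y z = R ∧ ∃ γ : GeodesicAt y, γ.Reaches z ∧ v = γ := by
  have hr := h.radius_pos
  have hyB := ball_subset_bigBall hy
  have hW : ∀ z, dist y z = R → z ∈ Metric.closedBall x₀ (5 * r₀) := fun z hz =>
    mem_of_dist_le hy hz.le (by linarith)
  have hex : ∀ z : {z // dist y z = R}, ∃ γ : GeodesicAt y, γ.Reaches z := fun z =>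
    h.exists_reaches hy (hW z z.2) fun he => by
      have := z.2
      rw [he, dist_self] at this
      linarith
  choose g hg using hex
  have hcpt : CompactSpace {z // dist y z = R} := by
    apply isCompact_iff_compactSpace.1
    refine h.compact.of_isClosed_subset (isClosed_eq (by fun_prop) (by fun_prop)) fun z hz => ?_
    exact closedBall_subset_bigBall hr (hW z hz)
  have hs : 0 < Real.sin (m * R) := by
    have := h.scale_le
    have := h.scale_pos
    exact Real.sin_pos_of_pos_of_lt_pi (by positivity)
      (by nlinarith [Real.pi_pos])
  have hcont : Continuous fun z => (g z : SpaceOfDirections y) := by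
    rw [continuous_iff_continuousAt]
    intro z
    refine tendsto_iff_dist_tendsto_zero.2 (squeeze_zero (fun _ => dist_nonneg) (fun z' => ?_)
      (?_ : Tendsto (fun z' : {z // dist y z = R} =>
        Real.arccos (sphCos m R R (dist (z' : X) z))) (𝓝 z) (𝓝 0)))
    · rw [h.dist_coe hy (hW _ z'.2) (hW _ z.2) (hg z') (hg z),
        h.ang_eq hy (hW _ z'.2) (hW _ z.2) (hg z') (hg z)]
      have := h.angle_le_arccos hy (hW _ z'.2) (hW _ z.2) (hg z') (hg z)
      rwa [z'.2, z.2] at this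
    · have e : Real.arccos (sphCos m R R (dist (z : X) z)) = 0 := by
        rw [dist_self, Real.arccos_eq_zero, sphCos, mul_zero, Real.cos_zero, le_div_iff₀
          (by positivity)]
        have := Real.sin_sq_add_cos_sq (m * R)
        nlinarith
      have hc : Continuous fun z' : {z // dist y z = R} =>
          Real.arccos (sphCos m R R (dist (z' : X) z)) := by
        unfold sphCos
        fun_prop
      have := hc.tendsto z
      rwa [e] at this
  have hdense : ∀ γ : GeodesicAt y, (γ : SpaceOfDirections y) ∈
      range fun z => (g z : SpaceOfDirections y) := by
    intro γ
    obtain ⟨t, ht0, ht⟩ := exists_between (lt_min γ.length_pos (half_pos hR))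
    obtain ⟨ht1, ht2⟩ := lt_min_iff.1 ht
    have hmem : ∀ s, 0 ≤ s → s ≤ t → γ.toFun s ∈ bigBall x₀ r₀ := by
      intro s h0 h1
      refine closedBall_subset_bigBall hr (mem_of_dist_le hy (t := t) ?_ (by linarith))
      rw [γ.dist_source h0 (by linarith)]
      exact h1
    have e1 := γ.dist_source ht0.le ht1.le
    obtain ⟨w, hw, e2, e3⟩ := h.exists_extension_length hyB (hmem t ht0.le le_rfl)
      (dist_pos.1 (by rw [e1]; exact ht0)) (T := R) (by linarith)
      (by rw [Metric.mem_ball'] at hy; linarith)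
    refine ⟨⟨w, e3⟩, ?_⟩
    refine eq_of_dist_eq_zero ?_
    rw [UniformSpace.Completion.dist_eq]
    have : (g ⟨w, e3⟩).angle γ = γ.angle γ := by
      refine GeodesicAt.angle_congr ht0 (fun s hs => ?_) (fun s hs => rfl)
      have e4 := γ.dist_source hs.1.le (hs.2.le.trans ht1.le)
      have e5 := γ.isGeodesic s ⟨hs.1.le, hs.2.le.trans ht1.le⟩ t ⟨ht0.le, ht1.le⟩
      rw [abs_of_nonpos (by linarith [hs.2])] at e5
      have := h.reaches_unique hy (hW w e3) (hg ⟨w, e3⟩) (hmem s hs.1.le hs.2.le) (by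
        apply le_antisymm
        · have := dist_triangle (γ.toFun s) (γ.toFun t) w
          linarith
        · exact dist_triangle _ _ _)
      rwa [e4] at this
    exact this.trans γ.angle_self
  have hcl : IsClosed (range fun z => (g z : SpaceOfDirections y)) :=
    (isCompact_range hcont).isClosed
  have huniv : v ∈ range fun z => (g z : SpaceOfDirections y) := by
    refine UniformSpace.Completion.induction_on v hcl hdense
  obtain ⟨z, hz⟩ := huniv
  exact ⟨z, z.2, g z, hg z, hz.symm⟩

/-- Points at a fixed distance on geodesics depend continuously on the end points. -/
theorem tendsto_of_dist_add (h : ComparisonBall x₀ r₀ m) {ι : Type*} {l : Filter ι}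
    {x a p : X} {xs as ps : ι → X} {t : ℝ} (hx : Tendsto xs l (𝓝 x)) (ha : Tendsto as l (𝓝 a))
    (hxB : x ∈ bigBall x₀ r₀) (haB : a ∈ bigBall x₀ r₀) (hpB : p ∈ bigBall x₀ r₀)
    (e1 : dist x p = t) (e2 : dist p a = dist x a - t)
    (hps : ∀ᶠ i in l, ps i ∈ bigBall x₀ r₀ ∧ dist (xs i) (ps i) = t ∧
      dist (ps i) (as i) = dist (xs i) (as i) - t) : Tendsto ps l (𝓝 p) := by
  refine h.compact.tendsto_nhds_of_unique_mapClusterPt (hps.mono fun i hi => hi.1)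
    fun w hw hcl => ?_
  obtain ⟨𝒰, h𝒰, hlim⟩ := mapClusterPt_iff_ultrafilter.1 hcl
  have hx' := hx.mono_left h𝒰
  have ha' := ha.mono_left h𝒰
  have hps' := hps.filter_mono h𝒰
  have l1 : dist x w = t :=
    tendsto_nhds_unique (hx'.dist hlim)
      (tendsto_const_nhds.congr' (hps'.mono fun i hi => hi.2.1.symm))
  have l2 : dist w a = dist x a - t :=
    tendsto_nhds_unique (hlim.dist ha')
      (((hx'.dist ha').sub_const t).congr' (hps'.mono fun i hi => hi.2.2.symm))
  exact h.eq_of_dist_add hxB haB hw hpB (by linarith) (by linarith) (by linarith)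

/-- Angles are upper semicontinuous. -/
theorem eventually_ang_lt (h : ComparisonBall x₀ r₀ m) {ι : Type*} {l : Filter ι}
    {x a b : X} {xs as bs : ι → X} (hx : Tendsto xs l (𝓝 x)) (ha : Tendsto as l (𝓝 a))
    (hb : Tendsto bs l (𝓝 b)) (hxU : x ∈ Metric.ball x₀ r₀)
    (haW : ∀ᶠ i in l, as i ∈ Metric.closedBall x₀ (5 * r₀))
    (hbW : ∀ᶠ i in l, bs i ∈ Metric.closedBall x₀ (5 * r₀))
    (haW' : a ∈ Metric.closedBall x₀ (5 * r₀)) (hbW' : b ∈ Metric.closedBall x₀ (5 * r₀))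
    (hax : a ≠ x) (hbx : b ≠ x) {θ : ℝ} (hθ : ang x a b < θ) :
    ∀ᶠ i in l, ang (xs i) (as i) (bs i) < θ := by
  have hr := h.radius_pos
  have hxB := ball_subset_bigBall hxU
  have haB := closedBall_subset_bigBall hr haW'
  have hbB := closedBall_subset_bigBall hr hbW'
  have hxsU : ∀ᶠ i in l, xs i ∈ Metric.ball x₀ r₀ :=
    hx.eventually_mem (Metric.isOpen_ball.mem_nhds hxU)
  have hax' : ∀ᶠ i in l, as i ≠ xs i := by
    filter_upwards [(ha.dist hx).eventually (lt_mem_nhds (dist_pos.2 hax))] with i hi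
    exact dist_pos.1 hi
  have hbx' : ∀ᶠ i in l, bs i ≠ xs i := by
    filter_upwards [(hb.dist hx).eventually (lt_mem_nhds (dist_pos.2 hbx))] with i hi
    exact dist_pos.1 hi
  rcases lt_or_ge Real.pi θ with hπ | hπ
  · filter_upwards [hxsU, haW, hbW, hax', hbx'] with i i1 i2 i3 i4 i5
    exact (h.ang_le_pi i1 i2 i3 i4 i5).trans_lt hπ
  have h0 := h.ang_nonneg hxU haW' hbW' hax hbx
  have hcos := Real.cos_lt_cos_of_nonneg_of_le_pi h0 hπ hθ
  obtain ⟨ε, hε, hε'⟩ := exists_between (sub_pos.2 hcos)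
  obtain ⟨s₀, hs₀, H⟩ := h.cos_ang_le hxU haW' hbW' hax hbx hε
  have pa : 0 < dist x a := dist_pos.2 hax.symm
  have pb : 0 < dist x b := dist_pos.2 hbx.symm
  obtain ⟨t, ht0, ht⟩ := exists_between (lt_min (lt_min hs₀ hr) (lt_min pa pb))
  simp only [lt_min_iff] at ht
  obtain ⟨⟨t1, t2⟩, t3, t4⟩ := ht
  obtain ⟨a', ha'B, a1, a2⟩ := h.exists_dist_eq hxB haB ht0.le t3.le
  obtain ⟨b', hb'B, b1, b2⟩ := h.exists_dist_eq hxB hbB ht0.le t4.le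
  have H1 := H a' ha'B b' hb'B (by linarith) (by linarith) (by linarith) (by linarith)
    (by linarith) (by linarith)
  have hex : ∀ i, ∃ p q, (xs i ∈ Metric.ball x₀ r₀ → as i ∈ Metric.closedBall x₀ (5 * r₀) →
      t < dist (xs i) (as i) → p ∈ bigBall x₀ r₀ ∧ dist (xs i) p = t ∧
        dist p (as i) = dist (xs i) (as i) - t) ∧
      (xs i ∈ Metric.ball x₀ r₀ → bs i ∈ Metric.closedBall x₀ (5 * r₀) →
      t < dist (xs i) (bs i) → q ∈ bigBall x₀ r₀ ∧ dist (xs i) q = t ∧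
        dist q (bs i) = dist (xs i) (bs i) - t) := by
    intro i
    have : ∀ c : X, ∃ p, xs i ∈ Metric.ball x₀ r₀ → c ∈ Metric.closedBall x₀ (5 * r₀) →
      t < dist (xs i) c → p ∈ bigBall x₀ r₀ ∧ dist (xs i) p = t ∧
        dist p c = dist (xs i) c - t := by
      intro c
      by_cases hc : xs i ∈ Metric.ball x₀ r₀ ∧ c ∈ Metric.closedBall x₀ (5 * r₀) ∧
        t < dist (xs i) c
      · obtain ⟨p, h1, h2, h3⟩ := h.exists_dist_eq (ball_subset_bigBall hc.1)
          (closedBall_subset_bigBall hr hc.2.1) ht0.le hc.2.2.le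
        exact ⟨p, fun _ _ _ => ⟨h1, h2, h3⟩⟩
      · exact ⟨x, fun c1 c2 c3 => absurd ⟨c1, c2, c3⟩ hc⟩
    obtain ⟨p, hp⟩ := this (as i)
    obtain ⟨q, hq⟩ := this (bs i)
    exact ⟨p, q, hp, hq⟩
  choose p q hp hq using hex
  have ta : ∀ᶠ i in l, t < dist (xs i) (as i) := (hx.dist ha).eventually (lt_mem_nhds t3)
  have tb : ∀ᶠ i in l, t < dist (xs i) (bs i) := (hx.dist hb).eventually (lt_mem_nhds t4)
  have hp' : Tendsto p l (𝓝 a') := h.tendsto_of_dist_add hx ha hxB haB ha'B a1 a2 (by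
    filter_upwards [hxsU, haW, ta] with i i1 i2 i3 using hp i i1 i2 i3)
  have hq' : Tendsto q l (𝓝 b') := h.tendsto_of_dist_add hx hb hxB hbB hb'B b1 b2 (by
    filter_upwards [hxsU, hbW, tb] with i i1 i2 i3 using hq i i1 i2 i3)
  have hlim : Tendsto (fun i => sphCos m t t (dist (p i) (q i))) l
      (𝓝 (sphCos m t t (dist a' b'))) := by
    have hc : Continuous fun d => sphCos m t t d := by unfold sphCos; fun_prop
    exact (hc.tendsto _).comp (hp'.dist hq')
  rw [a1, b1] at H1
  have hev := hlim.eventually (lt_mem_nhds (show Real.cos θ < _ by linarith))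
  filter_upwards [hev, hxsU, haW, hbW, hax', hbx', ta, tb] with i i0 i1 i2 i3 i4 i5 i6 i7
  obtain ⟨p1, p2, p3⟩ := hp i i1 i2 i6
  obtain ⟨q1, q2, q3⟩ := hq i i1 i3 i7
  have hpW : p i ∈ Metric.closedBall x₀ (5 * r₀) := mem_of_dist_le i1 p2.le (by linarith)
  have hqW : q i ∈ Metric.closedBall x₀ (5 * r₀) := mem_of_dist_le i1 q2.le (by linarith)
  have hpx : p i ≠ xs i := fun he => by rw [he, dist_self] at p2; linarith
  have hqx : q i ≠ xs i := fun he => by rw [he, dist_self] at q2; linarith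
  have k := h.sphCos_le_cos_ang i1 hpW hqW hpx hqx
  rw [h.ang_of_between i1 i2 hqW hpW hpx hqx (by linarith), h.ang_comm i1 i2 hqW i4 hqx,
    h.ang_of_between i1 i3 i2 hqW hqx i4 (by linarith), h.ang_comm i1 i3 i2 i5 i4, p2, q2] at k
  by_contra hcon
  push Not at hcon
  have := Real.cos_le_cos_of_nonneg_of_le_pi (h0.trans hθ.le) (h.ang_le_pi i1 i2 i3 i4 i5) hcon
  linarith

end ComparisonBall

end

/-! ### Spherical tuples and strainers in terms of points -/

section

variable {X : Type u} [MetricSpace X] {x₀ : X} {r₀ m : ℝ}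

/-- `a` is different from `y` and, like the points of strainers, lies in the ball of radius `5 r₀`. -/
def Admissible (x₀ : X) (r₀ : ℝ) (y a : X) : Prop :=
  a ∈ Metric.closedBall x₀ (5 * r₀) ∧ a ≠ y

/-- The directions at `y` of the geodesics to `a` and `b` are opposite `δ`-spherical points. All
directions at `y` are realized by points at distance `r₀` from `y`. -/
def OppPair (r₀ δ : ℝ) (y a b : X) : Prop :=
  ∀ z, dist y z = r₀ → ang y a z + ang y z b < Real.pi + δ

/-- The directions at `y` of the geodesics to `p i` and to `p' i` form opposite `δ`-spherical
tuples. -/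
def OppTuples (r₀ δ : ℝ) (y : X) {k : ℕ} (p p' : Fin k → X) : Prop :=
  (∀ i, OppPair r₀ δ y (p i) (p' i)) ∧
    ∀ i j, i ≠ j → ang y (p i) (p' j) < Real.pi / 2 + δ ∧ ang y (p i) (p j) < Real.pi / 2 + δ ∧
      ang y (p' i) (p' j) < Real.pi / 2 + δ

theorem admissible_of_dist_eq {y z : X} (hy : y ∈ Metric.ball x₀ r₀) (hz : dist y z = r₀) :
    Admissible x₀ r₀ y z := by
  have hr : 0 < r₀ := dist_nonneg.trans_lt (Metric.mem_ball.1 hy)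
  exact ⟨ComparisonBall.mem_of_dist_le hy hz.le (by linarith),
    fun he => by rw [he, dist_self] at hz; linarith⟩

namespace ComparisonBall

/-- Every direction has an antipode, the direction of an extension of the geodesic beyond `y`. -/
theorem exists_opposite (h : ComparisonBall x₀ r₀ m) {y a : X} (hy : y ∈ Metric.ball x₀ r₀)
    (ha : Admissible x₀ r₀ y a) {T : ℝ} (hT : 0 < T) (hT' : T ≤ 4 * r₀) :
    ∃ b, Admissible x₀ r₀ y b ∧ dist a y + dist y b = dist a b ∧ dist y b = T ∧
      ang y a b = Real.pi := by
  have hr := h.radius_pos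
  obtain ⟨b, hb, h1, h2⟩ := h.exists_extension (closedBall_subset_bigBall hr ha.1)
    (ball_subset_bigBall hy) ha.2 hT.le (by rw [Metric.mem_ball'] at hy; linarith)
  have hbW : Admissible x₀ r₀ y b := ⟨mem_of_dist_le hy h2.le hT',
    fun he => by rw [he, dist_self] at h2; linarith⟩
  exact ⟨b, hbW, h1, h2, h.ang_eq_pi hy ha.1 hbW.1 ha.2 hbW.2 h1⟩

theorem oppositeSphericalPoints_iff (h : ComparisonBall x₀ r₀ m) {y a b : X} {δ : ℝ}
    (hy : y ∈ Metric.ball x₀ r₀) (ha : Admissible x₀ r₀ y a) (hb : Admissible x₀ r₀ y b)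
    {γ η : GeodesicAt y} (hγ : γ.Reaches a) (hη : η.Reaches b) :
    OppositeSphericalPoints δ (γ : SpaceOfDirections y) (η : SpaceOfDirections y) ↔
      OppPair r₀ δ y a b := by
  constructor
  · intro H z hz
    have hzW := admissible_of_dist_eq hy hz
    obtain ⟨ζ, hζ⟩ := h.exists_reaches hy hzW.1 hzW.2
    have := H ζ
    rwa [h.dist_coe hy ha.1 hzW.1 hγ hζ, h.dist_coe hy hzW.1 hb.1 hζ hη] at this
  · intro H w
    obtain ⟨z, hz, ζ, hζ, rfl⟩ := h.exists_direction hy h.radius_pos le_rfl w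
    have hzW := admissible_of_dist_eq hy hz
    rw [h.dist_coe hy ha.1 hzW.1 hγ hζ, h.dist_coe hy hzW.1 hb.1 hζ hη]
    exact H z hz

theorem ang_add_ang_lt (h : ComparisonBall x₀ r₀ m) {y a b z : X} {δ : ℝ}
    (hy : y ∈ Metric.ball x₀ r₀) (ha : Admissible x₀ r₀ y a) (hb : Admissible x₀ r₀ y b)
    (hz : Admissible x₀ r₀ y z) (H : OppPair r₀ δ y a b) :
    ang y a z + ang y z b < Real.pi + δ := by
  obtain ⟨γ, hγ⟩ := h.exists_reaches hy ha.1 ha.2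
  obtain ⟨η, hη⟩ := h.exists_reaches hy hb.1 hb.2
  obtain ⟨ζ, hζ⟩ := h.exists_reaches hy hz.1 hz.2
  have := (h.oppositeSphericalPoints_iff hy ha hb hγ hη).2 H ζ
  rwa [h.dist_coe hy ha.1 hz.1 hγ hζ, h.dist_coe hy hz.1 hb.1 hζ hη] at this

theorem oppositeSphericalTuples_iff (h : ComparisonBall x₀ r₀ m) {y : X} {δ : ℝ} {k : ℕ}
    {p p' : Fin k → X} (hy : y ∈ Metric.ball x₀ r₀) (hp : ∀ i, Admissible x₀ r₀ y (p i))
    (hp' : ∀ i, Admissible x₀ r₀ y (p' i)) {γ η : Fin k → GeodesicAt y}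
    (hγ : ∀ i, (γ i).Reaches (p i)) (hη : ∀ i, (η i).Reaches (p' i)) :
    OppositeSphericalTuples δ (fun i => (γ i : SpaceOfDirections y))
      (fun i => (η i : SpaceOfDirections y)) ↔ OppTuples r₀ δ y p p' := by
  refine and_congr (forall_congr' fun i =>
    h.oppositeSphericalPoints_iff hy (hp i) (hp' i) (hγ i) (hη i)) ?_
  refine forall_congr' fun i => forall_congr' fun j => ?_
  rw [h.dist_coe hy (hp i).1 (hp' j).1 (hγ i) (hη j), h.dist_coe hy (hp i).1 (hp j).1 (hγ i) (hγ j),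
    h.dist_coe hy (hp' i).1 (hp' j).1 (hη i) (hη j)]

theorem exists_admissible_directions (h : ComparisonBall x₀ r₀ m) {y : X} {k : ℕ}
    (hy : y ∈ Metric.ball x₀ r₀) (v : Fin k → SpaceOfDirections y) :
    ∃ p : Fin k → X, (∀ i, Admissible x₀ r₀ y (p i)) ∧ ∃ γ : Fin k → GeodesicAt y,
      (∀ i, (γ i).Reaches (p i)) ∧ v = fun i => (γ i : SpaceOfDirections y) := by
  choose p hp γ hγ hv using fun i => h.exists_direction hy h.radius_pos le_rfl (v i)
  exact ⟨p, fun i => admissible_of_dist_eq hy (hp i), γ, hγ, funext hv⟩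

/-- As directions are realized by points, strainers are described by angles between points. -/
theorem isStrainerAt_iff (h : ComparisonBall x₀ r₀ m) {y : X} {δ : ℝ} {k : ℕ}
    {p : Fin k → X} (hy : y ∈ Metric.ball x₀ r₀) :
    IsStrainerAt x₀ r₀ δ p y ↔ (∀ i, Admissible x₀ r₀ y (p i)) ∧
      ∃ p' : Fin k → X, (∀ i, Admissible x₀ r₀ y (p' i)) ∧ OppTuples r₀ δ y p p' := by
  refine and_congr_right fun hp => ?_
  constructor
  · rintro ⟨v, hv, v', hvv'⟩
    choose γ hγ1 hγ2 hγ3 using hv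
    obtain ⟨p', hp', η, hη, rfl⟩ := h.exists_admissible_directions hy v'
    obtain rfl : v = fun i => (γ i : SpaceOfDirections y) := funext hγ3
    exact ⟨p', hp', (h.oppositeSphericalTuples_iff hy hp hp' (fun i => ⟨hγ1 i, hγ2 i⟩) hη).1 hvv'⟩
  · rintro ⟨p', hp', H⟩
    choose γ hγ using fun i => h.exists_reaches hy (hp i).1 (hp i).2
    choose η hη using fun i => h.exists_reaches hy (hp' i).1 (hp' i).2
    exact ⟨fun i => γ i, fun i => ⟨γ i, (hγ i).1, (hγ i).2, rfl⟩, fun i => η i,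
      (h.oppositeSphericalTuples_iff hy hp hp' hγ hη).2 H⟩

theorem mem_strainedPoints_iff (h : ComparisonBall x₀ r₀ m) {y : X} {δ : ℝ} {k : ℕ}
    (hy : y ∈ Metric.ball x₀ r₀) :
    y ∈ strainedPoints X k δ ↔ ∃ p p' : Fin k → X, (∀ i, Admissible x₀ r₀ y (p i)) ∧
      (∀ i, Admissible x₀ r₀ y (p' i)) ∧ OppTuples r₀ δ y p p' := by
  constructor
  · rintro ⟨v, v', hvv'⟩
    obtain ⟨p, hp, γ, hγ, rfl⟩ := h.exists_admissible_directions hy v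
    obtain ⟨p', hp', η, hη, rfl⟩ := h.exists_admissible_directions hy v'
    exact ⟨p, p', hp, hp', (h.oppositeSphericalTuples_iff hy hp hp' hγ hη).1 hvv'⟩
  · rintro ⟨p, p', hp, hp', H⟩
    choose γ hγ using fun i => h.exists_reaches hy (hp i).1 (hp i).2
    choose η hη using fun i => h.exists_reaches hy (hp' i).1 (hp' i).2
    exact ⟨fun i => γ i, fun i => η i, (h.oppositeSphericalTuples_iff hy hp hp' hγ hη).2 H⟩

theorem eventually_oppPair (h : ComparisonBall x₀ r₀ m) {y a b : X} {δ : ℝ}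
    (hy : y ∈ Metric.ball x₀ r₀) (ha : Admissible x₀ r₀ y a) (hb : Admissible x₀ r₀ y b)
    (H : OppPair r₀ δ y a b) : ∀ᶠ x in 𝓝 y, OppPair r₀ δ x a b := by
  have hr := h.radius_pos
  refine Filter.mem_iff_ultrafilter.2 fun 𝒰 h𝒰 => ?_
  by_contra hcon
  have hbad := Ultrafilter.compl_mem_iff_notMem.2 hcon
  have hid : Tendsto (fun x : X => x) (𝒰 : Filter X) (𝓝 y) := h𝒰
  have hball : ∀ᶠ x in (𝒰 : Filter X), x ∈ Metric.ball x₀ r₀ :=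
    hid.eventually_mem (Metric.isOpen_ball.mem_nhds hy)
  have hex : ∀ x, ∃ z, ¬ OppPair r₀ δ x a b →
      dist x z = r₀ ∧ Real.pi + δ ≤ ang x a z + ang x z b := by
    intro x
    by_cases hx : OppPair r₀ δ x a b
    · exact ⟨x, fun h => absurd hx h⟩
    · have := hx
      unfold OppPair at this
      push Not at this
      obtain ⟨z, hz⟩ := this
      exact ⟨z, fun _ => hz⟩
  choose z hz using hex
  have hbad' : ∀ᶠ x in (𝒰 : Filter X), dist x (z x) = r₀ ∧
      Real.pi + δ ≤ ang x a (z x) + ang x (z x) b := by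
    filter_upwards [hbad] with x hx using hz x hx
  have hzB : ∀ᶠ x in (𝒰 : Filter X), z x ∈ bigBall x₀ r₀ := by
    filter_upwards [hbad', hball] with x hx hxU
    exact closedBall_subset_bigBall hr (admissible_of_dist_eq hxU hx.1).1
  obtain ⟨w, -, hw⟩ := isCompact_iff_ultrafilter_le_nhds'.1 h.compact (𝒰.map z) hzB
  have hlim : Tendsto z (𝒰 : Filter X) (𝓝 w) := hw
  have hdw : dist y w = r₀ := tendsto_nhds_unique (hid.dist hlim)
    (tendsto_const_nhds.congr' (hbad'.mono fun x hx => hx.1.symm))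
  have hwW := admissible_of_dist_eq hy hdw
  have hzW : ∀ᶠ x in (𝒰 : Filter X), z x ∈ Metric.closedBall x₀ (5 * r₀) := by
    filter_upwards [hbad', hball] with x hx hxU
    exact (admissible_of_dist_eq hxU hx.1).1
  have hlt := H w hdw
  obtain ⟨e, he, he'⟩ := exists_between (sub_pos.2 hlt)
  have k1 := h.eventually_ang_lt hid tendsto_const_nhds hlim hy
    (Eventually.of_forall fun _ => ha.1) hzW ha.1 hwW.1 ha.2 hwW.2
    (show ang y a w < ang y a w + e / 2 by linarith)
  have k2 := h.eventually_ang_lt hid hlim tendsto_const_nhds hy hzW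
    (Eventually.of_forall fun _ => hb.1) hwW.1 hb.1 hwW.2 hb.2
    (show ang y w b < ang y w b + e / 2 by linarith)
  obtain ⟨x, hx1, hx2, hx3⟩ := (k1.and (k2.and hbad')).exists
  linarith [hx3.2]

theorem eventually_admissible {y a : X} (ha : Admissible x₀ r₀ y a) :
    ∀ᶠ x in 𝓝 y, Admissible x₀ r₀ x a := by
  filter_upwards [isOpen_ne.mem_nhds ha.2.symm] with x hx
  exact ⟨ha.1, Ne.symm hx⟩

/-- Being opposite `δ`-spherical tuples is an open condition on the base point. -/
theorem eventually_oppTuples (h : ComparisonBall x₀ r₀ m) {y : X} {δ : ℝ} {k : ℕ}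
    {p p' : Fin k → X} (hy : y ∈ Metric.ball x₀ r₀) (hp : ∀ i, Admissible x₀ r₀ y (p i))
    (hp' : ∀ i, Admissible x₀ r₀ y (p' i)) (H : OppTuples r₀ δ y p p') :
    ∀ᶠ x in 𝓝 y, (∀ i, Admissible x₀ r₀ x (p i)) ∧ (∀ i, Admissible x₀ r₀ x (p' i)) ∧
      OppTuples r₀ δ x p p' := by
  have key : ∀ a b, Admissible x₀ r₀ y a → Admissible x₀ r₀ y b → ∀ θ, ang y a b < θ →
      ∀ᶠ x in 𝓝 y, ang x a b < θ := fun a b ha hb θ hθ =>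
    h.eventually_ang_lt tendsto_id tendsto_const_nhds tendsto_const_nhds hy
      (Eventually.of_forall fun _ => ha.1) (Eventually.of_forall fun _ => hb.1) ha.1 hb.1
      ha.2 hb.2 hθ
  refine ((eventually_all.2 fun i => eventually_admissible (hp i)).and
    ((eventually_all.2 fun i => eventually_admissible (hp' i)).and
    ((eventually_all.2 fun i => h.eventually_oppPair hy (hp i) (hp' i) (H.1 i)).and
      (eventually_all.2 fun i => eventually_all.2 fun j => ?_))))
  by_cases hij : i = j
  · exact Eventually.of_forall fun x hne => absurd hij hne
  · obtain ⟨h1, h2, h3⟩ := H.2 i j hij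
    filter_upwards [key _ _ (hp i) (hp' j) _ h1, key _ _ (hp i) (hp j) _ h2,
      key _ _ (hp' i) (hp' j) _ h3] with x x1 x2 x3 _ using ⟨x1, x2, x3⟩

theorem isOpen_inter_strainedPoints (h : ComparisonBall x₀ r₀ m) {V : Set X} (hV : IsOpen V)
    (hVU : V ⊆ Metric.ball x₀ r₀) (k : ℕ) (δ : ℝ) : IsOpen (V ∩ strainedPoints X k δ) := by
  rw [isOpen_iff_mem_nhds]
  rintro y ⟨hyV, hy⟩
  obtain ⟨p, p', hp, hp', H⟩ := (h.mem_strainedPoints_iff (hVU hyV)).1 hy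
  filter_upwards [hV.mem_nhds hyV, h.eventually_oppTuples (hVU hyV) hp hp' H] with x hx hx'
  exact ⟨hx, (h.mem_strainedPoints_iff (hVU hx)).2 ⟨p, p', hx'⟩⟩

theorem isOpen_diff_nonExtendable (h : ComparisonBall x₀ r₀ m) {V : Set X} (hV : IsOpen V)
    (hVU : V ⊆ Metric.ball x₀ r₀) {k : ℕ} (δ : ℝ) (p : Fin k → X) :
    IsOpen (V \ nonExtendable x₀ r₀ δ p V) := by
  rw [isOpen_iff_mem_nhds]
  rintro y ⟨hyV, hy⟩
  simp only [nonExtendable, mem_ofPred_eq, not_and, not_not] at hy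
  obtain ⟨q, hq⟩ := hy hyV
  obtain ⟨h1, p', h2, h3⟩ := (h.isStrainerAt_iff (hVU hyV)).1 hq
  filter_upwards [hV.mem_nhds hyV, h.eventually_oppTuples (hVU hyV) h1 h2 h3] with x hx hx'
  exact ⟨hx, fun hxE => hxE.2 ⟨q, (h.isStrainerAt_iff (hVU hx)).2 ⟨hx'.1, p', hx'.2⟩⟩⟩

/-- Opposite `δ`-spherical points have distance more than `π - δ`, as is seen from an antipode of one of
them. -/
theorem pi_sub_lt_ang (h : ComparisonBall x₀ r₀ m) {y a b : X} {δ : ℝ}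
    (hy : y ∈ Metric.ball x₀ r₀) (ha : Admissible x₀ r₀ y a) (hb : Admissible x₀ r₀ y b)
    (H : OppPair r₀ δ y a b) : Real.pi - δ < ang y a b := by
  obtain ⟨c, hc, -, -, e⟩ := h.exists_opposite hy ha h.radius_pos (by linarith [h.radius_pos])
  have h1 := h.ang_add_ang_lt hy ha hb hc H
  have h2 := h.ang_triangle hy ha.1 hb.1 hc.1 ha.2 hb.2 hc.2
  rw [h.ang_comm hy hb.1 hc.1 hb.2 hc.2] at h2
  linarith

/-- A strainer map extends by the distance to `x` if `x` has an almost opposite point and is almost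
orthogonal to the given strainer. -/
theorem isStrainerAt_snoc (h : ComparisonBall x₀ r₀ m) {y x x' : X} {δ : ℝ} {k : ℕ}
    {p p' : Fin k → X} (hδ : 0 < δ)
    (hy : y ∈ Metric.ball x₀ r₀) (hp : ∀ i, Admissible x₀ r₀ y (p i))
    (hp' : ∀ i, Admissible x₀ r₀ y (p' i)) (H : OppTuples r₀ δ y p p')
    (hx : Admissible x₀ r₀ y x) (hx' : Admissible x₀ r₀ y x') (Hx : OppPair r₀ δ y x x')
    (Hp : ∀ i, |ang y (p i) x - Real.pi / 2| ≤ δ) :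
    IsStrainerAt x₀ r₀ (12 * δ) (Fin.snoc (α := fun _ => X) p x) y := by
  have mix : ∀ i, ang y (p i) x < Real.pi / 2 + 12 * δ ∧ ang y (p i) x' < Real.pi / 2 + 12 * δ ∧
      ang y (p' i) x < Real.pi / 2 + 12 * δ ∧ ang y (p' i) x' < Real.pi / 2 + 12 * δ := by
    intro i
    obtain ⟨a1, a2⟩ := abs_le.1 (Hp i)
    have b1 := h.ang_add_ang_lt hy hx hx' (hp i) Hx
    have b2 := h.ang_add_ang_lt hy (hp i) (hp' i) hx (H.1 i)
    have b3 := h.ang_add_ang_lt hy hx hx' (hp' i) Hx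
    have b4 := h.pi_sub_lt_ang hy (hp i) (hp' i) (H.1 i)
    have b5 := h.ang_triangle hy (hp i).1 hx.1 (hp' i).1 (hp i).2 hx.2 (hp' i).2
    rw [h.ang_comm hy hx.1 (hp i).1 hx.2 (hp i).2] at b1
    rw [h.ang_comm hy hx.1 (hp' i).1 hx.2 (hp' i).2] at b2 b3 b5
    refine ⟨by linarith, by linarith, by linarith, by linarith⟩
  have hpair : ∀ a b, OppPair r₀ δ y a b → OppPair r₀ (12 * δ) y a b :=
    fun a b hab z hz => (hab z hz).trans (by linarith)
  refine (h.isStrainerAt_iff hy).2 ⟨fun i => ?_, Fin.snoc (α := fun _ => X) p' x', fun i => ?_,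
    fun i => ?_, fun i j hij => ?_⟩
  · induction i using Fin.lastCases with
    | last => simpa using hx
    | cast i => simpa using hp i
  · induction i using Fin.lastCases with
    | last => simpa using hx'
    | cast i => simpa using hp' i
  · induction i using Fin.lastCases with
    | last => simpa using hpair _ _ Hx
    | cast i => simpa using hpair _ _ (H.1 i)
  · induction i using Fin.lastCases with
    | last =>
      induction j using Fin.lastCases with
      | last => exact absurd rfl hij
      | cast j =>
        simp only [Fin.snoc_last, Fin.snoc_castSucc]
        obtain ⟨m1, m2, m3, m4⟩ := mix j
        rw [h.ang_comm hy hx.1 (hp' j).1 hx.2 (hp' j).2,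
          h.ang_comm hy hx.1 (hp j).1 hx.2 (hp j).2, h.ang_comm hy hx'.1 (hp' j).1 hx'.2 (hp' j).2]
        exact ⟨m3, m1, m4⟩
    | cast i =>
      induction j using Fin.lastCases with
      | last =>
        simp only [Fin.snoc_last, Fin.snoc_castSucc]
        obtain ⟨m1, m2, m3, m4⟩ := mix i
        exact ⟨m2, m1, m4⟩
      | cast j =>
        simp only [Fin.snoc_castSucc]
        obtain ⟨m1, m2, m3⟩ := H.2 i j (fun e => hij (by rw [e]))
        exact ⟨by linarith, by linarith, by linarith⟩

end ComparisonBall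

end

/-! ### Estimates for comparison angles -/

theorem cos_le_one_sub_add {t : ℝ} (h : |t| ≤ 1) : Real.cos t ≤ 1 - t ^ 2 / 2 + t ^ 4 / 16 := by
  have h1 := (abs_le.1 (Real.cos_bound h)).2
  rw [show |t| ^ 4 = t ^ 4 from (even_two_mul 2).pow_abs t] at h1
  have : 0 ≤ t ^ 4 := by positivity
  linarith

/-- When the apex of an isosceles triangle with legs `r` and base `D` is moved by at most `s ≤ ε r`, the
cosine of the angle there increases by little. -/
theorem eucCos_le_add {r s r' D ε : ℝ} (hr : 0 < r) (hs : 0 ≤ s) (hsr : s ≤ ε * r)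
    (hε : ε ≤ 1 / 10) (hr' : |r' - r| ≤ s) (hD : 0 ≤ D) (hD' : D ≤ 2 * r) :
    eucCos r' (r + s) D ≤ eucCos r r D + 6 * ε := by
  obtain ⟨σ, rfl⟩ : ∃ σ, s = r * σ := ⟨s / r, by field_simp⟩
  obtain ⟨α, rfl⟩ : ∃ α, r' = r * (1 + α) := ⟨r' / r - 1, by field_simp; ring⟩
  obtain ⟨d, rfl⟩ : ∃ d, D = r * d := ⟨D / r, by field_simp⟩
  have hσ0 : 0 ≤ σ := nonneg_of_mul_nonneg_right hs hr
  have hσ : σ ≤ ε := le_of_mul_le_mul_left (by linarith) hr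
  have hd0 : 0 ≤ d := nonneg_of_mul_nonneg_right hD hr
  have hd : d ≤ 2 := le_of_mul_le_mul_left (by linarith) hr
  obtain ⟨h1, h2⟩ := abs_le.1 hr'
  have hα1 : -σ ≤ α := le_of_mul_le_mul_left (by linarith) hr
  have hα2 : α ≤ σ := le_of_mul_le_mul_left (by linarith) hr
  have e1 : eucCos (r * (1 + α)) (r + r * σ) (r * d) =
      ((1 + α) ^ 2 + (1 + σ) ^ 2 - d ^ 2) / (2 * (1 + α) * (1 + σ)) := by
    have : 1 + α ≠ 0 := by linarith
    have : 1 + σ ≠ 0 := by linarith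
    rw [eucCos, show r + r * σ = r * (1 + σ) by ring]
    field_simp
  have e2 : eucCos r r (r * d) = 1 - d ^ 2 / 2 := by
    rw [eucCos]; field_simp; ring
  have hp1 : 0 < 1 + α := by linarith
  have hp2 : 0 < 1 + σ := by linarith
  rw [e1, e2, div_le_iff₀ (by positivity)]
  have hd2 : d ^ 2 ≤ 4 := by nlinarith
  have hP : 1 - σ ≤ (1 + α) * (1 + σ) := by nlinarith
  have hP' : (1 + α) * (1 + σ) - 1 ≤ 2 * σ + σ ^ 2 := by nlinarith
  have hq : (α - σ) ^ 2 ≤ 4 * σ ^ 2 := by nlinarith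
  have hd3 : d ^ 2 * ((1 + α) * (1 + σ) - 1) ≤ 4 * (2 * σ + σ ^ 2) := by
    have : 0 ≤ 2 * σ + σ ^ 2 := by positivity
    nlinarith [sq_nonneg d]
  have hε0 : 0 ≤ ε := hσ0.trans hσ
  have hq2 : σ ^ 2 ≤ ε / 10 := by nlinarith
  nlinarith

/-- A triangle with two sides about `r` and third side about `2 r` is almost straight. -/
theorem eucCos_le_neg_one_add {r s r' E ε : ℝ} (hr : 0 < r) (hs : 0 ≤ s) (hsr : s ≤ ε * r)
    (hε : ε ≤ 1 / 10) (hr' : |r' - r| ≤ s) (hE : 2 * r - s ≤ E) :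
    eucCos r r' E ≤ -1 + 5 * ε := by
  obtain ⟨h1, h2⟩ := abs_le.1 hr'
  have hs' : s ≤ r / 10 := by nlinarith
  have hp : 0 < r' := by linarith
  rw [eucCos, div_le_iff₀ (by positivity)]
  have hE2 : (2 * r - s) ^ 2 ≤ E ^ 2 := pow_le_pow_left₀ (by linarith) hE 2
  have hsum : (r + r') ^ 2 ≤ (2 * r + s) ^ 2 := pow_le_pow_left₀ (by linarith) (by linarith) 2
  have h3 : 8 * (r * s) ≤ 8 * (ε * r) * r := by nlinarith
  have hε0 : 0 ≤ ε * r := hs.trans hsr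
  have h4 : (ε * r) * (9 / 10 * r) ≤ (ε * r) * r' := mul_le_mul_of_nonneg_left (by linarith) hε0
  nlinarith

/-- The two angles at the side `s` of a Euclidean triangle have sum at most `π`, in terms of their
cosines. -/
theorem eucCos_add_eucCos_nonneg {r s r' : ℝ} (hr : 0 < r) (hs : 0 < s) (hp : 0 < r')
    (hr' : |r' - r| ≤ s) (hsum : s ≤ r + r') : 0 ≤ eucCos r' s r + eucCos s r r' := by
  obtain ⟨h1, h2⟩ := abs_le.1 hr'
  have hA := abs_le.1 (abs_eucCos_le hp hs (c := r) (abs_le.2 ⟨by linarith, by linarith⟩)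
    (by linarith))
  have key : eucCos r' s r * r' + eucCos s r r' * r = s := by
    rw [eucCos, eucCos]; field_simp; ring
  have : 0 ≤ (eucCos r' s r + eucCos s r r') * r := by nlinarith
  exact nonneg_of_mul_nonneg_left this hr

/-- The distance from the middle of an almost straight isosceles triangle to the apex. -/
theorem sq_le_of_cos_le {S U D ε : ℝ} (hS : 0 < S) (hU : 0 ≤ U) (hD : 0 ≤ D) (hS1 : S ^ 2 ≤ ε / 10)
    (hε : ε ≤ 1 / 10) (hUS : S ^ 2 * (1 - 3 * ε) ≤ U ^ 2) (hUS' : U ≤ S) (hDS : D ≤ 2 * S)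
    (h : Real.cos S ≤ Real.cos U * Real.cos D) : D ^ 2 ≤ 9 * ε * S ^ 2 := by
  have hS2 : S ^ 2 ≤ 1 / 100 := by linarith
  have hS3 : S ≤ 1 / 10 := by nlinarith
  have hε0 : 0 < ε := by nlinarith [pow_pos hS 2]
  have c1 := Real.one_sub_sq_div_two_le_cos (x := S)
  have c2 := cos_le_one_sub_add (t := U) (by rw [abs_of_nonneg hU]; linarith)
  have c3 := cos_le_one_sub_add (t := D) (by rw [abs_of_nonneg hD]; linarith)
  obtain ⟨s, hs⟩ : ∃ s, s = S ^ 2 := ⟨_, rfl⟩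
  obtain ⟨u, hu⟩ : ∃ u, u = U ^ 2 := ⟨_, rfl⟩
  obtain ⟨d, hd⟩ : ∃ d, d = D ^ 2 := ⟨_, rfl⟩
  have hu4 : U ^ 4 = u ^ 2 := by rw [hu]; ring
  have hd4 : D ^ 4 = d ^ 2 := by rw [hd]; ring
  have hus : u ≤ s := by rw [hu, hs]; nlinarith
  have hds : d ≤ 4 * s := by rw [hd, hs]; nlinarith
  rw [hu4, ← hu] at c2
  rw [hd4, ← hd] at c3
  rw [← hs, ← hu] at hUS
  rw [← hs] at c1 hS1 hS2
  rw [← hs, ← hd]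
  have hs0 : 0 < s := by rw [hs]; positivity
  have hu0 : 0 ≤ u := by rw [hu]; positivity
  have hd0 : 0 ≤ d := by rw [hd]; positivity
  have k2 : Real.cos U ≤ 1 - s / 2 + 2 * ε * s := by
    have : u ^ 2 ≤ ε / 10 * s := by nlinarith
    nlinarith
  have k3 : Real.cos D ≤ 1 - 3 / 8 * d := by nlinarith
  have hcD : 0 ≤ Real.cos D := Real.cos_nonneg_of_mem_Icc
    ⟨by linarith [Real.pi_pos], by linarith [Real.pi_gt_three]⟩
  have k4 : Real.cos U * Real.cos D ≤ (1 - s / 2 + 2 * ε * s) * (1 - 3 / 8 * d) :=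
    mul_le_mul k2 k3 hcD (by nlinarith)
  have k5 : 1 / 2 * (3 / 8 * d) ≤ (1 - s / 2 + 2 * ε * s) * (3 / 8 * d) :=
    mul_le_mul_of_nonneg_right (by nlinarith) (by linarith)
  have k6 : 0.98 * (3 / 8 * d) ≤ (1 - s / 2 + 2 * ε * s) * (3 / 8 * d) :=
    mul_le_mul_of_nonneg_right (by nlinarith) (by linarith)
  nlinarith

/-- If `U` is almost `S` and `D` is at least almost `S`, then `cos U cos D` hardly exceeds `cos² S`. -/
theorem cos_mul_cos_sub_le {S U D τ : ℝ} (hS : 0 < S) (hτ0 : 0 < τ) (hU : 0 ≤ U) (hD : 0 ≤ D)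
    (hS1 : S ^ 2 ≤ τ ^ 2 / 10)
    (hτ : τ ≤ 1 / 10) (hUS : S ^ 2 * (1 - 3 * τ ^ 2) ≤ U ^ 2) (hUS' : U ≤ S)
    (hDS : S * (1 - 3 * τ) ≤ D) (hDS' : D ≤ 2 * S) :
    Real.cos U * Real.cos D - Real.cos S * Real.cos S ≤
      12 * τ * (Real.sin S * Real.sin S) := by
  have hτ2 : τ ^ 2 ≤ τ / 10 := by
    rw [sq]; linarith [mul_le_mul_of_nonneg_left hτ hτ0.le]
  have hS2 : S ^ 2 ≤ 1 / 1000 := by linarith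
  have hS3 : S ≤ 1 / 10 := (abs_le.1 (abs_le_of_sq_le_sq (by linarith) (by norm_num))).2
  have c1 := Real.one_sub_sq_div_two_le_cos (x := S)
  have c2 := cos_le_one_sub_add (t := U) (by rw [abs_of_nonneg hU]; linarith)
  have hD' : 0 ≤ S * (1 - 3 * τ) := mul_nonneg hS.le (by linarith)
  have hcD : 0 ≤ Real.cos D := Real.cos_nonneg_of_mem_Icc
    ⟨by linarith [Real.pi_pos], by linarith [Real.pi_gt_three]⟩
  have c3 : Real.cos D ≤ Real.cos (S * (1 - 3 * τ)) :=
    Real.cos_le_cos_of_nonneg_of_le_pi hD' (by linarith [Real.pi_gt_three]) hDS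
  have hle : S * (1 - 3 * τ) ≤ S := by linarith [mul_pos hS hτ0]
  have c4 := cos_le_one_sub_add (t := S * (1 - 3 * τ)) (by rw [abs_of_nonneg hD']; linarith)
  obtain ⟨s, hs⟩ : ∃ s, s = S ^ 2 := ⟨_, rfl⟩
  obtain ⟨u, hu⟩ : ∃ u, u = U ^ 2 := ⟨_, rfl⟩
  have hs0 : 0 < s := by rw [hs]; positivity
  have hu0 : 0 ≤ u := by rw [hu]; positivity
  have hu4 : U ^ 4 = u ^ 2 := by rw [hu]; ring
  have hus : u ≤ s := by rw [hu, hs]; exact pow_le_pow_left₀ hU hUS' 2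
  rw [hu4, ← hu] at c2
  rw [← hs, ← hu] at hUS
  have e4 : (S * (1 - 3 * τ)) ^ 2 = s * (1 - 3 * τ) ^ 2 := by rw [hs]; ring
  have l4 : (S * (1 - 3 * τ)) ^ 4 ≤ s ^ 2 := by
    rw [hs, ← pow_mul]; exact pow_le_pow_left₀ hD' hle 4
  rw [e4] at c4
  rw [← hs] at c1 hS1 hS2
  have hss : s ^ 2 ≤ τ / 100 * s := by
    rw [sq]; exact mul_le_mul_of_nonneg_right (by linarith) hs0.le
  have hτs : τ ^ 2 * s ≤ τ / 10 * s := mul_le_mul_of_nonneg_right hτ2 hs0.le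
  have hτs0 : 0 < τ * s := mul_pos hτ0 hs0
  have k2 : Real.cos U ≤ 1 - s / 2 + τ / 5 * s := by
    have : u ^ 2 ≤ s ^ 2 := pow_le_pow_left₀ hu0 hus 2
    linarith
  have k4 : Real.cos D ≤ 1 - s / 2 + 3.1 * τ * s := by
    have : 0 < s * τ ^ 2 := by positivity
    linarith
  have k5 : Real.cos U * Real.cos D ≤ (1 - s / 2 + τ / 5 * s) * (1 - s / 2 + 3.1 * τ * s) :=
    mul_le_mul k2 k4 hcD (by linarith)
  have k6 : (1 - s / 2 + τ / 5 * s) * (1 - s / 2 + 3.1 * τ * s) ≤ 1 - s + 4 * τ * s := by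
    have h1 : τ * s ≤ 1 / 100 := by
      calc τ * s ≤ 1 / 10 * (1 / 1000) := mul_le_mul hτ hS2 hs0.le (by norm_num)
        _ ≤ 1 / 100 := by norm_num
    have h2 : (τ * s) * (τ * s) ≤ 1 / 100 * (τ * s) := mul_le_mul_of_nonneg_right h1 hτs0.le
    have h3 : 0 ≤ s * (τ * s) := by positivity
    linarith
  have k7 : 1 - s ≤ Real.cos S * Real.cos S := by
    have := mul_le_mul c1 c1 (by linarith) ((by linarith : (0 : ℝ) ≤ 1 - s / 2).trans c1)
    linarith [sq_nonneg s]
  have k8 : s / 2 ≤ Real.sin S * Real.sin S := by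
    have := Real.sin_ge_sub_cube hS.le
    have h9 : S * (1 - s / 6) ≤ Real.sin S := by rw [hs]; linarith
    have h10 : (S * (1 - s / 6)) ^ 2 ≤ Real.sin S ^ 2 :=
      pow_le_pow_left₀ (mul_nonneg hS.le (by linarith)) h9 2
    have h11 : (S * (1 - s / 6)) ^ 2 = s * (1 - s / 6) ^ 2 := by rw [mul_pow, ← hs]
    have h12 : s * (1 / 2) ≤ s * (1 - s / 6) ^ 2 :=
      mul_le_mul_of_nonneg_left (by linarith [sq_nonneg (s / 6)]) hs0.le
    linarith
  have := mul_le_mul_of_nonneg_left k8 (show 0 ≤ 12 * τ by linarith)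
  linarith

/-- If `α + β ≥ π + ε`, then `cos α + cos β ≤ -2 sin (ε / 2) ^ 2`. -/
theorem add_lt_of_cos_add {α β ε : ℝ} (hα : α ≤ Real.pi)
    (hβ : β ≤ Real.pi) (hε : 0 < ε) (h : -(2 * Real.sin (ε / 2) ^ 2) < Real.cos α + Real.cos β) :
    α + β < Real.pi + ε := by
  by_contra! hcon
  have h1 : Real.cos β ≤ Real.cos (Real.pi + ε - α) :=
    Real.cos_le_cos_of_nonneg_of_le_pi (by linarith) hβ (by linarith)
  have h2 : Real.cos (Real.pi + ε - α) = -Real.cos (α - ε) := by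
    rw [← Real.cos_pi_sub]; congr 1; ring
  have hεα : ε ≤ α := by linarith
  have h3 : Real.cos α - Real.cos (α - ε) = -2 * Real.sin (α - ε / 2) * Real.sin (ε / 2) := by
    rw [Real.cos_sub_cos]; congr 2 <;> [congr 1; skip] <;> congr 1 <;> ring
  have h4 : Real.sin (ε / 2) ≤ Real.sin (α - ε / 2) := by
    rcases le_total (α - ε / 2) (Real.pi / 2) with h | h
    · exact Real.sin_le_sin_of_le_of_le_pi_div_two (by linarith [Real.pi_pos]) h (by linarith)
    · rw [← Real.sin_pi_sub (α - ε / 2)]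
      exact Real.sin_le_sin_of_le_of_le_pi_div_two (by linarith [Real.pi_pos]) (by linarith)
        (by linarith)
  have h5 : 0 ≤ Real.sin (ε / 2) :=
    Real.sin_nonneg_of_nonneg_of_le_pi (by linarith) (by linarith)
  nlinarith

theorem abs_sub_pi_div_two_le {α ε : ℝ} (hα0 : 0 ≤ α) (hα : α ≤ Real.pi) (hε : 0 ≤ ε)
    (h : |Real.cos α| ≤ Real.sin (min ε (Real.pi / 2))) : |α - Real.pi / 2| ≤ ε := by
  have hm : 0 ≤ min ε (Real.pi / 2) := le_min hε (by linarith [Real.pi_pos])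
  have hm2 := min_le_right ε (Real.pi / 2)
  refine le_trans ?_ (min_le_left ε (Real.pi / 2))
  obtain ⟨h1, h2⟩ := abs_le.1 h
  set e := min ε (Real.pi / 2)
  rw [abs_le]
  constructor
  · by_contra! hc
    have := Real.cos_lt_cos_of_nonneg_of_le_pi hα0 (by linarith)
      (show α < Real.pi / 2 - e by linarith)
    rw [Real.cos_pi_div_two_sub] at this
    linarith
  · by_contra! hc
    have := Real.cos_lt_cos_of_nonneg_of_le_pi (by linarith) hα
      (show e + Real.pi / 2 < α by linarith)
    rw [Real.cos_add_pi_div_two] at this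
    linarith

/-! ### Angles at a point near the center of stable scales -/

section

variable {X : Type u} [MetricSpace X] {x₀ : X} {r₀ m : ℝ}

/-- Between the radii `s` and `R` around `x`, all comparison angles at `x` change by at most `ε`
(measured by their cosines): the comparison angle of the points at distance `s` on two segments
from `x`, which is at most that of the end points, is not much smaller. -/
def Stable (x₀ : X) (r₀ : ℝ) (x : X) (s R ε : ℝ) : Prop :=
  ∀ z ∈ bigBall x₀ r₀, ∀ z' ∈ bigBall x₀ r₀, ∀ a ∈ bigBall x₀ r₀, ∀ a' ∈ bigBall x₀ r₀,
    s ≤ dist x z → dist x z ≤ R → s ≤ dist x z' → dist x z' ≤ R →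
    dist x a = s → dist a z = dist x z - s → dist x a' = s → dist a' z' = dist x z' - s →
    eucCos s s (dist a a') ≤ eucCos (dist x z) (dist x z') (dist z z') + ε

theorem eucCos_self (s u : ℝ) (hs : 0 < s) : eucCos s s u = 1 - u ^ 2 / (2 * s ^ 2) := by
  rw [eucCos]; field_simp; ring

namespace ComparisonBall

theorem eucCos_sub_le_sphCos (h : ComparisonBall x₀ r₀ m) {x a b : X} {R ε : ℝ}
    (hx : x ∈ bigBall x₀ r₀) (ha : a ∈ bigBall x₀ r₀) (hb : b ∈ bigBall x₀ r₀)
    (hxa : 0 < dist x a) (hxb : 0 < dist x b) (ha' : dist x a ≤ R) (hb' : dist x b ≤ R)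
    (hR : (m * R) ^ 2 ≤ ε) :
    eucCos (dist x a) (dist x b) (dist a b) - ε ≤
      sphCos m (dist x a) (dist x b) (dist a b) := by
  have h1 := (h.sphCos_eucCos hx ha hb hxa hxb).2
  have hm := h.scale_pos
  have h2 : (m * dist x a) ^ 2 ≤ (m * R) ^ 2 := by gcongr
  have h3 : (m * dist x b) ^ 2 ≤ (m * R) ^ 2 := by gcongr
  linarith

/-- If comparison angles at `x` are stable between the scales `d(x, y)` and `2 r`, then the direction
at `y` to `x` has an almost opposite one: that of a point `x'` on an extension of `xy` beyond `y`.
Indeed, let `z` have distance `r` from `y`. The comparison angle of `z` and `x'` at `y` is about that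
at `x`, which by stability is hardly larger than the angle at `x` of the triangle `x y z`; and the two
angles of this triangle at `xy` have sum at most `π`. -/
theorem exists_oppPair_of_stable (h : ComparisonBall x₀ r₀ m) {x y : X} {r τ δ : ℝ}
    (hx : x ∈ Metric.ball x₀ r₀) (hy : y ∈ Metric.ball x₀ r₀) (hxy : x ≠ y)
    (hτ : 0 < τ) (hτ1 : τ ≤ 1 / 10) (hr : 0 < r) (hr0 : 2 * r ≤ r₀)
    (hs : dist x y ≤ τ ^ 2 * r) (hm : (m * (2 * r)) ^ 2 ≤ τ ^ 2)
    (hst : Stable x₀ r₀ x (dist x y) (2 * r) (τ ^ 2)) (hδ : 0 < δ)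
    (hτδ : 10 * τ ^ 2 < 2 * Real.sin (δ / 2) ^ 2) :
    ∃ x', Admissible x₀ r₀ y x' ∧ OppPair r₀ δ y x x' := by
  have hr₀ := h.radius_pos
  have hxB := ball_subset_bigBall hx
  have hyB := ball_subset_bigBall hy
  have hxW : x ∈ Metric.closedBall x₀ (5 * r₀) := by
    rw [Metric.mem_closedBall]; rw [Metric.mem_ball] at hx; linarith
  have hd := Metric.mem_ball'.1 hy
  obtain ⟨x', hx'B, hx'1, hx'2⟩ := h.exists_extension hxB hyB hxy hr.le (by linarith)
  have hx'W : x' ∈ Metric.closedBall x₀ (5 * r₀) :=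
    mem_of_dist_le hy hx'2.le (by linarith)
  have hx'y : x' ≠ y := by
    rintro rfl; rw [dist_self] at hx'2; linarith
  refine ⟨x', ⟨hx'W, hx'y⟩, fun z₀ hz₀ => ?_⟩
  have hz₀A := admissible_of_dist_eq hy hz₀
  obtain ⟨z, hzB, hz1, hz2⟩ := h.exists_dist_eq hyB (closedBall_subset_bigBall hr₀ hz₀A.1) hr.le
    (by rw [hz₀]; linarith)
  have hzW : z ∈ Metric.closedBall x₀ (5 * r₀) := mem_of_dist_le hy hz1.le (by linarith)
  have hzy : z ≠ y := by
    rintro rfl; rw [dist_self] at hz1; linarith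
  have e : dist y z + dist z z₀ = dist y z₀ := by rw [hz1, hz2]; ring
  have e1 : ang y z x' = ang y z₀ x' := h.ang_of_between hy hz₀A.1 hx'W hzW hzy hx'y e
  have e2 : ang y x z = ang y x z₀ := by
    rw [h.ang_comm hy hxW hzW hxy hzy, h.ang_comm hy hxW hz₀A.1 hxy hz₀A.2]
    exact h.ang_of_between hy hz₀A.1 hxW hzW hzy hxy e
  rw [← e1, ← e2]
  refine add_lt_of_cos_add (h.ang_le_pi hy hxW hzW hxy hzy) (h.ang_le_pi hy hzW hx'W hzy hx'y) hδ ?_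
  set s := dist x y with hsdef
  have hs0 : 0 < s := dist_pos.2 hxy
  have hτ2 : τ ^ 2 ≤ 1 / 100 := by nlinarith
  have hsr : s ≤ r / 100 := by nlinarith
  set r' := dist x z with hr'def
  have hr' : |r' - r| ≤ s := by
    have := abs_dist_sub_dist_le z x y
    rwa [dist_comm z x, dist_comm z y, hz1] at this
  obtain ⟨h1, h2⟩ := abs_le.1 hr'
  set D := dist z x' with hD
  have hD2 : D ≤ 2 * r := by
    have := dist_triangle_left z x' y
    rw [hz1, hx'2] at this; linarith
  obtain ⟨a, haB, ha1, ha2⟩ := h.exists_dist_eq hxB hzB hs0.le (by linarith : s ≤ dist x z)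
  have hxx' : dist x x' = r + s := by rw [← hx'1, hx'2]; ring
  have c1 : eucCos s s (dist a y) ≤ eucCos r' (r + s) D + τ ^ 2 := by
    have := hst z hzB x' hx'B a haB y hyB (by linarith) (by linarith)
      (by linarith) (by linarith) ha1 ha2 rfl (by rw [hxx', hx'2]; ring)
    rwa [hxx'] at this
  have c2 := eucCos_le_add hr hs0.le hs (by linarith) hr' dist_nonneg hD2
  have c3 := h.sphCos_mono hxB hzB hyB haB (by rw [ha1, ha2]; ring) (by rw [ha1]; exact hs0) hs0
  have c4 := (h.sphCos_eucCos hxB hyB haB hs0 (by rw [ha1]; exact hs0)).1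
  have c5 := h.eucCos_sub_le_sphCos hxB hyB hzB hs0 (by linarith) (by linarith) (by linarith) hm
  have c6 := h.eucCos_sub_le_sphCos hyB hzB hx'B (by linarith) (by linarith) (by linarith)
    (by linarith) hm
  have c7 := h.eucCos_sub_le_sphCos hyB hxB hzB (by rw [dist_comm]; exact hs0) (by linarith)
    (by rw [dist_comm]; linarith) (by linarith) hm
  have c8 := h.sphCos_le_cos_ang hy hzW hx'W hzy hx'y
  have c9 := h.sphCos_le_cos_ang hy hxW hzW hxy hzy
  have c10 := eucCos_add_eucCos_nonneg hr hs0 (by linarith) hr' (by linarith)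
  rw [dist_comm z y] at c3
  rw [dist_comm y a, ha1] at c4
  rw [ha1] at c3
  rw [hx'2] at c6 c8
  rw [dist_comm y x] at c7 c9
  simp only [← hsdef, ← hr'def, ← hD, hz1] at c3 c4 c5 c6 c7 c8 c9
  rw [eucCos_comm s r'] at c5
  linarith

/-- If `p` is not much farther from `x` than from `y`, then the comparison angle at `y` of `p` and `x` is
not much larger than `π / 2`. -/
theorem neg_le_sphCos (h : ComparisonBall x₀ r₀ m) {y p x : X} {c : ℝ}
    (hy : y ∈ bigBall x₀ r₀) (hp : p ∈ bigBall x₀ r₀) (hx : x ∈ bigBall x₀ r₀)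
    (hyp : 0 < dist y p) (hyx : 0 < dist y x) (hc0 : 0 ≤ c) (hc1 : c ≤ 1)
    (hc : dist p x ≤ dist y p + c * dist y x) :
    -(2 * c) ≤ sphCos m (dist y p) (dist y x) (dist p x) := by
  have hm := h.scale_pos
  have hA := h.sin_pos hy hp hyp
  have hB := h.sin_pos hy hx hyx
  have hA1 := h.mul_dist_le_one hy hp
  have hB1 := h.mul_dist_le_one hy hx
  have hC1 := h.mul_dist_le_one hp hx
  have hA0 : 0 < m * dist y p := by positivity
  have hB0 : 0 < m * dist y x := by positivity
  set A := m * dist y p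
  set B := m * dist y x
  have hpi := Real.pi_gt_three
  have h1 : Real.cos (A + c * B) ≤ Real.cos (m * dist p x) := by
    apply Real.cos_le_cos_of_nonneg_of_le_pi (by positivity)
    · nlinarith
    · have := mul_le_mul_of_nonneg_left hc hm.le
      calc _ ≤ _ := this
        _ = A + c * B := by simp only [A, B]; ring
  rw [Real.cos_add] at h1
  have h2 : Real.sin (c * B) ≤ c * B := Real.sin_le (by positivity)
  have h3 : B / 2 ≤ Real.sin B := by
    have := Real.mul_le_sin hB0.le (by linarith)
    refine le_trans ?_ this
    have : (1 / 2 : ℝ) ≤ 2 / Real.pi := by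
      rw [div_le_div_iff₀ (by norm_num) Real.pi_pos]; linarith [Real.pi_lt_four]
    nlinarith
  have h4 : Real.cos B ≤ Real.cos (c * B) := by
    apply Real.cos_le_cos_of_nonneg_of_le_pi (by positivity) (by linarith) (by nlinarith)
  have h5 : 0 ≤ Real.cos A := Real.cos_nonneg_of_neg_pi_div_two_le_of_le (by linarith) (by linarith)
  rw [sphCos, le_div_iff₀ (mul_pos hA hB)]
  have h6 := mul_le_mul_of_nonneg_left h4 h5
  have h7 : Real.sin A * Real.sin (c * B) ≤ Real.sin A * (2 * c * Real.sin B) := by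
    apply mul_le_mul_of_nonneg_left _ hA.le
    nlinarith
  linarith

/-- Let `a`, `b` and `y` have distance `s` from `x`, with `a` and `b` almost opposite. If the comparison
angle of `a` and `y` is not much larger than `π / 2`, then that of `b` and `y` is not much smaller. The
reason is that the midpoint `μ` of `a b` is close to `x`, and that the distances from `y` to `a`, `b` and
`μ` are related by `ComparisonBall.stewart`. -/
theorem sphCos_le_of_almost_straight (h : ComparisonBall x₀ r₀ m) {x y a b : X} {s τ c : ℝ}
    (hxB : x ∈ bigBall x₀ r₀) (hyB : y ∈ bigBall x₀ r₀) (hpsB : a ∈ bigBall x₀ r₀)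
    (hqsB : b ∈ bigBall x₀ r₀) (hs0 : 0 < s) (hsy : dist x y = s) (hps1 : dist x a = s)
    (hqs1 : dist x b = s)
    (hτ : 0 < τ) (hτ1 : τ ≤ 1 / 10) (hSr : (m * s) ^ 2 ≤ τ ^ 2 / 10)
    (hwsq : 4 * s ^ 2 * (1 - 3 * τ ^ 2) ≤ dist a b ^ 2)
    (hps : -(2 * c) ≤ sphCos m s s (dist a y)) :
    sphCos m s s (dist b y) ≤ 2 * c + 24 * τ := by
  have hm0 := h.scale_pos
  have hτ2 : τ ^ 2 ≤ 1 / 100 := by nlinarith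
  set w := dist a b with hw
  have hw0 : 0 ≤ w := dist_nonneg
  have hw2 : w ≤ 2 * s := by
    have := dist_triangle_left a b x
    rw [hps1, hqs1] at this; linarith
  have hwpos : 0 < w := by
    rcases hw0.lt_or_eq with h' | h'
    · exact h'
    · rw [← h'] at hwsq
      have : 0 < s ^ 2 := by positivity
      nlinarith
  set S := m * s with hS
  set U := m * (w / 2) with hU
  have hS0 : 0 < S := by positivity
  have hU0 : 0 < U := by positivity
  have hUS : S ^ 2 * (1 - 3 * τ ^ 2) ≤ U ^ 2 := by
    rw [hS, hU, mul_pow, mul_pow]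
    have := mul_le_mul_of_nonneg_left hwsq (sq_nonneg m)
    linarith
  have hUS' : U ≤ S := by
    rw [hS, hU]; apply mul_le_mul_of_nonneg_left _ hm0.le; linarith
  obtain ⟨μ, hμB, hμ1, hμ2⟩ := h.exists_dist_eq hpsB hqsB (t := w / 2) (by linarith) (by linarith)
  have hμ2' : dist μ b = w / 2 := by rw [hμ2]; linarith
  have hsinU : 0 < Real.sin U := by
    have := h.sin_pos hpsB hμB (by rw [hμ1]; linarith)
    rwa [hμ1] at this
  have stew : ∀ z ∈ bigBall x₀ r₀, Real.cos (m * dist a z) + Real.cos (m * dist b z) ≤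
      2 * (Real.cos U * Real.cos (m * dist μ z)) := by
    intro z hz
    have := h.stewart a hpsB b hqsB z hz μ hμB (by rw [hμ1, hμ2']; linarith)
    rw [hμ1, hμ2', ← hw, show m * w = 2 * U by rw [hU]; ring, ← hU, Real.sin_two_mul] at this
    have : Real.sin U * (Real.cos (m * dist a z) + Real.cos (m * dist b z)) ≤
        Real.sin U * (2 * (Real.cos U * Real.cos (m * dist μ z))) := by linarith
    exact le_of_mul_le_mul_left this hsinU
  have hμx : dist μ x ≤ 3 * τ * s := by
    have hD : m * dist μ x ≤ 2 * S := by
      have := dist_triangle_left μ x a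
      rw [hμ1, dist_comm a x, hps1] at this
      rw [hS]; nlinarith
    have e := stew x hxB
    rw [dist_comm a x, hps1, dist_comm b x, hqs1] at e
    have := sq_le_of_cos_le hS0 hU0.le (D := m * dist μ x) (by positivity)
      hSr (by linarith) hUS hUS' hD (by linarith)
    rw [show 9 * τ ^ 2 * S ^ 2 = (m * (3 * τ * s)) ^ 2 by rw [hS]; ring] at this
    have := (pow_le_pow_iff_left₀ (by positivity) (by positivity) two_ne_zero).1 this
    exact le_of_mul_le_mul_left this hm0
  have hμy := cos_mul_cos_sub_le (D := m * dist μ y) hS0 hτ hU0.le (by positivity) hSr hτ1 hUS hUS'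
    (by
      have := dist_triangle_left x y μ
      rw [hsy] at this
      rw [hS, mul_assoc]
      apply mul_le_mul_of_nonneg_left _ hm0.le
      linarith)
    (by
      have := dist_triangle μ x y
      rw [hsy] at this
      have h3 : 3 * τ * s ≤ s := by nlinarith
      rw [hS, ← mul_assoc, mul_comm 2 m, mul_assoc]
      apply mul_le_mul_of_nonneg_left _ hm0.le
      linarith)
  have hsinS : 0 < Real.sin S := by
    have := h.sin_pos hxB hyB (by rw [hsy]; exact hs0)
    rwa [hsy] at this
  rw [sphCos, ← hS, le_div_iff₀ (mul_pos hsinS hsinS)] at hps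
  rw [sphCos, ← hS, div_le_iff₀ (mul_pos hsinS hsinS)]
  have := stew y hyB
  linarith

theorem sq_le_div_ten {m s r τ : ℝ} (hm : 0 ≤ m) (hr : 0 ≤ r) (hs0 : 0 ≤ s) (hs : s ≤ τ ^ 2 * r)
    (h : (m * (2 * r)) ^ 2 ≤ τ ^ 2) (hτ : τ ^ 2 ≤ 1 / 100) : (m * s) ^ 2 ≤ τ ^ 2 / 10 := by
  have h1 : m * s ≤ m * (2 * r) * (1 / 10) := by
    have : s ≤ 2 * r * (1 / 10) := by nlinarith
    rw [mul_assoc]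
    exact mul_le_mul_of_nonneg_left this hm
  have h2 : (m * s) ^ 2 ≤ (m * (2 * r) * (1 / 10)) ^ 2 := pow_le_pow_left₀ (by positivity) h1 2
  rw [mul_pow] at h2
  nlinarith

/-- If comparison angles at `x` are stable between the scales `d(x, y)` and `2 r`, and if `x` and `y` have
almost the same distance to `p`, then the directions at `y` to `p` and to `x` are almost orthogonal.
The angle is not much larger than `π / 2` by `neg_le_sphCos`. Let `q` be opposite to `p` at `y`. At
the scale `r` the points `p` and `q` are almost opposite also at `x`, and by stability they still are
at the scale `d(x, y)`; then `sphCos_le_of_almost_straight` shows that the angle at `y` of `x` and `q`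
is not much larger than `π / 2`. -/
theorem abs_cos_ang_le_of_stable (h : ComparisonBall x₀ r₀ m) {x y p : X} {r τ c : ℝ}
    (hx : x ∈ Metric.ball x₀ r₀) (hy : y ∈ Metric.ball x₀ r₀) (hxy : x ≠ y)
    (hτ : 0 < τ) (hτ1 : τ ≤ 1 / 10) (hr : 0 < r) (hr0 : 2 * r ≤ r₀)
    (hs : dist x y ≤ τ ^ 2 * r) (hm : (m * (2 * r)) ^ 2 ≤ τ ^ 2)
    (hst : Stable x₀ r₀ x (dist x y) (2 * r) (τ ^ 2))
    (hp : Admissible x₀ r₀ y p) (hxp : r ≤ dist x p) (hc0 : 0 ≤ c) (hc1 : c ≤ 1)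
    (hc : |dist p x - dist p y| ≤ c * dist x y) :
    |Real.cos (ang y p x)| ≤ 2 * c + 26 * τ := by
  have hr₀ := h.radius_pos
  have hm0 := h.scale_pos
  have hxB := ball_subset_bigBall hx
  have hyB := ball_subset_bigBall hy
  have hpB := closedBall_subset_bigBall hr₀ hp.1
  have hxW : x ∈ Metric.closedBall x₀ (5 * r₀) := by
    rw [Metric.mem_closedBall]; rw [Metric.mem_ball] at hx; linarith
  have hyx0 : 0 < dist y x := dist_pos.2 hxy.symm
  have hyp0 : 0 < dist y p := dist_pos.2 hp.2.symm
  obtain ⟨hc2, hc3⟩ := abs_le.1 hc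
  have hlow : -(2 * c) ≤ Real.cos (ang y p x) :=
    (h.neg_le_sphCos hyB hpB hxB hyp0 hyx0 hc0 hc1
      (by rw [dist_comm y p, dist_comm y x]; linarith)).trans
      (h.sphCos_le_cos_ang hy hp.1 hxW hp.2 hxy)
  refine abs_le.2 ⟨by linarith, ?_⟩
  obtain ⟨q, hq, hq1, hq2, hq3⟩ := h.exists_opposite hy hp hr (by linarith)
  have hqB := closedBall_subset_bigBall hr₀ hq.1
  set s := dist x y with hsdef
  have hs0 : 0 < s := dist_pos.2 hxy
  have hτ2 : τ ^ 2 ≤ 1 / 100 := by nlinarith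
  have hττ : τ ^ 2 ≤ τ / 10 := by nlinarith
  have hsr : s ≤ r / 100 := by nlinarith
  have hcs : c * s ≤ s := by nlinarith
  set r' := dist x q with hr'def
  have hr' : |r' - r| ≤ s := by
    have := abs_dist_sub_dist_le q x y
    rwa [dist_comm q x, dist_comm q y, hq2] at this
  obtain ⟨h1, h2⟩ := abs_le.1 hr'
  obtain ⟨pr, hprB, hpr1, hpr2⟩ := h.exists_dist_eq hxB hpB hr.le hxp
  have hE : 2 * r - s ≤ dist pr q := by
    have := dist_triangle p pr q
    rw [dist_comm p pr, ← hq1, hq2, hpr2, dist_comm x p] at this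
    linarith
  have k1 := eucCos_le_neg_one_add hr hs0.le hs (by linarith) hr' hE
  obtain ⟨ps, hpsB, hps1, hps2⟩ := h.exists_dist_eq hxB hprB hs0.le (by linarith : s ≤ dist x pr)
  obtain ⟨qs, hqsB, hqs1, hqs2⟩ := h.exists_dist_eq hxB hqB hs0.le (by linarith : s ≤ dist x q)
  have k2 := hst pr hprB q hqB ps hpsB qs hqsB (by linarith) (by linarith) (by linarith)
    (by linarith) hps1 hps2 hqs1 hqs2
  rw [hpr1, ← hr'def, eucCos_self _ _ hs0] at k2
  have hwsq : 4 * s ^ 2 * (1 - 3 * τ ^ 2) ≤ dist ps qs ^ 2 := by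
    have : (2 - 6 * τ ^ 2) ≤ dist ps qs ^ 2 / (2 * s ^ 2) := by linarith
    rw [le_div_iff₀ (by positivity)] at this
    linarith
  have hxps : dist x ps + dist ps p = dist x p := by
    apply le_antisymm _ (dist_triangle _ _ _)
    have := dist_triangle ps pr p
    rw [hps2, hpr1, hpr2] at this
    rw [hps1]; linarith
  have hb := h.neg_le_sphCos hxB hpB hyB (by linarith : 0 < dist x p) hs0 hc0 hc1
    (by rw [dist_comm x p]; linarith)
  have hmono := h.sphCos_mono hxB hpB hyB hpsB hxps (by rw [hps1]; exact hs0) hs0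
  rw [sphCos_comm, hps1, ← hsdef] at hmono
  have hps := hb.trans hmono
  have hSr : (m * s) ^ 2 ≤ τ ^ 2 / 10 := sq_le_div_ten hm0.le hr.le hs0.le hs hm hτ2
  have hqs := h.sphCos_le_of_almost_straight hxB hyB hpsB hqsB hs0 hsdef.symm hps1 hqs1 hτ hτ1 hSr
    hwsq hps
  have hmono' := h.sphCos_mono hxB hqB hyB hqsB (by rw [hqs1, hqs2]; ring)
    (by rw [hqs1]; exact hs0) hs0
  rw [hqs1, ← hsdef] at hmono'
  have c5 := h.eucCos_sub_le_sphCos hxB hyB hqB hs0 (by linarith) (by linarith) (by linarith) hm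
  have c7 := h.eucCos_sub_le_sphCos hyB hxB hqB hyx0 (by linarith)
    (by rw [dist_comm]; linarith) (by linarith) hm
  have c9 := h.sphCos_le_cos_ang hy hxW hq.1 hxy hq.2
  have c10 := eucCos_add_eucCos_nonneg hr hs0 (by linarith) hr' (by linarith)
  rw [dist_comm y x] at c7 c9
  rw [dist_comm q y] at hmono'
  simp only [← hsdef, ← hr'def, hq2] at hmono' c5 c7 c9
  rw [eucCos_comm s r'] at c5
  have hfin : -(2 * c + 26 * τ) ≤ Real.cos (ang y x q) := by linarith
  have htri := h.ang_triangle hy hp.1 hxW hq.1 hp.2 hxy hq.2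
  rw [hq3] at htri
  have : Real.cos (ang y p x) ≤ Real.cos (Real.pi - ang y x q) := by
    apply Real.cos_le_cos_of_nonneg_of_le_pi
    · linarith [h.ang_le_pi hy hxW hq.1 hxy hq.2]
    · exact h.ang_le_pi hy hp.1 hxW hp.2 hxy
    · linarith
  rw [Real.cos_pi_sub] at this
  linarith

end ComparisonBall

end

/-! ### Existence of stable scales -/

section

variable {X : Type u} [MetricSpace X] {x₀ : X} {r₀ m : ℝ}

theorem Stable.mono {x : X} {s R ε ε' : ℝ} (hst : Stable x₀ r₀ x s R ε) (hε : ε ≤ ε') :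
    Stable x₀ r₀ x s R ε' := by
  intro z hz z' hz' b hb b' hb' h1 h2 h1' h2' h3 h4 h3' h4'
  linarith [hst z hz z' hz' b hb b' hb' h1 h2 h1' h2' h3 h4 h3' h4']

theorem OppPair.mono {r₀ δ δ' : ℝ} {y a b : X} (h : OppPair r₀ δ y a b) (hδ : δ ≤ δ') :
    OppPair r₀ δ' y a b := fun z hz => (h z hz).trans_le (by linarith)

/-- The precision `τ` of stability and the tolerance `c` for the difference of the distances that give
angles with errors less than `δ`. -/
theorem exists_constants {δ : ℝ} (hδ : 0 < δ) : ∃ τ c : ℝ, 0 < τ ∧ τ ≤ 1 / 10 ∧ 0 < c ∧ c ≤ 1 ∧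
    2 * c + 26 * τ ≤ Real.sin (min δ (Real.pi / 2)) ∧
    10 * τ ^ 2 < 2 * Real.sin (min δ 1 / 2) ^ 2 := by
  have hpi := Real.pi_gt_three
  have h1 : 0 < Real.sin (min δ (Real.pi / 2)) := by
    apply Real.sin_pos_of_pos_of_lt_pi (lt_min hδ (by linarith))
    exact (min_le_right _ _).trans_lt (by linarith)
  have h2 : 0 < Real.sin (min δ 1 / 2) := by
    have := lt_min hδ one_pos
    have := min_le_right δ 1
    apply Real.sin_pos_of_pos_of_lt_pi <;> linarith
  set α := Real.sin (min δ (Real.pi / 2))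
  set β := Real.sin (min δ 1 / 2)
  have hα : α ≤ 1 := Real.sin_le_one _
  have h3 : 0 < min (α / 52) (β / 10) := lt_min (by positivity) (by positivity)
  refine ⟨min (α / 52) (β / 10), α / 4, h3, (min_le_left _ _).trans (by linarith), by positivity,
    by linarith, ?_, ?_⟩
  · have := min_le_left (α / 52) (β / 10); linarith
  · have := min_le_right (α / 52) (β / 10)
    have : min (α / 52) (β / 10) ^ 2 ≤ (β / 10) ^ 2 := pow_le_pow_left₀ h3.le this 2
    have : 0 < β ^ 2 := by positivity
    nlinarith

/-- If comparison angles at `x` are stable from the scale `d(x, y)` on and if `x` and `y` are almost in the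
same fiber, then the strainer map can be extended at `y` by the distance to `x`. -/
theorem ComparisonBall.not_mem_nonExtendable (h : ComparisonBall x₀ r₀ m) {k : ℕ} {p : Fin k → X}
    {V : Set X} {δ τ c r : ℝ} (hF : IsStrainerMap x₀ r₀ δ p V) (hδ : 0 < δ) {x y : X}
    (hx : x ∈ Metric.ball x₀ r₀) (hy : y ∈ V) (hxy : x ≠ y)
    (hτ : 0 < τ) (hτ1 : τ ≤ 1 / 10) (hc0 : 0 ≤ c) (hc1 : c ≤ 1)
    (hcτ : 2 * c + 26 * τ ≤ Real.sin (min δ (Real.pi / 2)))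
    (hτδ : 10 * τ ^ 2 < 2 * Real.sin (min δ 1 / 2) ^ 2)
    (hr : 0 < r) (hr0 : 2 * r ≤ r₀)
    (hs : dist x y ≤ τ ^ 2 * r) (hm : (m * (2 * r)) ^ 2 ≤ τ ^ 2)
    (hst : Stable x₀ r₀ x (dist x y) (2 * r) (τ ^ 2))
    (hp : ∀ i, r ≤ dist x (p i)) (hc : ∀ i, |dist (p i) x - dist (p i) y| ≤ c * dist x y) :
    y ∉ nonExtendable x₀ r₀ (12 * δ) p V := by
  rintro ⟨-, hE⟩
  apply hE
  have hyU := hF.subset hy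
  obtain ⟨hpA, p', hp'A, H⟩ := (h.isStrainerAt_iff hyU).1 (hF.strainer y hy)
  obtain ⟨x', hx'A, hx'⟩ := h.exists_oppPair_of_stable hx hyU hxy hτ hτ1 hr hr0 hs hm hst
    (lt_min hδ one_pos) hτδ
  have hr₀ := h.radius_pos
  have hxW : x ∈ Metric.closedBall x₀ (5 * r₀) := by
    rw [Metric.mem_closedBall]; rw [Metric.mem_ball] at hx; linarith
  refine ⟨x, isStrainerAt_snoc h hδ hyU hpA hp'A H ⟨hxW, hxy⟩ hx'A (hx'.mono (min_le_left _ _))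
    fun i => ?_⟩
  have := h.abs_cos_ang_le_of_stable hx hyU hxy hτ hτ1 hr hr0 hs hm hst (hpA i) (hp i) hc0 hc1 (hc i)
  exact abs_sub_pi_div_two_le (h.ang_nonneg hyU (hpA i).1 hxW (hpA i).2 hxy)
    (h.ang_le_pi hyU (hpA i).1 hxW (hpA i).2 hxy) hδ.le (this.trans hcτ)

theorem eucCos_self_sub_le {s u v θ : ℝ} (hs : 0 < s) (hu0 : 0 ≤ u) (hv0 : 0 ≤ v) (hu : u ≤ 2 * s)
    (hv : v ≤ 2 * s) (hθ : 0 ≤ θ) (huv : u ≤ v + θ * s) :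
    eucCos s s v ≤ eucCos s s u + 2 * θ := by
  rw [eucCos_self _ _ hs, eucCos_self _ _ hs]
  have : u ^ 2 - v ^ 2 ≤ 2 * θ * (2 * s ^ 2) := by
    rcases le_total u v with h | h
    · have : u ^ 2 ≤ v ^ 2 := pow_le_pow_left₀ hu0 h 2
      have : 0 ≤ 2 * θ * (2 * s ^ 2) := by positivity
      linarith
    · have h1 : (u - v) * (u + v) ≤ (θ * s) * (4 * s) :=
        mul_le_mul (by linarith) (by linarith) (by linarith) (by positivity)
      nlinarith
  have h2 : (u ^ 2 - v ^ 2) / (2 * s ^ 2) ≤ 2 * θ := by rwa [div_le_iff₀ (by positivity)]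
  rw [sub_div] at h2
  linarith

namespace ComparisonBall

/-- Points on two segments from `x` are close when the end points are. -/
theorem dist_le_of_between (h : ComparisonBall x₀ r₀ m) {x w t a b : X} {R u θ : ℝ}
    (hx : x ∈ bigBall x₀ r₀) (hw : w ∈ bigBall x₀ r₀) (ht : t ∈ bigBall x₀ r₀)
    (ha : a ∈ bigBall x₀ r₀) (hb : b ∈ bigBall x₀ r₀) (hu : 0 < u) (huR : u ≤ R)
    (hm : (m * R) ^ 2 ≤ θ ^ 2) (hθ : 0 ≤ θ)
    (hxw : dist x w = R) (hxt : dist x t = R) (hwt : dist w t ≤ θ * R)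
    (hxa : dist x a = u) (haw : dist a w = R - u) (hxb : dist x b = u) (hbt : dist b t = R - u) :
    dist a b ≤ 2 * θ * u := by
  have hR : 0 < R := hu.trans_le huR
  have h1 := h.sphCos_mono₂ hx hw ht ha hb (by linarith) (by linarith) (by linarith) (by linarith)
  have h2 := h.eucCos_sub_le_sphCos hx hw ht (by linarith) (by linarith) hxw.le hxt.le hm
  have h3 := (h.sphCos_eucCos hx ha hb (by linarith) (by linarith)).1
  rw [hxw, hxt] at h1 h2
  rw [hxa, hxb] at h1 h3
  rw [eucCos_self _ _ hR] at h2
  rw [eucCos_self _ _ hu] at h3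
  have h4 : dist w t ^ 2 / (2 * R ^ 2) ≤ θ ^ 2 / 2 := by
    rw [div_le_iff₀ (by positivity)]
    have := pow_le_pow_left₀ dist_nonneg hwt 2
    linarith
  have h5 : dist a b ^ 2 / (2 * u ^ 2) ≤ 3 / 2 * θ ^ 2 := by linarith
  rw [div_le_iff₀ (by positivity)] at h5
  have : 0 ≤ θ ^ 2 * u ^ 2 := by positivity
  refine (pow_le_pow_iff_left₀ dist_nonneg (by positivity) two_ne_zero).1 ?_
  nlinarith

/-- Stability follows from that of the comparison angles of the points `a i` and `a j`, at distance `s` on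
segments from `x` to the points `t i` of a net of the sphere of radius `R`. -/
theorem stable_of_net (h : ComparisonBall x₀ r₀ m) {x : X} {s R θ : ℝ} (hx : x ∈ Metric.ball x₀ r₀)
    (hs : 0 < s) (hsR : s ≤ R) (hR : R ≤ r₀) (hθ : 0 ≤ θ) (hθ1 : θ ≤ 1)
    (hm : (m * R) ^ 2 ≤ θ ^ 2) {ι : Type*} (t a : ι → X) (ht : ∀ i, dist x (t i) = R)
    (hta : ∀ i, dist x (a i) = s ∧ dist (a i) (t i) = R - s)
    (hnet : ∀ w, dist x w = R → ∃ i, dist w (t i) ≤ θ * R)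
    (hta' : ∀ i j, sphCos m s s (dist (a i) (a j)) ≤ sphCos m R R (dist (t i) (t j)) + θ ^ 2) :
    Stable x₀ r₀ x s R (16 * θ) := by
  intro z hz z' hz' b hb b' hb' h1 h2 h1' h2' h3 h4 h3' h4'
  have hxB := ball_subset_bigBall hx
  have hr₀ := h.radius_pos
  have hd := Metric.mem_ball'.1 hx
  have hR0 : 0 < R := hs.trans_le hsR
  have hmem : ∀ w : X, dist x w ≤ R → w ∈ bigBall x₀ r₀ := fun w hw =>
    closedBall_subset_bigBall hr₀ (mem_of_dist_le hx hw (by linarith))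
  have hext : ∀ z ∈ bigBall x₀ r₀, s ≤ dist x z → dist x z ≤ R → ∀ b ∈ bigBall x₀ r₀,
      dist x b = s → dist b z = dist x z - s →
      ∃ w ∈ bigBall x₀ r₀, dist x z + dist z w = dist x w ∧ dist x w = R ∧
      dist b w = R - s ∧ ∃ i, dist w (t i) ≤ θ * R ∧ dist b (a i) ≤ 2 * θ * s := by
    intro z hz h1 h2 b hb h3 h4
    have hxz : x ≠ z := by rintro rfl; rw [dist_self] at h1; linarith
    obtain ⟨w, hw, hw1, hw2⟩ := h.exists_extension_length hxB hz hxz h2 (by linarith)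
    have hbw : dist b w = R - s := by
      have := dist_triangle b z w
      have := dist_triangle x b w
      linarith
    obtain ⟨i, hi⟩ := hnet w hw2
    exact ⟨w, hw, hw1, hw2, hbw, i, hi, h.dist_le_of_between hxB hw (hmem _ (ht i).le) hb
      (hmem _ ((hta i).1.trans_le hsR)) hs hsR hm hθ hw2 (ht i) hi h3 hbw (hta i).1 (hta i).2⟩
  obtain ⟨w, hw, hw1, hw2, hw3, i, hi1, hi2⟩ := hext z hz h1 h2 b hb h3 h4
  obtain ⟨w', hw', hw1', hw2', hw3', j, hj1, hj2⟩ := hext z' hz' h1' h2' b' hb' h3' h4'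
  have hti := hmem _ (ht i).le
  have htj := hmem _ (ht j).le
  have hai := hmem _ ((hta i).1.trans_le hsR)
  have haj := hmem _ ((hta j).1.trans_le hsR)
  have tri : ∀ {u : ℝ} {a b : X}, dist x a = u → dist x b = u → dist a b ≤ 2 * u := by
    intro u a b e1 e2
    have := dist_triangle_left a b x
    linarith
  have k1 : eucCos s s (dist b b') ≤ eucCos s s (dist (a i) (a j)) + 2 * (4 * θ) := by
    apply eucCos_self_sub_le hs dist_nonneg dist_nonneg (tri (hta i).1 (hta j).1) (tri h3 h3')
      (by positivity)
    have e1 := dist_triangle (a i) b (a j)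
    have e2 := dist_triangle b b' (a j)
    rw [dist_comm (a i) b] at e1
    linarith
  have k2 : eucCos R R (dist (t i) (t j)) ≤ eucCos R R (dist w w') + 2 * (2 * θ) := by
    apply eucCos_self_sub_le hR0 dist_nonneg dist_nonneg (tri hw2 hw2') (tri (ht i) (ht j))
      (by positivity)
    have e1 := dist_triangle w (t i) w'
    have e2 := dist_triangle (t i) (t j) w'
    rw [dist_comm (t j) w'] at e2
    linarith
  have k3 := h.eucCos_sub_le_sphCos hxB hai haj (by linarith [(hta i).1]) (by linarith [(hta j).1])
    ((hta i).1.trans_le hsR) ((hta j).1.trans_le hsR) hm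
  have k4 := (h.sphCos_eucCos hxB hti htj (by linarith [ht i]) (by linarith [ht j])).1
  have k5 := h.eucCos_sub_le_sphCos hxB hw hw' (by linarith) (by linarith) hw2.le hw2'.le hm
  have k6 := h.sphCos_mono₂ hxB hw hw' hz hz' hw1 (by linarith) hw1' (by linarith)
  have k7 := (h.sphCos_eucCos hxB hz hz' (by linarith) (by linarith)).1
  rw [(hta i).1, (hta j).1] at k3
  rw [ht i, ht j] at k4
  rw [hw2, hw2'] at k5 k6
  have := hta' i j
  nlinarith

/-- Let `T` be a finite net of a sphere around `x`. The sum `G u`, over all pairs in `T`, of the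
cosines of the comparison angles of the points at distance `u` on the segments to `T` is monotone and
bounded, and two radii between which `G` hardly changes are stable. -/
theorem exists_stability_function (h : ComparisonBall x₀ r₀ m) {x : X} {ρ θ : ℝ}
    (hx : x ∈ Metric.ball x₀ r₀) (hρ : 0 < ρ) (hρr : ρ ≤ r₀) (hθ : 0 ≤ θ) (hθ1 : θ ≤ 1 / 2)
    (hm : (m * ρ) ^ 2 ≤ θ ^ 2) (T : Finset X) (hT : ∀ t ∈ T, dist x t = ρ)
    (hnet : ∀ w, dist x w = ρ → ∃ t ∈ T, dist w t ≤ θ * ρ) :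
    ∃ G : ℝ → ℝ, AntitoneOn G (Ioc 0 ρ) ∧ (∀ u ∈ Ioc 0 ρ, |G u| ≤ (T.card : ℝ) ^ 2) ∧
      ∀ s R, 0 < s → s ≤ R → R ≤ ρ → G s ≤ G R + θ ^ 2 → Stable x₀ r₀ x s R (32 * θ) := by
  have hxB := ball_subset_bigBall hx
  have hr₀ := h.radius_pos
  have hd := Metric.mem_ball'.1 hx
  have hmem : ∀ w : X, dist x w ≤ ρ → w ∈ bigBall x₀ r₀ := fun w hw =>
    closedBall_subset_bigBall hr₀ (mem_of_dist_le hx hw (by linarith))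
  have hpt : ∀ (t : T) (u : ℝ), ∃ a, u ∈ Icc 0 ρ → dist x a = u ∧ dist a t = ρ - u := by
    intro t u
    by_cases hu : u ∈ Icc 0 ρ
    · obtain ⟨a, -, h1, h2⟩ := h.exists_dist_eq hxB (hmem t (hT t t.2).le) hu.1
        (by rw [hT t t.2]; exact hu.2)
      exact ⟨a, fun _ => ⟨h1, by rw [h2, hT t t.2]⟩⟩
    · exact ⟨x, fun h => absurd h hu⟩
  choose φ hφ using hpt
  have hφB : ∀ t, ∀ u ∈ Ioc 0 ρ, φ t u ∈ bigBall x₀ r₀ := fun t u hu =>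
    hmem _ (by rw [(hφ t u ⟨hu.1.le, hu.2⟩).1]; exact hu.2)
  have hbet : ∀ t, ∀ s ∈ Ioc 0 ρ, ∀ R ∈ Ioc 0 ρ, s ≤ R → dist (φ t s) (φ t R) = R - s := by
    intro t s hs R hR hsR
    obtain ⟨e1, e2⟩ := hφ t s ⟨hs.1.le, hs.2⟩
    obtain ⟨e3, e4⟩ := hφ t R ⟨hR.1.le, hR.2⟩
    -- the point of the segment from `x` to `φ t R` at distance `s` from `x` is `φ t s`
    obtain ⟨q, hq, hq1, hq2⟩ := h.exists_dist_eq hxB (hφB t R hR) hs.1.le (by rw [e3]; exact hsR)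
    have : φ t s = q := by
      have ht := hT t t.2
      have hq3 : dist x q + dist q t = dist x t := by
        apply le_antisymm _ (dist_triangle _ _ _)
        have := dist_triangle q (φ t R) t
        linarith
      exact h.eq_of_dist_add hxB (hmem t ht.le) (hφB t s hs) hq (by linarith) hq3 (by linarith)
    rw [this, hq2, e3]
  set f : T → T → ℝ → ℝ := fun t t' u => sphCos m u u (dist (φ t u) (φ t' u)) with hf
  have hanti : ∀ t t', AntitoneOn (f t t') (Ioc 0 ρ) := by
    intro t t' s hs R hR hsR
    obtain ⟨e1, -⟩ := hφ t s ⟨hs.1.le, hs.2⟩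
    obtain ⟨e1', -⟩ := hφ t' s ⟨hs.1.le, hs.2⟩
    obtain ⟨e3, -⟩ := hφ t R ⟨hR.1.le, hR.2⟩
    obtain ⟨e3', -⟩ := hφ t' R ⟨hR.1.le, hR.2⟩
    have := h.sphCos_mono₂ hxB (hφB t R hR) (hφB t' R hR) (hφB t s hs) (hφB t' s hs)
      (by rw [e1, e3, hbet t s hs R hR hsR]; ring) (by rw [e1]; exact hs.1)
      (by rw [e1', e3', hbet t' s hs R hR hsR]; ring) (by rw [e1']; exact hs.1)
    rwa [e1, e1', e3, e3'] at this
  refine ⟨fun u => ∑ i : T × T, f i.1 i.2 u, ?_, ?_, ?_⟩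
  · intro s hs R hR hsR
    exact Finset.sum_le_sum fun i _ => hanti i.1 i.2 hs hR hsR
  · intro u hu
    refine (Finset.abs_sum_le_sum_abs _ _).trans ?_
    have : ∀ i ∈ (Finset.univ : Finset (T × T)), |f i.1 i.2 u| ≤ 1 := by
      intro i _
      have := h.abs_sphCos_le hxB (hφB i.1 u hu) (hφB i.2 u hu)
        (by rw [(hφ i.1 u ⟨hu.1.le, hu.2⟩).1]; exact hu.1)
        (by rw [(hφ i.2 u ⟨hu.1.le, hu.2⟩).1]; exact hu.1)
      rwa [(hφ i.1 u ⟨hu.1.le, hu.2⟩).1, (hφ i.2 u ⟨hu.1.le, hu.2⟩).1] at this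
    refine (Finset.sum_le_card_nsmul _ _ _ this).trans ?_
    simp [sq]
  · intro s R hs hsR hR hG
    have hsI : s ∈ Ioc 0 ρ := ⟨hs, hsR.trans hR⟩
    have hRI : R ∈ Ioc 0 ρ := ⟨hs.trans_le hsR, hR⟩
    have hm0 := h.scale_pos
    have hmR : (m * R) ^ 2 ≤ θ ^ 2 := by
      refine le_trans ?_ hm
      have := hRI.1
      gcongr
    rw [show 32 * θ = 16 * (2 * θ) by ring]
    refine h.stable_of_net hx hs hsR (hR.trans hρr) (by positivity) (by linarith) ?_
      (fun t : T => φ t R) (fun t : T => φ t s) (fun t => (hφ t R ⟨hRI.1.le, hR⟩).1)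
      (fun t => ⟨(hφ t s ⟨hs.le, hsI.2⟩).1, hbet t s hsI R hRI hsR⟩) ?_ ?_
    · nlinarith
    · intro w hw
      have hwx : x ≠ w := by rintro rfl; rw [dist_self] at hw; linarith [hRI.1]
      obtain ⟨v, hv, hv1, hv2⟩ := h.exists_extension_length hxB (hmem w (hw.trans_le hR)) hwx
        (hw.trans_le hR) (by linarith)
      obtain ⟨t, ht, htv⟩ := hnet v hv2
      obtain ⟨e3, e4⟩ := hφ ⟨t, ht⟩ R ⟨hRI.1.le, hRI.2⟩
      exact ⟨⟨t, ht⟩, h.dist_le_of_between hxB hv (hmem t (hT t ht).le) (hmem w (hw.trans_le hR))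
        (hφB _ R hRI) hRI.1 hR hm hθ hv2 (hT t ht) htv hw (by linarith) e3 e4⟩
    · intro t t'
      have hsum : ∑ i : T × T, (f i.1 i.2 s - f i.1 i.2 R) ≤ θ ^ 2 := by
        rw [Finset.sum_sub_distrib]; linarith
      have hnn : ∀ i ∈ (Finset.univ : Finset (T × T)), 0 ≤ f i.1 i.2 s - f i.1 i.2 R :=
        fun i _ => sub_nonneg.2 (hanti i.1 i.2 hsI hRI hsR)
      have := Finset.single_le_sum hnn (Finset.mem_univ (t, t'))
      simp only [hf] at this hsum
      nlinarith

/-- At small scales around a given point, comparison angles are almost constant. -/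
theorem exists_stable (h : ComparisonBall x₀ r₀ m) {x : X} {ε : ℝ} (hx : x ∈ Metric.ball x₀ r₀)
    (hε : 0 < ε) : ∃ R₀ > 0, ∀ s R, 0 < s → s ≤ R → R ≤ R₀ → Stable x₀ r₀ x s R ε := by
  have hr₀ := h.radius_pos
  have hm0 := h.scale_pos
  set θ := min (ε / 32) (1 / 2) with hθ
  have hθ0 : 0 < θ := lt_min (by positivity) (by norm_num)
  set ρ := min r₀ (θ / m) with hρdef
  have hρ : 0 < ρ := lt_min hr₀ (by positivity)
  have hmρ : (m * ρ) ^ 2 ≤ θ ^ 2 := by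
    apply pow_le_pow_left₀ (by positivity)
    have := min_le_right r₀ (θ / m)
    rw [le_div_iff₀ hm0] at this
    linarith
  have hK : IsCompact (Metric.sphere x ρ) := by
    apply h.compact.of_isClosed_subset Metric.isClosed_sphere
    intro w hw
    rw [Metric.mem_sphere'] at hw
    exact closedBall_subset_bigBall hr₀
      (mem_of_dist_le hx hw.le (by linarith [min_le_left r₀ (θ / m)]))
  obtain ⟨T, hT1, hT2, hT3⟩ := finite_cover_balls_of_compact hK
    (show 0 < θ * ρ by positivity)
  obtain ⟨G, hG1, hG2, hG3⟩ := h.exists_stability_function hx hρ (min_le_left _ _) hθ0.le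
    (min_le_right _ _) hmρ hT2.toFinset (fun t ht => Metric.mem_sphere'.1 (hT1 (hT2.mem_toFinset.1 ht)))
    (fun w hw => by
      have := hT3 (Metric.mem_sphere'.2 hw)
      simp only [mem_iUnion, Metric.mem_ball] at this
      obtain ⟨t, ht, htw⟩ := this
      exact ⟨t, hT2.mem_toFinset.2 ht, htw.le⟩)
  have hne : (G '' Ioc 0 ρ).Nonempty := ⟨G ρ, ρ, ⟨hρ, le_rfl⟩, rfl⟩
  have hbdd : BddAbove (G '' Ioc 0 ρ) := by
    refine ⟨(hT2.toFinset.card : ℝ) ^ 2, ?_⟩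
    rintro _ ⟨u, hu, rfl⟩
    exact (le_abs_self _).trans (hG2 u hu)
  obtain ⟨_, ⟨R₀, hR₀, rfl⟩, hlt⟩ := exists_lt_of_lt_csSup hne
    (show sSup (G '' Ioc 0 ρ) - θ ^ 2 < sSup (G '' Ioc 0 ρ) by
      have : 0 < θ ^ 2 := by positivity
      linarith)
  refine ⟨R₀, hR₀.1, fun s R hs hsR hR => ?_⟩
  have hRI : R ∈ Ioc 0 ρ := ⟨hs.trans_le hsR, hR.trans hR₀.2⟩
  have h1 : G s ≤ sSup (G '' Ioc 0 ρ) := le_csSup hbdd ⟨s, ⟨hs, hsR.trans hRI.2⟩, rfl⟩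
  have h2 := hG1 hRI hR₀ hR
  refine (hG3 s R hs hsR hRI.2 (by linarith)).mono ?_
  linarith [min_le_left (ε / 32) (1 / 2)]

/-- A point `y` close to `x` whose distances to the points `p i` are almost the same as those of `x`
is not in the set where the strainer map cannot be extended. -/
theorem exists_forall_not_mem_nonExtendable (h : ComparisonBall x₀ r₀ m) {k : ℕ} {p : Fin k → X}
    {V : Set X} {δ τ c : ℝ} (hF : IsStrainerMap x₀ r₀ δ p V) (hδ : 0 < δ)
    (hτ : 0 < τ) (hτ1 : τ ≤ 1 / 10) (hc0 : 0 ≤ c) (hc1 : c ≤ 1)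
    (hcτ : 2 * c + 26 * τ ≤ Real.sin (min δ (Real.pi / 2)))
    (hτδ : 10 * τ ^ 2 < 2 * Real.sin (min δ 1 / 2) ^ 2) {x : X} (hx : x ∈ V) :
    ∃ ρ > 0, ∀ y ∈ V, x ≠ y → dist x y < ρ →
      (∀ i, |dist (p i) x - dist (p i) y| ≤ c * dist x y) →
      y ∉ nonExtendable x₀ r₀ (12 * δ) p V := by
  have hr₀ := h.radius_pos
  have hm0 := h.scale_pos
  have hxU := hF.subset hx
  obtain ⟨R₀, hR₀, hst⟩ := h.exists_stable hxU (show 0 < τ ^ 2 by positivity)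
  have hev : ∀ᶠ R in 𝓝[>] (0 : ℝ), ∀ i, R ≤ dist x (p i) := by
    rw [eventually_all]
    intro i
    have := dist_pos.2 ((hF.strainer x hx).1 i).2.symm
    filter_upwards [Ioo_mem_nhdsGT this] with R hR using hR.2.le
  have hev2 : ∀ᶠ R in 𝓝[>] (0 : ℝ), (m * (2 * R)) ^ 2 ≤ τ ^ 2 := by
    have hpos : 0 < τ / (2 * m) := by positivity
    filter_upwards [Ioo_mem_nhdsGT hpos] with R hR
    have h1 := hR.1
    have h2 := hR.2
    rw [lt_div_iff₀ (by positivity)] at h2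
    apply pow_le_pow_left₀ (by positivity)
    linarith
  have hev3 : ∀ᶠ R in 𝓝[>] (0 : ℝ), 2 * R ≤ min R₀ r₀ := by
    filter_upwards [Ioo_mem_nhdsGT (show 0 < min R₀ r₀ / 2 by positivity)] with R hR
    linarith [hR.2]
  obtain ⟨r, ⟨⟨hr1, hr2⟩, hr3⟩, hr0⟩ :=
    (((hev.and hev2).and hev3).and self_mem_nhdsWithin).exists
  replace hr0 : 0 < r := hr0
  refine ⟨τ ^ 2 * r, by positivity, fun y hy hxy hd hc => ?_⟩
  have hττ : τ ^ 2 ≤ 1 := by nlinarith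
  exact h.not_mem_nonExtendable hF hδ hxU hy hxy hτ hτ1 hc0 hc1 hcτ hτδ hr0
    (hr3.trans (min_le_right _ _)) hd.le hr2
    (hst _ _ (dist_pos.2 hxy) (by nlinarith) (hr3.trans (min_le_left _ _))) hr1 hc

end ComparisonBall

end

/-! ### Countable decompositions into compact biLipschitz pieces -/

section

variable {X : Type u} [MetricSpace X] {x₀ : X} {r₀ m : ℝ}

theorem abs_sub_le_dist_distMap {k : ℕ} (p : Fin k → X) (x y : X) (i : Fin k) :
    |dist (p i) x - dist (p i) y| ≤ dist (distMap p x) (distMap p y) := by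
  have := EuclideanSpace.norm_eq (distMap p x - distMap p y)
  rw [dist_eq_norm]
  exact PiLp.norm_apply_le (distMap p x - distMap p y) i

theorem dist_distMap_le {k : ℕ} (p : Fin k → X) (x y : X) :
    dist (distMap p x) (distMap p y) ≤ Real.sqrt k * dist x y := by
  rw [EuclideanSpace.dist_eq]
  apply Real.sqrt_le_iff.2
  refine ⟨by positivity, ?_⟩
  rw [mul_pow, Real.sq_sqrt (Nat.cast_nonneg k)]
  calc _ ≤ ∑ _i : Fin k, dist x y ^ 2 := by
        refine Finset.sum_le_sum fun i _ => ?_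
        have : dist ((distMap p x).ofLp i) ((distMap p y).ofLp i) ≤ dist x y := by
          rw [Real.dist_eq]
          exact abs_dist_sub_dist_le (p i) x y
        exact pow_le_pow_left₀ dist_nonneg this 2
    _ = k * dist x y ^ 2 := by simp

theorem continuous_distMap {k : ℕ} (p : Fin k → X) : Continuous (distMap p) :=
  (LipschitzWith.of_dist_le_mul (K := (Real.sqrt k).toNNReal) fun x y => by
    rw [Real.coe_toNNReal _ (Real.sqrt_nonneg _)]
    exact dist_distMap_le p x y).continuous

theorem BiLipschitzOn.mono {X Y : Type*} [MetricSpace X] [MetricSpace Y] {L : ℝ} {F : X → Y}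
    {K K' : Set X} (h : BiLipschitzOn L F K) (hK : K' ⊆ K) : BiLipschitzOn L F K' :=
  fun x hx y hy => h x (hK hx) y (hK hy)

/-- The points of `V` that are not `(k + 1, δ')`-strained are points at which no strainer map on `V`
can be extended. -/
theorem diff_strainedPoints_subset {k : ℕ} (δ' : ℝ) (p : Fin k → X) (V : Set X) :
    V \ strainedPoints X (k + 1) δ' ⊆ nonExtendable x₀ r₀ δ' p V := by
  rintro x ⟨hx, hx'⟩
  refine ⟨hx, fun ⟨q, _, v, _, hv⟩ => hx' ⟨v, hv⟩⟩

namespace ComparisonBall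

/-- The countable decomposition: the sets of points of `E` near which, at scale `1 / (n + 1)`, the
strainer map expands distances to points of `E` by at least the factor `c`, exhaust `E`. -/
theorem exists_compact_pieces (h : ComparisonBall x₀ r₀ m) [TopologicalSpace.SeparableSpace X]
    {k : ℕ} {p : Fin k → X} {V : Set X} {δ τ c L : ℝ} (hF : IsStrainerMap x₀ r₀ δ p V) (hδ : 0 < δ)
    (hτ : 0 < τ) (hτ1 : τ ≤ 1 / 10) (hc0 : 0 < c) (hc1 : c ≤ 1)
    (hcτ : 2 * c + 26 * τ ≤ Real.sin (min δ (Real.pi / 2)))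
    (hτδ : 10 * τ ^ 2 < 2 * Real.sin (min δ 1 / 2) ^ 2)
    (hL : 1 / c ≤ L) (hL' : Real.sqrt k ≤ L) :
    ∃ K : ℕ → Set X, (∀ j, IsCompact (K j) ∧ BiLipschitzOn L (distMap p) (K j)) ∧
      nonExtendable x₀ r₀ (12 * δ) p V = ⋃ j, K j := by
  have : Nonempty X := ⟨x₀⟩
  have hEV : ∀ x ∈ nonExtendable x₀ r₀ (12 * δ) p V, x ∈ V := fun x hx => hx.1
  have hopen := h.isOpen_diff_nonExtendable hF.isOpen hF.subset (12 * δ) p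
  set E := nonExtendable x₀ r₀ (12 * δ) p V with hE
  obtain ⟨C, hC1, hC2, hC3, -⟩ := hF.isOpen.exists_iUnion_isClosed
  set A : ℕ → Set X := fun n => {x | x ∈ E ∧ ∀ y ∈ E, dist x y < 1 / ((n : ℝ) + 1) →
    c * dist x y ≤ dist (distMap p x) (distMap p y)} with hA
  have hmemA : ∀ x ∈ E, ∃ n, x ∈ A n := by
    intro x hx
    obtain ⟨ρ, hρ, H⟩ := h.exists_forall_not_mem_nonExtendable hF hδ hτ hτ1 hc0.le hc1 hcτ hτδ
      (hEV x hx)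
    obtain ⟨n, hn⟩ := exists_nat_one_div_lt hρ
    refine ⟨n, hx, fun y hy hxy => ?_⟩
    rcases eq_or_ne x y with rfl | hne
    · simp
    by_contra! hcon
    exact H y (hEV y hy) hne (hxy.trans hn)
      (fun i => (abs_sub_le_dist_distMap p x y i).trans hcon.le) hy
  have hclosed : ∀ n j, IsClosed (A n ∩ C j) := by
    intro n j
    have h1 : A n ∩ C j = (C j \ (V \ E)) ∩ ⋂ y ∈ E, {x | dist x y < 1 / ((n : ℝ) + 1) →
        c * dist x y ≤ dist (distMap p x) (distMap p y)} := by
      ext x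
      simp only [hA, mem_inter_iff, Set.mem_sdiff, mem_iInter, mem_ofPred_eq]
      constructor
      · rintro ⟨⟨a1, a2⟩, a3⟩
        exact ⟨⟨a3, fun h => h.2 a1⟩, a2⟩
      · rintro ⟨⟨a1, a2⟩, a3⟩
        refine ⟨⟨?_, a3⟩, a1⟩
        by_contra hx
        exact a2 ⟨hC2 j a1, hx⟩
    rw [h1]
    refine ((hC1 j).sdiff hopen).inter (isClosed_biInter fun y _ => ?_)
    have h2 : {x | dist x y < 1 / ((n : ℝ) + 1) →
        c * dist x y ≤ dist (distMap p x) (distMap p y)} = {x | 1 / ((n : ℝ) + 1) ≤ dist x y} ∪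
        {x | c * dist x y ≤ dist (distMap p x) (distMap p y)} := by
      ext x
      simp only [mem_ofPred_eq, mem_union, ← not_lt (a := dist x y)]
      tauto
    rw [h2]
    have hcont := continuous_distMap p
    exact (isClosed_le (by fun_prop) (by fun_prop)).union (isClosed_le (by fun_prop) (by fun_prop))
  have hbig : ∀ x ∈ E, x ∈ bigBall x₀ r₀ := fun x hx => ball_subset_bigBall (hF.subset (hEV x hx))
  obtain ⟨e, he⟩ := exists_surjective_nat (ℕ × ℕ × ℕ)
  refine ⟨fun j => (A (e j).1 ∩ C (e j).2.1) ∩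
    Metric.closedBall (TopologicalSpace.denseSeq X (e j).2.2) (1 / (4 * (((e j).1 : ℝ) + 1))),
    fun j => ⟨?_, ?_⟩, ?_⟩
  · exact h.compact.of_isClosed_subset ((hclosed _ _).inter Metric.isClosed_closedBall)
      fun x hx => hbig x hx.1.1.1
  · rintro x ⟨⟨hx, -⟩, hx'⟩ y ⟨⟨hy, -⟩, hy'⟩
    have hL0 : 0 < L := (by positivity : 0 < 1 / c).trans_le hL
    constructor
    · have hd : dist x y < 1 / (((e j).1 : ℝ) + 1) := by
        rw [Metric.mem_closedBall] at hx' hy'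
        have := dist_triangle_right x y (TopologicalSpace.denseSeq X (e j).2.2)
        have hp : 0 < 1 / (((e j).1 : ℝ) + 1) := by positivity
        have : 1 / (4 * (((e j).1 : ℝ) + 1)) = 1 / (((e j).1 : ℝ) + 1) / 4 := by
          field_simp
        linarith
      have h1 := hx.2 y hy.1 hd
      have h2 : 1 / L ≤ c := by
        rw [div_le_iff₀ hc0] at hL
        rw [div_le_iff₀ hL0]; linarith
      exact (mul_le_mul_of_nonneg_right h2 dist_nonneg).trans h1
    · exact (dist_distMap_le p x y).trans (mul_le_mul_of_nonneg_right hL' dist_nonneg)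
  · ext x
    simp only [mem_iUnion]
    constructor
    · intro hx
      obtain ⟨n, hn⟩ := hmemA x hx
      have hxV := hEV x hx
      rw [← hC3] at hxV
      obtain ⟨j, hj⟩ := mem_iUnion.1 hxV
      obtain ⟨l, hl⟩ := (TopologicalSpace.denseRange_denseSeq X).exists_dist_lt x
        (show (0 : ℝ) < 1 / (4 * ((n : ℝ) + 1)) by positivity)
      obtain ⟨i, hi⟩ := he (n, j, l)
      refine ⟨i, ?_⟩
      rw [hi]
      exact ⟨⟨hn, hj⟩, Metric.mem_closedBall.2 hl.le⟩
    · rintro ⟨j, ⟨hx, -⟩, -⟩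
      exact hx.1

theorem exists_compact_pieces_diff (h : ComparisonBall x₀ r₀ m) {k : ℕ} {p : Fin k → X} {V : Set X}
    {δ δ' L : ℝ} (hF : IsStrainerMap x₀ r₀ δ p V) {K : ℕ → Set X}
    (hK : ∀ j, IsCompact (K j) ∧ BiLipschitzOn L (distMap p) (K j))
    (hE : nonExtendable x₀ r₀ δ' p V = ⋃ j, K j) :
    ∃ K : ℕ → Set X, (∀ j, IsCompact (K j) ∧ BiLipschitzOn L (distMap p) (K j)) ∧
      V \ strainedPoints X (k + 1) δ' = ⋃ j, K j := by
  refine ⟨fun j => K j \ (V ∩ strainedPoints X (k + 1) δ'), fun j => ⟨?_, ?_⟩, ?_⟩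
  · exact (hK j).1.diff (h.isOpen_inter_strainedPoints hF.isOpen hF.subset _ _)
  · exact (hK j).2.mono sdiff_subset
  · rw [← iUnion_sdiff, ← hE]
    ext x
    constructor
    · intro hx
      exact ⟨diff_strainedPoints_subset δ' p V hx, fun h => hx.2 h.2⟩
    · rintro ⟨h1, h2⟩
      exact ⟨h1.1, fun h3 => h2 ⟨h1.1, h3⟩⟩

end ComparisonBall

/-- Without a bound on the capacity, the biLipschitz constant depends on `δ` and `k`. -/
theorem exists_compact_pieces_of_isTinyBall (X : Type u) [MetricSpace X] (κ : ℝ) (x₀ : X)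
    (r₀ δ : ℝ) (k : ℕ) (p : Fin k → X) (V : Set X) (hδ : 0 < δ) (hX : IsGCBA κ X)
    (hU : IsTinyBall κ x₀ r₀) (hF : IsStrainerMap x₀ r₀ δ p V) :
    ∃ (L : ℝ) (K : ℕ → Set X), 0 < L ∧
      (∀ j, IsCompact (K j) ∧ BiLipschitzOn L (distMap p) (K j)) ∧
      V \ strainedPoints X (k + 1) (12 * δ) = ⋃ j, K j := by
  have := hX.separable
  obtain ⟨m, h⟩ := hU.exists_comparisonBall hX
  obtain ⟨τ, c, hτ, hτ1, hc0, hc1, hcτ, hτδ⟩ := exists_constants hδ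
  obtain ⟨K, hK, hE⟩ := h.exists_compact_pieces hF hδ hτ hτ1 hc0 hc1 hcτ hτδ
    (le_max_left (1 / c) (Real.sqrt k)) (le_max_right _ _)
  obtain ⟨K', hK', hE'⟩ := h.exists_compact_pieces_diff hF hK hE
  exact ⟨_, K', (by positivity : 0 < 1 / c).trans_le (le_max_left _ _), hK', hE'⟩

end

/-! ### Doubling: the number of points in a fiber and the dimension -/

section

variable {X : Type u} [MetricSpace X] {x₀ : X} {r₀ m : ℝ}

theorem CapacityBoundedBy.card_le {N : ℕ} (hN : CapacityBoundedBy N x₀ r₀) {y : X} {r : ℝ}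
    (hr : 0 < r) (hy : y ∈ Metric.closedBall x₀ (5 * r₀)) (S : Finset X)
    (hS : ∀ a ∈ S, a ∈ Metric.closedBall x₀ (5 * r₀)) (hSy : ∀ a ∈ S, a ∈ Metric.ball y r)
    (hsep : ∀ a ∈ S, ∀ b ∈ S, a ≠ b → r / 2 ≤ dist a b) : S.card ≤ N := by
  classical
  have := hN ⟨y, hy⟩ r hr (S.subtype fun a => a ∈ Metric.closedBall x₀ (5 * r₀))
    (fun a ha => hSy a (Finset.mem_subtype.1 ha))
    (fun a ha b hb hab => hsep a (Finset.mem_subtype.1 ha) b (Finset.mem_subtype.1 hb)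
      fun h => hab (Subtype.ext h))
  rwa [Finset.card_subtype, Finset.filter_true_of_mem hS] at this

/-- A subset of a ball of radius `r` has an `r / 2`-net with at most `N` elements. -/
theorem CapacityBoundedBy.exists_half_net {N : ℕ} (hN : CapacityBoundedBy N x₀ r₀) {y : X} {r : ℝ}
    (hr : 0 < r) (hy : y ∈ Metric.closedBall x₀ (5 * r₀)) {B : Set X}
    (hB : B ⊆ Metric.closedBall x₀ (5 * r₀)) (hBy : B ⊆ Metric.ball y r) :
    ∃ T : Finset X, ↑T ⊆ B ∧ T.card ≤ N ∧ ∀ w ∈ B, ∃ t ∈ T, dist w t < r / 2 := by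
  classical
  let P : ℕ → Prop := fun n => ∃ T : Finset X, ↑T ⊆ B ∧
    (∀ a ∈ T, ∀ b ∈ T, a ≠ b → r / 2 ≤ dist a b) ∧ T.card = n
  have hle : ∀ n, P n → n ≤ N := by
    rintro n ⟨T, h1, h2, rfl⟩
    exact hN.card_le hr hy T (fun a ha => hB (h1 ha)) (fun a ha => hBy (h1 ha)) h2
  have hP0 : P 0 := ⟨∅, by simp, by simp, rfl⟩
  obtain ⟨T, h1, h2, h3⟩ := Nat.findGreatest_spec (P := P) (Nat.zero_le N) hP0
  refine ⟨T, h1, by rw [h3]; exact Nat.findGreatest_le N, fun w hw => ?_⟩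
  by_contra! hcon
  have hwT : w ∉ T := fun hwT => by
    have := hcon w hwT
    rw [dist_self] at this
    linarith
  have hP : P (T.card + 1) := by
    refine ⟨insert w T, ?_, ?_, Finset.card_insert_of_notMem hwT⟩
    · rw [Finset.coe_insert]
      exact insert_subset hw h1
    · intro a ha b hb hab
      rw [Finset.mem_insert] at ha hb
      rcases ha with rfl | ha <;> rcases hb with rfl | hb
      · exact absurd rfl hab
      · exact hcon b hb
      · rw [dist_comm]; exact hcon a ha
      · exact h2 a ha b hb hab
  have := Nat.le_findGreatest (hle _ hP) hP
  omega

/-- Iterated halving of the radius gives nets of fineness `r / 2 ^ (j + 1)`. -/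
theorem CapacityBoundedBy.exists_net {N : ℕ} (hN : CapacityBoundedBy N x₀ r₀) {y : X} {r : ℝ}
    (hr : 0 < r) (hy : y ∈ Metric.closedBall x₀ (5 * r₀)) {B : Set X}
    (hB : B ⊆ Metric.closedBall x₀ (5 * r₀)) (hBy : B ⊆ Metric.ball y r) (j : ℕ) :
    ∃ T : Finset X, ↑T ⊆ B ∧ T.card ≤ N ^ (j + 1) ∧
      ∀ w ∈ B, ∃ t ∈ T, dist w t < r / 2 ^ (j + 1) := by
  classical
  induction j with
  | zero => simpa using hN.exists_half_net hr hy hB hBy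
  | succ j ih =>
    obtain ⟨T, h1, h2, h3⟩ := ih
    have key : ∀ t : X, ∃ T' : Finset X, t ∈ T → ↑T' ⊆ B ∧ T'.card ≤ N ∧
        ∀ w ∈ B ∩ Metric.ball t (r / 2 ^ (j + 1)), ∃ t' ∈ T', dist w t' < r / 2 ^ (j + 2) := by
      intro t
      by_cases ht : t ∈ T
      · obtain ⟨T', e1, e2, e3⟩ := hN.exists_half_net (show 0 < r / 2 ^ (j + 1) by positivity)
          (hB (h1 ht)) (inter_subset_left.trans hB)
          (inter_subset_right : B ∩ Metric.ball t (r / 2 ^ (j + 1)) ⊆ _)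
        refine ⟨T', fun _ => ⟨e1.trans inter_subset_left, e2, fun w hw => ?_⟩⟩
        obtain ⟨t', ht', hd⟩ := e3 w hw
        refine ⟨t', ht', hd.trans_eq ?_⟩
        rw [div_div, ← pow_succ]
      · exact ⟨∅, fun h => absurd h ht⟩
    choose f hf using key
    refine ⟨T.biUnion f, ?_, ?_, ?_⟩
    · intro a ha
      obtain ⟨t, ht, hat⟩ := Finset.mem_biUnion.1 (Finset.mem_coe.1 ha)
      exact (hf t ht).1 hat
    · refine (Finset.card_biUnion_le_card_mul _ _ N fun t ht => (hf t ht).2.1).trans ?_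
      rw [pow_succ]
      exact Nat.mul_le_mul_right N h2
    · intro w hw
      obtain ⟨t, ht, hwt⟩ := h3 w hw
      obtain ⟨t', ht', hd⟩ := (hf t ht).2.2 w ⟨hw, hwt⟩
      exact ⟨t', Finset.mem_biUnion.2 ⟨t, ht, ht'⟩, hd⟩

theorem CapacityBoundedBy.pos {N : ℕ} (hN : CapacityBoundedBy N x₀ r₀) (hr₀ : 0 < r₀) : 1 ≤ N := by
  have hx : x₀ ∈ Metric.closedBall x₀ (5 * r₀) := Metric.mem_closedBall_self (by positivity)
  have := hN.card_le one_pos hx {x₀} (by simpa using hx) (by simp) (by simp)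
  simpa using this

/-- A large finite set contains a point `x` and a long sequence of points converging to `x` at a
prescribed geometric rate. -/
theorem CapacityBoundedBy.exists_chain {N : ℕ} (hN : CapacityBoundedBy N x₀ r₀) (hr₀ : 0 < r₀)
    (j n : ℕ) (A : Finset X)
    (hA : ∀ a ∈ A, a ∈ Metric.closedBall x₀ (5 * r₀)) (hcard : (N ^ (j + 1)) ^ n < A.card) :
    ∃ x ∈ A, ∃ y : ℕ → X, (∀ i < n, y i ∈ A ∧ y i ≠ x) ∧
      ∀ i, i + 1 < n → dist x (y (i + 1)) ≤ 8 / 2 ^ (j + 1) * dist x (y i) := by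
  classical
  induction n generalizing A with
  | zero =>
    obtain ⟨x, hx⟩ := Finset.card_pos.1 (by simp at hcard; omega : 0 < A.card)
    exact ⟨x, hx, fun _ => x, by simp, by simp⟩
  | succ n ih =>
    have hM : 1 ≤ N ^ (j + 1) := Nat.one_le_pow _ _ (hN.pos hr₀)
    have h1 : 1 < A.card := (Nat.one_le_pow _ _ hM).trans_lt hcard
    obtain ⟨u₀, hu₀, v₀, hv₀, huv₀⟩ := Finset.one_lt_card.1 h1
    obtain ⟨⟨u, v⟩, huv, hmax⟩ := Finset.exists_max_image (A ×ˢ A) (fun q => dist q.1 q.2)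
      ⟨(u₀, v₀), Finset.mem_product.2 ⟨hu₀, hv₀⟩⟩
    rw [Finset.mem_product] at huv
    simp only at huv
    set D := dist u v with hD
    have hmax' : ∀ a ∈ A, ∀ b ∈ A, dist a b ≤ D := fun a ha b hb =>
      hmax (a, b) (Finset.mem_product.2 ⟨ha, hb⟩)
    have hD0 : 0 < D := (dist_pos.2 huv₀).trans_le (hmax' _ hu₀ _ hv₀)
    obtain ⟨T, hT1, hT2, hT3⟩ := hN.exists_net (B := (A : Set X)) (y := u) (r := 2 * D)
      (by positivity) (hA u huv.1) hA
      (fun a ha => by rw [Metric.mem_ball]; linarith [hmax' a ha u huv.1]) j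
    choose! f hf using hT3
    obtain ⟨t, ht, hlt⟩ := Finset.exists_lt_card_fiber_of_mul_lt_card_of_maps_to
      (s := A) (t := T) (f := f) (n := (N ^ (j + 1)) ^ n) (fun a ha => (hf a ha).1) (by
        refine (Nat.mul_le_mul_right _ hT2).trans_lt ?_
        rwa [pow_succ, mul_comm] at hcard)
    obtain ⟨x, hx, y, hy1, hy2⟩ := ih _ (fun a ha => hA a (Finset.mem_filter.1 ha).1) hlt
    have hxA := (Finset.mem_filter.1 hx).1
    -- one of the end points `u`, `v` of a diameter is far from `x`
    obtain ⟨w, hw, hwD⟩ : ∃ w ∈ A, D / 2 ≤ dist x w := by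
      by_contra! hcon
      have := dist_triangle_left u v x
      have := hcon u huv.1
      have := hcon v huv.2
      linarith
    refine ⟨x, hxA, fun i => Nat.casesOn i w y, ?_, ?_⟩
    · rintro (_ | i) hi
      · refine ⟨hw, ?_⟩
        intro e
        replace e : w = x := e
        rw [e, dist_self] at hwD
        linarith
      · have := hy1 i (by omega)
        exact ⟨(Finset.mem_filter.1 this.1).1, this.2⟩
    · rintro (_ | i) hi
      · have hy := hy1 0 (by omega)
        have e1 := (hf x hxA).2
        have e2 := (hf (y 0) (Finset.mem_filter.1 hy.1).1).2
        rw [(Finset.mem_filter.1 hx).2] at e1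
        rw [(Finset.mem_filter.1 hy.1).2] at e2
        have e3 := dist_triangle_right x (y 0) t
        have e4 : 2 * (2 * D / 2 ^ (j + 1)) ≤ 8 / 2 ^ (j + 1) * dist x w := by
          rw [← mul_div_assoc, div_mul_eq_mul_div]
          apply div_le_div_of_nonneg_right _ (by positivity)
          linarith
        change dist x (y 0) ≤ 8 / 2 ^ (j + 1) * dist x w
        linarith
      · exact hy2 i (by omega)

/-- A bound for the number of points of a fiber at which the strainer map cannot be extended. Many such
points would contain a long chain, as in `exists_chain`, converging fast to one of them, `x`. The
stability function at `x` changes by a definite amount only boundedly often along the chain, so that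
some `y` in the chain is at a stable scale from `x`; this contradicts `not_mem_nonExtendable`. -/
theorem exists_card_fiber_le (N : ℕ) {δ : ℝ} (hδ : 0 < δ) : ∃ C : ℕ, ∀ (X : Type u) [MetricSpace X]
    (x₀ : X) (r₀ m : ℝ) (k : ℕ) (p : Fin k → X) (V : Set X), ComparisonBall x₀ r₀ m →
    CapacityBoundedBy N x₀ r₀ → IsStrainerMap x₀ r₀ δ p V → ∀ (A : Finset X),
    (∀ a ∈ A, a ∈ nonExtendable x₀ r₀ (12 * δ) p V) →
    (∀ a ∈ A, ∀ b ∈ A, distMap p a = distMap p b) → A.card ≤ C := by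
  obtain ⟨τ, c, hτ, hτ1, hc0, hc1, hcτ, hτδ⟩ := exists_constants hδ
  set θ := τ ^ 2 / 32 with hθ
  have hττ : τ ^ 2 ≤ 1 / 100 := by nlinarith
  have hθ0 : 0 < θ := by positivity
  obtain ⟨j, hj⟩ := exists_pow_lt_of_lt_one (show 0 < θ / 16 by positivity)
    (by norm_num : (1 / 2 : ℝ) < 1)
  have hj1 : 8 / 2 ^ (j + 1) ≤ θ / 2 := by
    have : (8 : ℝ) / 2 ^ (j + 1) = 4 * (1 / 2) ^ j := by
      rw [pow_succ, one_div, inv_pow]; field_simp; norm_num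
    linarith
  set M := N ^ (j + 1) with hM
  obtain ⟨n, hn⟩ := exists_nat_gt (2 * (M : ℝ) ^ 2 / θ ^ 2)
  refine ⟨M ^ (n + 2), fun X _ x₀ r₀ m k p V h hN hF A hAE hAF => ?_⟩
  by_contra! hcard
  have hr₀ := h.radius_pos
  have hm0 := h.scale_pos
  have hAV : ∀ a ∈ A, a ∈ V := fun a ha => (hAE a ha).1
  have hAW : ∀ a ∈ A, a ∈ Metric.closedBall x₀ (5 * r₀) := fun a ha => by
    have := Metric.mem_ball.1 (hF.subset (hAV a ha))
    rw [Metric.mem_closedBall]; linarith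
  obtain ⟨x, hx, y, hy1, hy2⟩ := hN.exists_chain hr₀ j (n + 2) A hAW hcard
  have hxU := hF.subset (hAV x hx)
  set ρ := θ * r₀ with hρ
  have hρ0 : 0 < ρ := by positivity
  have hρr : ρ ≤ r₀ := by nlinarith
  have hmem : ∀ w, dist x w = ρ → w ∈ Metric.closedBall x₀ (5 * r₀) := fun w hw =>
    ComparisonBall.mem_of_dist_le hxU hw.le (by linarith)
  obtain ⟨T, hT1, hT2, hT3⟩ := hN.exists_net (B := Metric.sphere x ρ) (y := x) (r := 2 * ρ)
    (by positivity) (hAW x hx) (fun w hw => hmem w (Metric.mem_sphere'.1 hw))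
    (fun w hw => by rw [Metric.mem_ball, Metric.mem_sphere.1 hw]; linarith) j
  have hmρ : (m * ρ) ^ 2 ≤ θ ^ 2 := by
    apply pow_le_pow_left₀ (by positivity)
    have := h.scale_le
    have := Real.pi_lt_four
    calc m * ρ = θ * (m * r₀) := by rw [hρ]; ring
      _ ≤ θ * 1 := mul_le_mul_of_nonneg_left (by linarith) hθ0.le
      _ = θ := mul_one θ
  obtain ⟨G, hG1, hG2, hG3⟩ := h.exists_stability_function hxU hρ0 hρr hθ0.le (by linarith) hmρ T
    (fun t ht => Metric.mem_sphere'.1 (hT1 ht)) (fun w hw => by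
      obtain ⟨t, ht, hwt⟩ := hT3 w (Metric.mem_sphere'.2 hw)
      refine ⟨t, ht, hwt.le.trans ?_⟩
      calc 2 * ρ / 2 ^ (j + 1) ≤ (8 / 2 ^ (j + 1)) * ρ := by
            rw [div_mul_eq_mul_div]
            apply div_le_div_of_nonneg_right _ (by positivity)
            linarith
        _ ≤ θ * ρ := mul_le_mul_of_nonneg_right (by linarith) hρ0.le)
  set d : ℕ → ℝ := fun i => dist x (y i) with hd
  have hd0 : ∀ i < n + 2, 0 < d i := fun i hi => dist_pos.2 (hy1 i hi).2.symm
  have hstep : ∀ i, i + 1 < n + 2 → d (i + 1) ≤ θ / 2 * d i := fun i hi =>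
    (hy2 i hi).trans (mul_le_mul_of_nonneg_right hj1 dist_nonneg)
  have hdec : ∀ i, i + 1 < n + 2 → d (i + 1) ≤ d i := fun i hi =>
    (hstep i hi).trans (by have := hd0 i (by omega); nlinarith)
  have hle0 : ∀ i < n + 2, d i ≤ d 0 := by
    intro i hi
    induction i with
    | zero => exact le_rfl
    | succ i ih => exact (hdec i hi).trans (ih (by omega))
  have hd02 : d 0 ≤ 2 * r₀ := by
    have h1 := Metric.mem_ball.1 hxU
    have h2 := Metric.mem_ball.1 (hF.subset (hAV _ (hy1 0 (by omega)).1))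
    have := dist_triangle_right x (y 0) x₀
    simp only [hd]
    linarith
  have hdρ : ∀ i, i + 1 < n + 2 → d (i + 1) ≤ ρ := by
    intro i hi
    have h1 := hstep i hi
    have h2 := hle0 i (by omega)
    have : θ / 2 * d i ≤ θ / 2 * (2 * r₀) :=
      mul_le_mul_of_nonneg_left (h2.trans hd02) (by positivity)
    rw [hρ]; linarith
  have hp : ∀ l, d 0 ≤ 2 * dist x (p l) := by
    intro l
    have h1 := abs_sub_le_dist_distMap p x (y 0) l
    rw [hAF x hx _ (hy1 0 (by omega)).1, dist_self] at h1
    have h2 := abs_nonpos_iff.1 h1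
    have h3 := dist_triangle x (p l) (y 0)
    rw [dist_comm (p l) x] at h2
    simp only [hd]
    linarith
  -- every step of the chain decreases `G` by a definite amount
  have hinc : ∀ i, i + 2 < n + 2 → G (d (i + 1)) + θ ^ 2 ≤ G (d (i + 2)) := by
    intro i hi
    by_contra! hcon
    have hs0 := hd0 (i + 2) hi
    set r := d (i + 2) / τ ^ 2 with hr
    have hsr : d (i + 2) = τ ^ 2 * r := by rw [hr]; field_simp
    have hr0 : 0 < r := by positivity
    have hRd : 2 * r ≤ d (i + 1) := by
      have h1 := hstep (i + 1) (by omega)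
      have : τ ^ 2 * (2 * r) ≤ τ ^ 2 * d (i + 1) := by
        have h2 := hd0 (i + 1) (by omega)
        have h3 : 0 ≤ τ ^ 2 * d (i + 1) := by positivity
        rw [show i + 1 + 1 = i + 2 from rfl, hsr, hθ] at h1
        nlinarith
      exact le_of_mul_le_mul_left this (by positivity)
    have hRρ : 2 * r ≤ ρ := hRd.trans (hdρ i (by omega))
    have hGR : G (d (i + 1)) ≤ G (2 * r) :=
      hG1 ⟨by positivity, hRρ⟩ ⟨hd0 _ (by omega), hdρ i (by omega)⟩ hRd
    have hst := hG3 (d (i + 2)) (2 * r) hs0 (by nlinarith) hRρ (by linarith)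
    have hyi := hy1 (i + 2) hi
    refine h.not_mem_nonExtendable hF hδ hxU (hAV _ hyi.1) hyi.2.symm hτ hτ1 le_rfl zero_le_one
      (by linarith) hτδ hr0 (hRρ.trans hρr) hsr.le ?_ (hst.mono (by rw [hθ]; linarith)) ?_ ?_
      (hAE _ hyi.1)
    · calc (m * (2 * r)) ^ 2 ≤ (m * ρ) ^ 2 := by gcongr
        _ ≤ θ ^ 2 := hmρ
        _ ≤ τ ^ 2 := by
          apply pow_le_pow_left₀ hθ0.le
          rw [hθ]; nlinarith
    · intro l
      have := hp l
      have := hle0 (i + 1) (by omega)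
      linarith
    · intro l
      have h1 := abs_sub_le_dist_distMap p x (y (i + 2)) l
      rwa [hAF x hx _ hyi.1, dist_self, ← zero_mul (dist x (y (i + 2)))] at h1
  have hsum : ∀ i, i + 1 < n + 2 → G (d 1) + i * θ ^ 2 ≤ G (d (i + 1)) := by
    intro i hi
    induction i with
    | zero => simp
    | succ i ih =>
      have h1 := ih (by omega)
      have h2 := hinc i (by omega)
      push_cast
      linarith
  have h1 := hsum n (by omega)
  have b1 := (abs_le.1 (hG2 (d 1) ⟨hd0 1 (by omega), hdρ 0 (by omega)⟩)).1
  have b2 := (abs_le.1 (hG2 (d (n + 1)) ⟨hd0 _ (by omega), hdρ n (by omega)⟩)).2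
  have b3 : (T.card : ℝ) ^ 2 ≤ (M : ℝ) ^ 2 := by
    have : (T.card : ℝ) ≤ M := by exact_mod_cast hT2
    gcongr
  rw [div_lt_iff₀ (by positivity)] at hn
  linarith

/-- Either `k` is at most `N`, or the strainer map can be extended everywhere. If `12 δ ≤ π`, the
directions of the `k` points of a strainer have pairwise angles at least `π / 3`, so that points close
to `x` in these directions are separated. If `12 δ > π`, only `OppPair` is a condition for the
extended map, and a strainer point can be repeated. -/
theorem ComparisonBall.nonExtendable_eq_empty_or_le (h : ComparisonBall x₀ r₀ m) {N k : ℕ}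
    (hN : CapacityBoundedBy N x₀ r₀) {δ : ℝ} (hδ : 0 < δ) {p : Fin k → X} {V : Set X}
    (hF : IsStrainerMap x₀ r₀ δ p V) : nonExtendable x₀ r₀ (12 * δ) p V = ∅ ∨ k ≤ N := by
  classical
  rcases Nat.eq_zero_or_pos k with rfl | hk
  · exact Or.inr (Nat.zero_le _)
  rcases V.eq_empty_or_nonempty with rfl | ⟨y, hyV⟩
  · left
    ext x
    simp [nonExtendable]
  have hr₀ := h.radius_pos
  rcases lt_or_ge Real.pi (12 * δ) with hbig | hsmall
  · left
    refine eq_empty_of_forall_notMem fun y hy => ?_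
    have hyU := hF.subset hy.1
    obtain ⟨hpA, p', hp'A, H1, -⟩ := (h.isStrainerAt_iff hyU).1 (hF.strainer y hy.1)
    have hpi := Real.pi_pos
    have hq : ∀ i, Admissible x₀ r₀ y (Fin.snoc (α := fun _ => X) p (p ⟨0, hk⟩) i) := fun i => by
      refine Fin.lastCases ?_ (fun i => ?_) i <;> simp [hpA]
    have hq' : ∀ i, Admissible x₀ r₀ y (Fin.snoc (α := fun _ => X) p' (p' ⟨0, hk⟩) i) := fun i => by
      refine Fin.lastCases ?_ (fun i => ?_) i <;> simp [hp'A]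
    have hlt : ∀ {a b : X}, Admissible x₀ r₀ y a → Admissible x₀ r₀ y b →
        ang y a b < Real.pi / 2 + 12 * δ := fun ha hb =>
      (h.ang_le_pi hyU ha.1 hb.1 ha.2 hb.2).trans_lt (by linarith)
    refine hy.2 ⟨p ⟨0, hk⟩, (h.isStrainerAt_iff hyU).2 ⟨hq, _, hq', fun i => ?_, fun i j _ =>
      ⟨hlt (hq i) (hq' j), hlt (hq i) (hq j), hlt (hq' i) (hq' j)⟩⟩⟩
    refine Fin.lastCases ?_ (fun i => ?_) i
    · simpa using (H1 ⟨0, hk⟩).mono (by linarith)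
    · simpa using (H1 i).mono (by linarith)
  · right
    have hyU := hF.subset hyV
    have hyB := ball_subset_bigBall hyU
    have hm0 := h.scale_pos
    obtain ⟨hpA, p', hp'A, H1, H2⟩ := (h.isStrainerAt_iff hyU).1 (hF.strainer y hyV)
    obtain ⟨s, ⟨hsp, hsr⟩, hs0⟩ : ∃ s : ℝ, ((∀ i, s ≤ dist y (p i)) ∧ s ≤ r₀) ∧ 0 < s := by
      have hev : ∀ᶠ s in 𝓝[>] (0 : ℝ), ∀ i, s ≤ dist y (p i) := by
        rw [eventually_all]
        intro i
        filter_upwards [Ioo_mem_nhdsGT (dist_pos.2 (hpA i).2.symm)] with s hs using hs.2.le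
      have hev2 : ∀ᶠ s in 𝓝[>] (0 : ℝ), s ≤ r₀ := by
        filter_upwards [Ioo_mem_nhdsGT hr₀] with s hs using hs.2.le
      exact ((hev.and hev2).and self_mem_nhdsWithin).exists
    have ha : ∀ i, ∃ a, Admissible x₀ r₀ y a ∧ dist y a = s ∧
        dist y a + dist a (p i) = dist y (p i) := by
      intro i
      obtain ⟨a, -, h1, h2⟩ := h.exists_dist_eq hyB (closedBall_subset_bigBall hr₀ (hpA i).1)
        hs0.le (hsp i)
      refine ⟨a, ⟨ComparisonBall.mem_of_dist_le hyU h1.le (by linarith), ?_⟩, h1, by linarith⟩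
      rintro rfl
      rw [dist_self] at h1
      linarith
    choose a haA has hap using ha
    have hdist : ∀ i j, i ≠ j → 3 / 4 * s ≤ dist (a i) (a j) := by
      intro i j hij
      have e1 : ang y (a i) (a j) = ang y (p i) (p j) := by
        rw [h.ang_of_between hyU (hpA i).1 (haA j).1 (haA i).1 (haA i).2 (haA j).2 (hap i),
          h.ang_comm hyU (hpA i).1 (haA j).1 (hpA i).2 (haA j).2,
          h.ang_of_between hyU (hpA j).1 (hpA i).1 (haA j).1 (haA j).2 (hpA i).2 (hap j),
          h.ang_comm hyU (hpA j).1 (hpA i).1 (hpA j).2 (hpA i).2]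
      have e2 := h.pi_sub_lt_ang hyU (hpA i) (hp'A i) (H1 i)
      have e3 := h.ang_triangle hyU (hpA i).1 (hpA j).1 (hp'A i).1 (hpA i).2 (hpA j).2 (hp'A i).2
      have e4 := (H2 j i hij.symm).1
      have e5 : Real.cos (ang y (a i) (a j)) ≤ Real.cos (Real.pi / 3) := by
        apply Real.cos_le_cos_of_nonneg_of_le_pi (by linarith [Real.pi_pos])
          (h.ang_le_pi hyU (haA i).1 (haA j).1 (haA i).2 (haA j).2)
        rw [e1]; linarith
      rw [Real.cos_pi_div_three] at e5
      have e6 := h.sphCos_le_cos_ang hyU (haA i).1 (haA j).1 (haA i).2 (haA j).2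
      have hms : (m * s) ^ 2 ≤ 1 / 5 := by
        have h1 : m * s ≤ m * r₀ := mul_le_mul_of_nonneg_left hsr hm0.le
        have h2 := h.scale_le
        have h3 := Real.pi_lt_four
        have h4 : 0 < m * s := by positivity
        nlinarith
      have e7 := h.eucCos_sub_le_sphCos hyB (closedBall_subset_bigBall hr₀ (haA i).1)
        (closedBall_subset_bigBall hr₀ (haA j).1) (by rw [has]; exact hs0) (by rw [has]; exact hs0)
        (has i).le (has j).le hms
      rw [has, has] at e6 e7
      rw [eucCos_self _ _ hs0] at e7
      have e8 : (3 / 4) ^ 2 / 2 ≤ dist (a i) (a j) ^ 2 / (2 * s ^ 2) := by linarith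
      rw [le_div_iff₀ (by positivity)] at e8
      refine (pow_le_pow_iff_left₀ (by positivity) dist_nonneg two_ne_zero).1 ?_
      linarith
    have hinj : Function.Injective a := by
      intro i j hij
      by_contra hne
      have := hdist i j hne
      rw [hij, dist_self] at this
      linarith
    have := hN.card_le (y := y) (r := 3 / 2 * s) (by positivity)
      (ComparisonBall.mem_of_dist_le hyU (dist_self y).le (by linarith)) (Finset.univ.image a)
      (fun b hb => by
        obtain ⟨i, -, rfl⟩ := Finset.mem_image.1 hb
        exact (haA i).1)
      (fun b hb => by
        obtain ⟨i, -, rfl⟩ := Finset.mem_image.1 hb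
        rw [Metric.mem_ball', has]
        linarith)
      (fun b hb b' hb' hbb => by
        obtain ⟨i, -, rfl⟩ := Finset.mem_image.1 hb
        obtain ⟨j, -, rfl⟩ := Finset.mem_image.1 hb'
        have := hdist i j fun e => hbb (by rw [e])
        linarith)
    rwa [Finset.card_image_of_injective _ hinj, Finset.card_univ, Fintype.card_fin] at this

end

/-! ### Hausdorff measures -/

section

open scoped ENNReal

theorem BiLipschitzOn.injOn {X Y : Type*} [MetricSpace X] [MetricSpace Y] {L : ℝ} (hL : 0 < L)
    {F : X → Y} {K : Set X} (h : BiLipschitzOn L F K) : InjOn F K := by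
  intro x hx y hy hxy
  have h1 := (h x hx y hy).1
  rw [hxy, dist_self] at h1
  by_contra hne
  have : 0 < 1 / L * dist x y := mul_pos (by positivity) (dist_pos.2 hne)
  linarith

theorem BiLipschitzOn.hausdorffMeasure_le {X Y : Type*} [MetricSpace X] [MeasurableSpace X]
    [BorelSpace X] [MetricSpace Y] [MeasurableSpace Y] [BorelSpace Y] {L : ℝ} (hL : 0 < L)
    {F : X → Y} {K : Set X} (h : BiLipschitzOn L F K) (k : ℕ) :
    Measure.hausdorffMeasure (k : ℝ) K ≤
      ENNReal.ofReal (L ^ k) * Measure.hausdorffMeasure (k : ℝ) (F '' K) := by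
  rcases K.eq_empty_or_nonempty with rfl | ⟨x, -⟩
  · simp
  have : Nonempty X := ⟨x⟩
  have hinv := (h.injOn hL).leftInvOn_invFunOn
  have hlip : LipschitzOnWith L.toNNReal (Function.invFunOn F K) (F '' K) := by
    refine LipschitzOnWith.of_dist_le_mul ?_
    rintro _ ⟨a, ha, rfl⟩ _ ⟨b, hb, rfl⟩
    rw [hinv ha, hinv hb]
    have := (h a ha b hb).1
    rw [one_div_mul_eq_div, div_le_iff₀ hL] at this
    rw [Real.coe_toNNReal _ hL.le]
    linarith
  have := hlip.hausdorffMeasure_image_le (d := k) (Nat.cast_nonneg k)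
  rw [hinv.image_image] at this
  refine this.trans_eq ?_
  rw [ENNReal.rpow_natCast, ENNReal.ofReal_pow hL.le]
  rfl

/-- A set that is a countable union of compact sets on which `F` is `L`-biLipschitz, and that meets
every fiber of `F` in at most `n` points, is not much larger than its image. -/
theorem hausdorffMeasure_le_of_biLipschitzOn {X Y : Type*} [MetricSpace X] [MeasurableSpace X]
    [BorelSpace X] [MetricSpace Y] [MeasurableSpace Y] [BorelSpace Y] {L : ℝ} (hL : 0 < L)
    {F : X → Y} (hF : Continuous F) {K : ℕ → Set X} (hK : ∀ j, IsCompact (K j))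
    (hK' : ∀ j, BiLipschitzOn L F (K j)) {n : ℕ}
    (hn : ∀ A : Finset X, (∀ a ∈ A, a ∈ ⋃ j, K j) → (∀ a ∈ A, ∀ b ∈ A, F a = F b) → A.card ≤ n)
    (k : ℕ) : Measure.hausdorffMeasure (k : ℝ) (⋃ j, K j) ≤
      ENNReal.ofReal (L ^ k) * (n * Measure.hausdorffMeasure (k : ℝ) (F '' ⋃ j, K j)) := by
  classical
  rcases isEmpty_or_nonempty X with hX | hX
  · rw [(⋃ j, K j).eq_empty_of_isEmpty]
    simp
  set μ : Measure Y := Measure.hausdorffMeasure (k : ℝ) with hμ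
  set B := disjointed K with hB
  have hBK : ∀ j, B j ⊆ K j := disjointed_subset K
  have hmeas : ∀ j, MeasurableSet (F '' B j) := by
    intro j
    have h1 : B j = K j \ ⋃ i ∈ Finset.range j, K j ∩ K i := by
      ext x
      simp only [hB, disjointed_apply, Finset.sup_set_eq_biUnion, Finset.mem_Iio, Set.mem_sdiff,
        mem_iUnion, Finset.mem_range, mem_inter_iff, not_exists, not_and]
      exact and_congr_right fun hx => by simp [hx]
    rw [h1, ((hK' j).injOn hL).image_sdiff_subset (iUnion₂_subset fun i _ => inter_subset_left)]
    refine ((hK j).image hF).measurableSet.diff ?_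
    exact (((Finset.range j).isCompact_biUnion fun i _ =>
      (hK j).inter_right (hK i).isClosed).image hF).measurableSet
  have hmeasE : MeasurableSet (F '' ⋃ j, K j) := by
    rw [image_iUnion]
    exact MeasurableSet.iUnion fun j => ((hK j).image hF).measurableSet
  calc Measure.hausdorffMeasure (k : ℝ) (⋃ j, K j)
      = Measure.hausdorffMeasure (k : ℝ) (⋃ j, B j) := by rw [hB, iUnion_disjointed]
    _ ≤ ∑' j, Measure.hausdorffMeasure (k : ℝ) (B j) := measure_iUnion_le _
    _ ≤ ∑' j, ENNReal.ofReal (L ^ k) * μ (F '' B j) :=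
      ENNReal.tsum_le_tsum fun j => ((hK' j).mono (hBK j)).hausdorffMeasure_le hL k
    _ = ENNReal.ofReal (L ^ k) * ∑' j, ∫⁻ y, (F '' B j).indicator 1 y ∂μ := by
      rw [ENNReal.tsum_mul_left]
      simp_rw [lintegral_indicator_one (hmeas _)]
    _ = ENNReal.ofReal (L ^ k) * ∫⁻ y, ∑' j, (F '' B j).indicator 1 y ∂μ := by
      rw [lintegral_tsum fun j => (measurable_one.indicator (hmeas j)).aemeasurable]
    _ ≤ ENNReal.ofReal (L ^ k) * ∫⁻ y, (F '' ⋃ j, K j).indicator (fun _ => (n : ℝ≥0∞)) y ∂μ := by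
      refine mul_le_mul_right (lintegral_mono fun y => ?_) _
      rw [ENNReal.tsum_eq_iSup_sum]
      refine iSup_le fun s => ?_
      have h1 : ∑ j ∈ s, (F '' B j).indicator (1 : Y → ℝ≥0∞) y =
          ((s.filter fun j => y ∈ F '' B j).card : ℝ≥0∞) := by
        simp [indicator_apply]
      rw [h1]
      -- the points of the fiber in different pieces are different
      have h2 : ∀ j, y ∈ F '' B j → ∃ x, x ∈ B j ∧ F x = y := fun j hj => hj
      choose! f hf using h2
      have hinj : InjOn f (s.filter fun j => y ∈ F '' B j) := by
        intro i hi j hj hij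
        have hi' := (hf i (Finset.mem_filter.1 hi).2).1
        have hj' := (hf j (Finset.mem_filter.1 hj).2).1
        by_contra hne
        exact (disjoint_left.1 (disjoint_disjointed K hne)) hi' (hij ▸ hj')
      have h3 := hn ((s.filter fun j => y ∈ F '' B j).image f)
        (fun a ha => by
          obtain ⟨j, hj, rfl⟩ := Finset.mem_image.1 ha
          exact mem_iUnion.2 ⟨j, hBK j (hf j (Finset.mem_filter.1 hj).2).1⟩)
        (fun a ha b hb => by
          obtain ⟨i, hi, rfl⟩ := Finset.mem_image.1 ha
          obtain ⟨j, hj, rfl⟩ := Finset.mem_image.1 hb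
          rw [(hf i (Finset.mem_filter.1 hi).2).2, (hf j (Finset.mem_filter.1 hj).2).2])
      rw [Finset.card_image_of_injOn hinj] at h3
      by_cases hy : y ∈ F '' ⋃ j, K j
      · rw [indicator_of_mem hy]
        exact_mod_cast h3
      · have : (s.filter fun j => y ∈ F '' B j) = ∅ := by
          refine Finset.filter_eq_empty_iff.2 fun j _ hj => hy ?_
          exact image_mono ((hBK j).trans (subset_iUnion K j)) hj
        rw [this]
        simp
    _ = _ := by rw [lintegral_indicator_const hmeasE]

/-- The `k`-dimensional Hausdorff measure of a subset of a cube. -/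
theorem hausdorffMeasure_le_of_cube {k : ℕ} {r : ℝ} (hr : 0 ≤ r) (a : Fin k → ℝ)
    {S : Set (EuclideanSpace ℝ (Fin k))} (hS : ∀ x ∈ S, ∀ i, |x i - a i| ≤ r) :
    Measure.hausdorffMeasure (k : ℝ) S ≤ ENNReal.ofReal ((2 * Real.sqrt k * r) ^ k) := by
  set Q : Set (Fin k → ℝ) := univ.pi fun i => Icc (a i - r) (a i + r) with hQ
  have hlip : LipschitzOnWith (Real.sqrt k).toNNReal
      (WithLp.toLp 2 : (Fin k → ℝ) → EuclideanSpace ℝ (Fin k)) Q := by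
    refine LipschitzOnWith.of_dist_le_mul fun x _ y _ => ?_
    rw [Real.coe_toNNReal _ (Real.sqrt_nonneg _), EuclideanSpace.dist_eq]
    refine Real.sqrt_le_iff.2 ⟨by positivity, ?_⟩
    rw [mul_pow, Real.sq_sqrt (Nat.cast_nonneg k)]
    calc _ ≤ ∑ _i : Fin k, dist x y ^ 2 :=
          Finset.sum_le_sum fun i _ => pow_le_pow_left₀ dist_nonneg (dist_le_pi_dist x y i) 2
      _ = k * dist x y ^ 2 := by simp
  have hsub : S ⊆ WithLp.toLp 2 '' Q := by
    intro x hx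
    refine ⟨x.ofLp, fun i _ => ?_, rfl⟩
    have := abs_le.1 (hS x hx i)
    exact ⟨by linarith, by linarith⟩
  refine (measure_mono hsub).trans
    ((hlip.hausdorffMeasure_image_le (d := (k : ℝ)) (Nat.cast_nonneg k)).trans_eq ?_)
  have hvol : (Measure.hausdorffMeasure (k : ℝ) : Measure (Fin k → ℝ)) = volume := by
    have := hausdorffMeasure_pi_real (ι := Fin k)
    rwa [Fintype.card_fin] at this
  rw [hvol, hQ, volume_pi_pi]
  have hlen : ∀ i, volume (Icc (a i - r) (a i + r)) = ENNReal.ofReal (2 * r) := fun i => by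
    rw [Real.volume_Icc]
    congr 1
    ring
  simp only [hlen, Finset.prod_const, Finset.card_univ, Fintype.card_fin]
  rw [ENNReal.rpow_natCast, ← mul_pow, ENNReal.ofReal_pow (by positivity),
    show 2 * Real.sqrt k * r = Real.sqrt k * (2 * r) by ring,
    ENNReal.ofReal_mul (Real.sqrt_nonneg _)]
  rfl

theorem volume_ball_div_le (k : ℕ) :
    volume (Metric.ball (0 : EuclideanSpace ℝ (Fin k)) 1) / 2 ^ k ≤ 1 := by
  refine ENNReal.div_le_of_le_mul ?_
  rw [one_mul]
  set Q : Set (Fin k → ℝ) := univ.pi fun _ => Icc (-1) 1 with hQ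
  have hmp := EuclideanSpace.volume_preserving_symm_measurableEquiv_toLp (Fin k)
  have hQm : MeasurableSet Q := MeasurableSet.univ_pi fun _ => measurableSet_Icc
  have : Metric.ball (0 : EuclideanSpace ℝ (Fin k)) 1 ⊆
      (MeasurableEquiv.toLp 2 (Fin k → ℝ)).symm ⁻¹' Q := by
    intro x hx i _
    have h1 : ‖x i‖ ≤ ‖x‖ := PiLp.norm_apply_le x i
    rw [mem_ball_zero_iff] at hx
    exact abs_le.1 (h1.trans hx.le)
  refine (measure_mono this).trans ?_
  rw [hmp.measure_preimage hQm.nullMeasurableSet, hQ, volume_pi_pi]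
  simp only [Real.volume_Icc, Finset.prod_const, Finset.card_univ, Fintype.card_fin]
  norm_num

end

theorem hausdorffMeasure_apply (k : ℕ) (X : Type*) [MetricSpace X] [MeasurableSpace X]
    [BorelSpace X] (S : Set X) : hausdorffMeasure k X S =
      volume (Metric.ball (0 : EuclideanSpace ℝ (Fin k)) 1) / 2 ^ k *
        Measure.hausdorffMeasure (k : ℝ) S := by
  rw [hausdorffMeasure, Measure.smul_apply, smul_eq_mul]

theorem hausdorffMeasure_image_distMap_le {X : Type u} [MetricSpace X] {x₀ : X} {r₀ : ℝ} {k : ℕ}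
    (hr₀ : 0 ≤ r₀) (p : Fin k → X) {E : Set X} (hE : E ⊆ Metric.ball x₀ r₀) :
    hausdorffMeasure k (EuclideanSpace ℝ (Fin k)) (distMap p '' E) ≤
      ENNReal.ofReal ((2 * Real.sqrt k * r₀) ^ k) := by
  rw [hausdorffMeasure_apply]
  refine (mul_le_mul' (volume_ball_div_le k) (hausdorffMeasure_le_of_cube hr₀
    (fun i => dist (p i) x₀) ?_)).trans_eq (one_mul _)
  rintro _ ⟨x, hx, rfl⟩ i
  have h1 := abs_dist_sub_dist_le (p i) x x₀
  exact h1.trans (Metric.mem_ball.1 (hE hx)).le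

theorem finite_and_ncard_le {X : Type*} {S : Set X} {n : ℕ}
    (h : ∀ A : Finset X, ↑A ⊆ S → A.card ≤ n) : S.Finite ∧ S.ncard ≤ n := by
  have hfin : S.Finite := by
    by_contra hinf
    obtain ⟨A, hA, hcard⟩ := Set.Infinite.exists_subset_card_eq hinf (n + 1)
    have := h A hA
    omega
  refine ⟨hfin, ?_⟩
  rw [Set.ncard_eq_toFinset_card S hfin]
  exact h _ (by simp)

end GCBA

end

open GCBA

theorem theorem1p7 :
    (∀ (N : ℕ) (δ : ℝ), 0 < δ → ∃ C : ℝ, 0 < C ∧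
      ∀ (X : Type u) [MetricSpace X] [MeasurableSpace X] [BorelSpace X]
        (κ : ℝ) (x₀ : X) (r₀ : ℝ) (k : ℕ) (p : Fin k → X) (V : Set X),
        GCBA.IsGCBA κ X → GCBA.IsTinyBall κ x₀ r₀ → GCBA.CapacityBoundedBy N x₀ r₀ →
        GCBA.IsStrainerMap x₀ r₀ δ p V →
        (∀ y : EuclideanSpace ℝ (Fin k),
          (GCBA.nonExtendable x₀ r₀ (12 * δ) p V ∩ GCBA.distMap p ⁻¹' {y}).Finite ∧
          ((GCBA.nonExtendable x₀ r₀ (12 * δ) p V ∩ GCBA.distMap p ⁻¹' {y}).ncard : ℝ) ≤ C) ∧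
        (∃ K : ℕ → Set X,
          (∀ j, IsCompact (K j) ∧ GCBA.BiLipschitzOn C (GCBA.distMap p) (K j)) ∧
          GCBA.nonExtendable x₀ r₀ (12 * δ) p V = ⋃ j, K j) ∧
        GCBA.hausdorffMeasure k X (GCBA.nonExtendable x₀ r₀ (12 * δ) p V) ≤
          ENNReal.ofReal (C ^ (k + 1)) *
            GCBA.hausdorffMeasure k (EuclideanSpace ℝ (Fin k))
              (GCBA.distMap p '' GCBA.nonExtendable x₀ r₀ (12 * δ) p V) ∧
        ENNReal.ofReal (C ^ (k + 1)) *
            GCBA.hausdorffMeasure k (EuclideanSpace ℝ (Fin k))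
              (GCBA.distMap p '' GCBA.nonExtendable x₀ r₀ (12 * δ) p V) ≤
          ENNReal.ofReal (C ^ (2 * k + 1) * 10 * r₀ ^ k) ∧
        (∃ K : ℕ → Set X,
          (∀ j, IsCompact (K j) ∧ GCBA.BiLipschitzOn C (GCBA.distMap p) (K j)) ∧
          V \ GCBA.strainedPoints X (k + 1) (12 * δ) = ⋃ j, K j) ∧
        GCBA.hausdorffMeasure k X (V \ GCBA.strainedPoints X (k + 1) (12 * δ)) ≤
          ENNReal.ofReal (C ^ (2 * k + 1) * 10 * r₀ ^ k)) ∧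
    (∀ (X : Type u) [MetricSpace X] (κ : ℝ) (x₀ : X) (r₀ δ : ℝ) (k : ℕ) (p : Fin k → X)
        (V : Set X), 0 < δ → GCBA.IsGCBA κ X → GCBA.IsTinyBall κ x₀ r₀ →
        GCBA.IsStrainerMap x₀ r₀ δ p V →
        ∃ (L : ℝ) (K : ℕ → Set X), 0 < L ∧
          (∀ j, IsCompact (K j) ∧ GCBA.BiLipschitzOn L (GCBA.distMap p) (K j)) ∧
          V \ GCBA.strainedPoints X (k + 1) (12 * δ) = ⋃ j, K j) := by
  refine ⟨fun N δ hδ => ?_, exists_compact_pieces_of_isTinyBall⟩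
  obtain ⟨τ, c, hτ, hτ1, hc0, hc1, hcτ, hτδ⟩ := exists_constants hδ
  obtain ⟨n, hn⟩ := exists_card_fiber_le.{u} N hδ
  have hsN := Real.sqrt_nonneg (N : ℝ)
  have hn0 : (0 : ℝ) ≤ n := Nat.cast_nonneg n
  have hc' : 0 < 1 / c := by positivity
  set C : ℝ := n + 1 / c + 2 * Real.sqrt N with hC
  have hC0 : 0 < C := by positivity
  refine ⟨C, hC0, fun X _ _ _ κ x₀ r₀ k p V hX hU hN hF => ?_⟩
  have := hX.separable
  obtain ⟨m, h⟩ := hU.exists_comparisonBall hX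
  have hfiber := hn X x₀ r₀ m k p V h hN hF
  have hdich := h.nonExtendable_eq_empty_or_le hN hδ hF
  have hEU : nonExtendable x₀ r₀ (12 * δ) p V ⊆ Metric.ball x₀ r₀ := fun x hx => hF.subset hx.1
  have hsub : V \ strainedPoints X (k + 1) (12 * δ) ⊆ nonExtendable x₀ r₀ (12 * δ) p V :=
    diff_strainedPoints_subset (12 * δ) p V
  have hr₀ := hU.radius_pos
  have hsqrt : k ≤ N → Real.sqrt k ≤ Real.sqrt N := fun hk =>
    Real.sqrt_le_sqrt (Nat.cast_le.2 hk)
  have hpieces : ∃ K : ℕ → Set X, (∀ j, IsCompact (K j) ∧ BiLipschitzOn C (distMap p) (K j)) ∧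
      nonExtendable x₀ r₀ (12 * δ) p V = ⋃ j, K j := by
    rcases hdich with he | hk
    · exact ⟨fun _ => ∅, fun _ => ⟨isCompact_empty, fun x hx => hx.elim⟩, by rw [he]; simp⟩
    · exact h.exists_compact_pieces hF hδ hτ hτ1 hc0 hc1 hcτ hτδ (by linarith)
        (by linarith [hsqrt hk])
  obtain ⟨K, hK, hE⟩ := hpieces
  have hmeas : hausdorffMeasure k X (nonExtendable x₀ r₀ (12 * δ) p V) ≤
      ENNReal.ofReal (C ^ (k + 1)) * hausdorffMeasure k (EuclideanSpace ℝ (Fin k))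
        (distMap p '' nonExtendable x₀ r₀ (12 * δ) p V) := by
    have h1 := hausdorffMeasure_le_of_biLipschitzOn hC0 (continuous_distMap p) (fun j => (hK j).1)
      (fun j => (hK j).2) (n := n) (by rwa [← hE]) k
    rw [← hE, ← mul_assoc] at h1
    have h2 : ENNReal.ofReal (C ^ k) * n ≤ ENNReal.ofReal (C ^ (k + 1)) := by
      rw [← ENNReal.ofReal_natCast n, ← ENNReal.ofReal_mul (by positivity), pow_succ]
      exact ENNReal.ofReal_le_ofReal (mul_le_mul_of_nonneg_left (by linarith) (by positivity))
    rw [hausdorffMeasure_apply, hausdorffMeasure_apply, mul_left_comm]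
    exact mul_le_mul_right (h1.trans (mul_le_mul_left h2 _)) _
  have himage : ENNReal.ofReal (C ^ (k + 1)) * hausdorffMeasure k (EuclideanSpace ℝ (Fin k))
      (distMap p '' nonExtendable x₀ r₀ (12 * δ) p V) ≤
      ENNReal.ofReal (C ^ (2 * k + 1) * 10 * r₀ ^ k) := by
    rcases hdich with he | hk
    · rw [he]; simp
    · refine (mul_le_mul_right (hausdorffMeasure_image_distMap_le hr₀.le p hEU) _).trans ?_
      rw [← ENNReal.ofReal_mul (by positivity)]
      refine ENNReal.ofReal_le_ofReal ?_
      have h1 : (2 * Real.sqrt k * r₀) ^ k ≤ (C * r₀) ^ k := by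
        have := hsqrt hk
        gcongr
        linarith
      calc C ^ (k + 1) * (2 * Real.sqrt k * r₀) ^ k ≤ C ^ (k + 1) * (C * r₀) ^ k := by gcongr
        _ = C ^ (2 * k + 1) * 1 * r₀ ^ k := by ring
        _ ≤ C ^ (2 * k + 1) * 10 * r₀ ^ k := by gcongr; norm_num
  refine ⟨fun y => ?_, ⟨K, hK, hE⟩, hmeas, himage, h.exists_compact_pieces_diff hF hK hE,
    (measure_mono hsub).trans (hmeas.trans himage)⟩
  have hcard := finite_and_ncard_le (S := nonExtendable x₀ r₀ (12 * δ) p V ∩ distMap p ⁻¹' {y})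
    (n := n) fun A hA => hfiber A (fun a ha => (hA ha).1) fun a ha b hb => by
      have e1 : distMap p a = y := (hA ha).2
      have e2 : distMap p b = y := (hA hb).2
      rw [e1, e2]
  refine ⟨hcard.1, ?_⟩
  have : ((nonExtendable x₀ r₀ (12 * δ) p V ∩ distMap p ⁻¹' {y}).ncard : ℝ) ≤ n :=
    Nat.cast_le.2 hcard.2
  linarith
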